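/- **Setting.** Let $\overline{D^2}\subset\mathbb R^2=\mathbb C$ and $\overline{B^3}\subset\mathbb R^3$ be the closed unit disc and ball. Identify $S^2=\partial B^3$ with $\widehat{\mathbb C}=\mathbb C\cup\{\infty\}$ by the stereographic projection that sends $(0,0,-1)$ to $\infty$ and the equator to the unit circle, so that $D^2\subset\mathbb C\subset S^2$; points of $\overline{B^3}$ are written $(\rho,u)$ with $\rho\in[0,1]$ the distance to the origin and $u\in S^2$, and $z=x+iy$ is the coordinate on $\mathbb C=S^2\setminus\{\infty\}$. ${\rm Diff}_+(M)$ is the group of orientation-preserving $C^\infty$ self-diffeomorphisms of $M$ (smooth up to the boundary). For a subgroup $\mathscr G\subset{\rm Diff}_+(M)$ let $\mathscr G_0$ be the set of $g\in\mathscr G$ for which there is a smooth map $H:M\times[0,1]\to M$ with $H_t\in\mathscr G$ for all $t$, $H_0=\mathrm{id}$ and $H_1=g$, and let $\mathscr G_{\rm bt}=\{g\in\mathscr G: g|_{\partial M}=\mathrm{id}\}$. * ${\rm Diff}_{+{\rm ar}}(\overline{D^2})$ is the set of $g\in{\rm Diff}_+(\overline{D^2})$ for which there are $\epsilon\in(0,1)$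 and $f\in{\rm Diff}_+(S^1)$ with $g(ru)=r\,f(u)$ for all $r\in(1-\epsilon,1]$, $u\in S^1$. Put $\mathcal G={\rm Diff}_{+{\rm ar}}(\overline{D^2})_0$ and $\mathcal H=\mathcal G_{\rm bt}$. * ${\rm Diff}_{\rm ci}(S^2)$ is the set of $B\in{\rm Diff}_+(S^2)$ whose support (the closure of $\{u: B(u)\ne u\}$) does not contain $\infty$. * ${\rm Diff}_{+*}(\overline{B^3})$ is the set of $\mathbf g\in{\rm Diff}_+(\overline{B^3})$ that are both asymptotically radial (there are $\epsilon\in(0,1)$ and a self-diffeomorphism $B$ of $S^2$ with $\mathbf g(\rho,u)=(\rho,B(u))$ for all $\rho\in(1-\epsilon,1]$, $u\in S^2$) and layered with compact-from-infinity supports (there are $B_\rho\in{\rm Diff}_{\rm ci}(S^2)$, $\rho\in[0,1]$, with $\mathbf g(\rho,u)=(\rho,B_\rho(u))$ for all $\rho\in[0,1]$, $u\in S^2$). * For $\mathbf g\in{\rm Diff}_{+*}(\overline{B^3})$ let $J(\mathbf g)$ be the $3\times3$ Jacobian matrix of $\mathbf g$ in the coordinates $(\rho,x,y)$, which cover $B^3$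 up to a null set, let $\theta(\mathbf g)=J(\mathbf g)^{-1}\,dJ(\mathbf g)$, and $$W(\mathbf g)=\int_{B^3}{\rm tr}\bigl(\theta(\mathbf g)^{\wedge 3}\bigr),$$ with the orientation $d\rho\wedge dx\wedge dy$, the coordinates ranging over $0<\rho<1$, $(x,y)\in\mathbb R^2$. * For $h\in\mathcal H$ let $B_h:S^2\to S^2$ be equal to $h$ on $D^2$ and to the identity elsewhere. **Proposition.** 1. The integral defining $W(\mathbf g)$ converges absolutely for every $\mathbf g\in{\rm Diff}_{+*}(\overline{B^3})_0$. 2. $W(\mathbf h)=0$ for every $\mathbf h\in({\rm Diff}_{+*}(\overline{B^3})_0)_{\rm bt}$. 3. If $\mathbf g_1,\mathbf g_2\in{\rm Diff}_{+*}(\overline{B^3})_0$ satisfy $\mathbf g_1|_{S^2}=\mathbf g_2|_{S^2}$, then $W(\mathbf g_1)=W(\mathbf g_2)$. 4. Every $B_h$, $h\in\mathcal H$, is the boundary value of some $\widetilde B_h\in{\rm Diff}_{+*}(\overline{B^3})_0$, and for every $c_0\in\mathbb R$ there is exactly one function $\omega_0:\mathcal H\to\mathbb R$ such that $\omega_0(h)=c_0\,W(\widetilde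 B_h)$ for every $h\in\mathcal H$ and every such extension $\widetilde B_h$ of $B_h$. So $\omega_0$ is well defined as a real-valued function, not only up to integers. -/

import Mathlib

open scoped ContDiff Manifold

noncomputable section

namespace WessZumino

/-- Standard Euclidean space `ℝⁿ`. -/
abbrev E (n : ℕ) : Type := EuclideanSpace ℝ (Fin n)

/-- The closed unit ball of `ℝⁿ` (for `n = 2` the closed disc). -/
abbrev Ball (n : ℕ) : Set (E n) := Metric.closedBall (0 : E n) 1

/-- The unit sphere `Sⁿ` in `ℝⁿ⁺¹`, with Mathlib's smooth manifold structure. -/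
abbrev S (n : ℕ) : Set (E (n + 1)) := Metric.sphere (0 : E (n + 1)) 1

/-! ### Diffeomorphism groups of the closed ball -/

/-- A self-bijection of the closed ball, seen as a self-map of `ℝⁿ`.  The values outside of the
closed ball are irrelevant: only the restriction to the closed ball is ever used. -/
def ext {n : ℕ} (g : Equiv.Perm (Ball n)) (x : E n) : E n :=
  open Classical in if h : x ∈ Ball n then (g ⟨x, h⟩ : E n) else x

/-- `Diff₊` of the closed ball: the orientation-preserving smooth self-diffeomorphisms of the closed
ball, as a manifold with boundary (smooth means: smooth up to the boundary). -/
def DiffPlus (n : ℕ) : Set (Equiv.Perm (Ball n)) :=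
  {g | ContDiffOn ℝ ∞ (ext g) (Ball n) ∧ ContDiffOn ℝ ∞ (ext g⁻¹) (Ball n) ∧
    ∀ x ∈ Ball n, 0 < (fderivWithin ℝ (ext g) (Ball n) x).det}

/-- `𝒢₀`: the elements `g` of a set `𝒢` of diffeomorphisms of the closed ball for which there is a
smooth isotopy `H : ball × [0,1] → ball` inside `𝒢` from the identity to `g`. -/
def idComponent {n : ℕ} (𝒢 : Set (Equiv.Perm (Ball n))) : Set (Equiv.Perm (Ball n)) :=
  {g | ∃ H : ℝ → Equiv.Perm (Ball n),
    (∀ t ∈ Set.Icc (0 : ℝ) 1, H t ∈ 𝒢) ∧ H 0 = 1 ∧ H 1 = g ∧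
    ContDiffOn ℝ ∞ (fun p : E n × ℝ => ext (H p.2) p.1) (Ball n ×ˢ Set.Icc (0 : ℝ) 1)}

/-- `𝒢_bt`: the boundary-trivial elements of `𝒢`. -/
def boundaryTrivial {n : ℕ} (𝒢 : Set (Equiv.Perm (Ball n))) : Set (Equiv.Perm (Ball n)) :=
  {g ∈ 𝒢 | ∀ x ∈ Metric.sphere (0 : E n) 1, ext g x = x}

/-! ### Diffeomorphisms of spheres -/

/-- Smooth self-diffeomorphisms of the sphere `Sⁿ`. -/
abbrev SphereDiffeo (n : ℕ) : Type := Diffeomorph (𝓡 n) (𝓡 n) (S n) (S n) ∞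

/-- The extension of a self-map of the sphere to a positively homogeneous self-map of `ℝⁿ⁺¹`. -/
def radialExtension {n : ℕ} (B : S n → S n) (x : E (n + 1)) : E (n + 1) :=
  open Classical in
  if h : x = 0 then 0
  else ‖x‖ • (B ⟨‖x‖⁻¹ • x, by simp [norm_smul, h]⟩ : E (n + 1))

/-- A self-diffeomorphism of the sphere preserves the orientation: its radial extension, which maps
the outward unit normal at `u` to the outward unit normal at `B u` and restricts on the tangent
space at `u` to the differential of `B`, has positive Jacobian determinant. -/
def OrientationPreserving {n : ℕ} (B : SphereDiffeo n) : Prop :=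
  ∀ u : S n, 0 < (fderiv ℝ (radialExtension B) (u : E (n + 1))).det

/-- `g` is radial on the collar `1 - ε < ρ ≤ 1` of the boundary, with boundary value `B`. -/
def RadialOnCollar {n : ℕ} (g : Equiv.Perm (Ball (n + 1))) (B : SphereDiffeo n) (ε : ℝ) : Prop :=
  ∀ ρ ∈ Set.Ioc (1 - ε) 1, ∀ u : S n, ext g (ρ • (u : E (n + 1))) = ρ • (B u : E (n + 1))

/-! ### The disc -/

/-- `Diff_{+ar}` of the closed disc: `g (r e^{iθ}) = r e^{i f(θ)}` near the boundary, for some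
orientation-preserving diffeomorphism `f` of the circle. -/
def DiscDiffAR : Set (Equiv.Perm (Ball 2)) :=
  {g ∈ DiffPlus 2 | ∃ f : SphereDiffeo 1, OrientationPreserving f ∧
    ∃ ε ∈ Set.Ioo (0 : ℝ) 1, RadialOnCollar g f ε}

/-- The group `𝒢 = Diff_{+ar}(disc)₀`. -/
def GroupG : Set (Equiv.Perm (Ball 2)) := idComponent DiscDiffAR

/-- The group `ℋ = 𝒢_bt`. -/
def GroupH : Set (Equiv.Perm (Ball 2)) := boundaryTrivial GroupG

/-! ### The sphere `S²` as the Riemann sphere -/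

/-- The inverse stereographic projection `ℂ → S² ⊂ ℝ³`; the point at infinity is `(0, 0, -1)` and the
unit circle is the equator.  It carries the orientation of `ℂ` to the boundary orientation of `S²`. -/
def invStereo (z : E 2) : E 3 :=
  (1 + ‖z‖ ^ 2)⁻¹ • !₂[2 * z 0, 2 * z 1, 1 - ‖z‖ ^ 2]

/-- For `p` in `ℝ³` not on the closed ray from the origin through the point at infinity of `S²`, the
stereographic coordinate `(x, y)` of `p / ‖p‖`. -/
def stereo (p : E 3) : E 2 :=
  !₂[p 0 / (‖p‖ + p 2), p 1 / (‖p‖ + p 2)]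

/-- The point at infinity of the Riemann sphere. -/
def infinity : E 3 := !₂[0, 0, -1]

/-- `Diff_ci(S²)`: orientation-preserving diffeomorphisms of `S²` that are compactly supported from
infinity. -/
def DiffCI : Set (SphereDiffeo 2) :=
  {B | OrientationPreserving B ∧ IsCompact (closure {u : S 2 | B u ≠ u}) ∧
    ∀ u ∈ closure {u : S 2 | B u ≠ u}, (u : E 3) ≠ infinity}

/-! ### The ball `B³` -/

/-- `Diff_{+ar}` of the closed 3-ball: the asymptotically radial elements. -/
def BallDiffAR : Set (Equiv.Perm (Ball 3)) :=
  {g ∈ DiffPlus 3 | ∃ B : SphereDiffeo 2, ∃ ε ∈ Set.Ioo (0 : ℝ) 1, RadialOnCollar g B ε}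

/-- `Diff_lci` of the closed 3-ball: layered with compact-from-infinity supports. -/
def BallDiffLCI : Set (Equiv.Perm (Ball 3)) :=
  {g ∈ DiffPlus 3 | ∃ B : ℝ → SphereDiffeo 2, ∀ ρ ∈ Set.Icc (0 : ℝ) 1, B ρ ∈ DiffCI ∧
    ∀ u : S 2, ext g (ρ • (u : E 3)) = ρ • (B ρ u : E 3)}

/-- `Diff_{+*}` of the closed 3-ball. -/
def BallDiffStar : Set (Equiv.Perm (Ball 3)) := BallDiffAR ∩ BallDiffLCI

/-- `Diff_{+*}(closed 3-ball)₀`. -/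
def BallDiffStarZero : Set (Equiv.Perm (Ball 3)) := idComponent BallDiffStar

/-! ### The Wess-Zumino term -/

/-- The Jacobian matrix `(∂_j F_i)_{i,j}`. -/
def jacobian {n : ℕ} (F : E n → E n) (p : E n) : Matrix (Fin n) (Fin n) ℝ :=
  Matrix.of fun i j => fderiv ℝ F p (EuclideanSpace.single j 1) i

/-- The matrix-valued 1-form `θ(F) = J(F)⁻¹ dJ(F)`, at the point `p` and on the vector `v`. -/
def theta {n : ℕ} (F : E n → E n) (p v : E n) : Matrix (Fin n) (Fin n) ℝ :=
  (jacobian F p)⁻¹ * Matrix.of fun i j => fderiv ℝ (fun q => jacobian F q i j) p v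

/-- The wedge cube `α ∧ α ∧ α` of a matrix-valued 1-form `α` (at one point), on three vectors. -/
def wedgeCube {V : Type*} {n : ℕ} (α : V → Matrix (Fin n) (Fin n) ℝ) (v : Fin 3 → V) :
    Matrix (Fin n) (Fin n) ℝ :=
  ∑ σ : Equiv.Perm (Fin 3), (Equiv.Perm.sign σ : ℤ) • (α (v (σ 0)) * α (v (σ 1)) * α (v (σ 2)))

/-- The point of the closed 3-ball with coordinates `(ρ, x, y)`. -/
def fromCoords (p : E 3) : E 3 := p 0 • invStereo !₂[p 1, p 2]

/-- The coordinates `(ρ, x, y)` of a point. -/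
def toCoords (q : E 3) : E 3 := !₂[‖q‖, stereo q 0, stereo q 1]

/-- A self-map of the closed 3-ball written in the coordinates `(ρ, x, y)`. -/
def inCoords (g : Equiv.Perm (Ball 3)) (p : E 3) : E 3 := toCoords (ext g (fromCoords p))

/-- The range `0 < ρ < 1`, `(x, y) ∈ ℝ²` of the coordinates: they cover the open 3-ball but for the
null set formed by the radius that ends at the point at infinity of `S²`. -/
def coordDomain : Set (E 3) := {p | 0 < p 0 ∧ p 0 < 1}

/-- The coefficient of `dρ ∧ dx ∧ dy` in the 3-form `tr (θ(g)^{∧3})`. -/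
def density (g : Equiv.Perm (Ball 3)) (p : E 3) : ℝ :=
  (wedgeCube (theta (inCoords g) p) fun k => EuclideanSpace.single k 1).trace

/-- The Wess-Zumino term `W(g) = ∫_{B³} tr (θ(g)^{∧3})`. -/
def W (g : Equiv.Perm (Ball 3)) : ℝ :=
  ∫ p in coordDomain, density g p

/-- `B_h : S² → S²`: equal to `h` on the open unit disc, and to the identity elsewhere. -/
def extendToSphere (h : Equiv.Perm (Ball 2)) (u : E 3) : E 3 :=
  open Classical in
  if u ∈ invStereo '' Metric.ball (0 : E 2) 1 then invStereo (ext h (stereo u)) else u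

/-- The extensions of `B_h` to elements of `Diff_{+*}(closed 3-ball)₀`. -/
def extensions (h : Equiv.Perm (Ball 2)) : Set (Equiv.Perm (Ball 3)) :=
  {g ∈ BallDiffStarZero | ∀ u ∈ Metric.sphere (0 : E 3) 1, ext g u = extendToSphere h u}

end WessZumino

end

noncomputable section

namespace WessZumino

open Set Filter Topology MeasureTheory

/-! ### Parameter-dependent interval integrals -/

/-! A layered map reads `(ρ, z) ↦ (ρ, z + shift)` in coordinates, so its Jacobian matrix is block
lower triangular with corner entry 1, and `tr θ³` only sees the 2×2 block `A` of derivatives in `z`.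
The density is thus the pullback under `A` of the invariant 3-form `tr (A⁻¹ dA)³` on `GL₂⁺(ℝ)`. This
group is homotopy equivalent to a circle, so the form is exact, and a primitive can be written down.
Split `A` into its complex linear part `p + iq` and its antilinear part `r + is`. Then `det A = p² +
q² - r² - s² > 0` forces `p + iq ≠ 0`. With the closed form `φ = (p dq - q dp) / (p² + q²)` and `σ =
(r ds - s dr) / det A` one finds `tr θ³ = 6 φ ∧ dσ = -6 d(φ ∧ σ)` (`trace_wedgeCube_eq_rowDet`,
`angular_wedge_eq_rowDet`, `rowDet_eq_div_primitive`). The primitive is global, which is why no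
integer ambiguity appears.

By Stokes only boundary terms count. At `z = ∞` there are none: each layer is the identity near the
pole, and although the size of this neighbourhood may depend on `ρ`, smoothness makes the
displacement flat along the whole polar axis (`flat_of_slices`, `Layered.flat_displacementSouth`),
and flatness at `w = 0` is rapid decay in `z = w / |w|²` (`Flat.growth_comp_inversion`). This also
gives absolute convergence. At `ρ = 0` there is none either: the rescaled layers tend to the
derivative at the origin, a linear map which agrees with the identity to second order at the pole
and hence is the identity (`Layered.fderiv_zero`). At `ρ = 1` the term involves the boundary value
alone, because the map is radial on a collar. So `W` depends only on the boundary value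
(`Layered.W_eq`).

For the existence of an extension, an isotopy in the disc from the identity to `h` is continued to
the plane by rotating circles through the angle swept by the boundary points, cut off away from the
unit circle. A full rotation of the isotopy is removed first, so that the swept angle is zero at
time one (`exists_isAngle_eq_zero`, `contDiff_planeIsotopy`). The resulting isotopy of the sphere is
then run along the radius of the ball (`PlaneIsotopy.ballIsotopy`). -/

theorem hasFDerivAt_intervalIntegral_of_contDiffOn {X F : Type*} [NormedAddCommGroup X]
    [NormedSpace ℝ X] [FiniteDimensional ℝ X] [NormedAddCommGroup F] [NormedSpace ℝ F]
    {O : Set X} (hO : IsOpen O) {f : ℝ → X → F}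
    (hf : ContDiffOn ℝ 1 (fun q : ℝ × X => f q.1 q.2) (univ ×ˢ O)) {x : X} (hx : x ∈ O) :
    HasFDerivAt (fun x => ∫ t in (0 : ℝ)..1, f t x)
      (∫ t in (0 : ℝ)..1, (fderiv ℝ (fun q : ℝ × X => f q.1 q.2) (t, x)).comp
        (ContinuousLinearMap.inr ℝ ℝ X)) x := by
  have hop : IsOpen ((univ : Set ℝ) ×ˢ O) := isOpen_univ.prod hO
  have hcont : ∀ y ∈ O, Continuous fun t => f t y := fun y hy =>
    hf.continuousOn.comp_continuous (f := fun t : ℝ => (t, y)) (by fun_prop) fun t => ⟨trivial, hy⟩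
  have hd : ContinuousOn (fun q : ℝ × X => (fderiv ℝ (fun q : ℝ × X => f q.1 q.2) q).comp
      (ContinuousLinearMap.inr ℝ ℝ X)) (univ ×ˢ O) :=
    (hf.continuousOn_fderiv_of_isOpen hop le_rfl).clm_comp continuousOn_const
  obtain ⟨r, hr, hrO⟩ := Metric.nhds_basis_closedBall.mem_iff.1 (hO.mem_nhds hx)
  -- Compactness of `[0,1]` times a closed ball inside `O` turns continuity of the partial
  -- derivative into a constant dominating function.
  obtain ⟨C, hC⟩ := ((isCompact_Icc (a := (0 : ℝ)) (b := 1)).prod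
    (isCompact_closedBall x r)).exists_bound_of_continuousOn
      (hd.mono (prod_mono (subset_univ _) hrO))
  refine intervalIntegral.hasFDerivAt_integral_of_dominated_of_fderiv_le (F' := fun y t =>
    (fderiv ℝ (fun q : ℝ × X => f q.1 q.2) (t, y)).comp (ContinuousLinearMap.inr ℝ ℝ X))
    (bound := fun _ => C) (Metric.closedBall_mem_nhds x hr) ?_
    ((hcont x hx).intervalIntegrable _ _) ?_ ?_ (by simp) ?_
  · filter_upwards [hO.mem_nhds hx] with y hy using (hcont y hy).aestronglyMeasurable
  · exact (hd.comp_continuous (f := fun t : ℝ => (t, x)) (by fun_prop)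
      fun t => ⟨trivial, hx⟩).aestronglyMeasurable
  · refine Eventually.of_forall fun t ht y hy => hC (t, y) ⟨?_, hy⟩
    rw [uIoc_of_le zero_le_one] at ht
    exact Ioc_subset_Icc_self ht
  · refine Eventually.of_forall fun t ht y hy => ?_
    have h1 : HasFDerivAt (fun q : ℝ × X => f q.1 q.2) _ (t, y) :=
      ((hf.contDiffAt (hop.mem_nhds ⟨trivial, hrO hy⟩)).differentiableAt one_ne_zero).hasFDerivAt
    exact h1.comp y (hasFDerivAt_prodMk_right t y)

/-- A directional derivative of the integral is again an integral of the same kind, with a smooth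
integrand, so induction on the order applies. The interval is fixed to `[0,1]`; variable endpoints
are moved into the integrand by scaling. -/
theorem contDiffOn_intervalIntegral {X F : Type*} [NormedAddCommGroup X]
    [NormedSpace ℝ X] [FiniteDimensional ℝ X] [NormedAddCommGroup F] [NormedSpace ℝ F]
    [CompleteSpace F] {O : Set X} (hO : IsOpen O) {f : ℝ → X → F}
    (hf : ContDiffOn ℝ ∞ (fun q : ℝ × X => f q.1 q.2) (univ ×ˢ O)) :
    ContDiffOn ℝ ∞ (fun x => ∫ t in (0 : ℝ)..1, f t x) O := by
  refine contDiffOn_infty.2 fun n => ?_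
  have hop : IsOpen ((univ : Set ℝ) ×ˢ O) := isOpen_univ.prod hO
  induction n generalizing f with
  | zero =>
    refine contDiffOn_zero.2 fun x hx => ?_
    exact (hasFDerivAt_intervalIntegral_of_contDiffOn hO (hf.of_le (by simp))
      hx).continuousAt.continuousWithinAt
  | succ n ih =>
    have key := fun x (hx : x ∈ O) =>
      hasFDerivAt_intervalIntegral_of_contDiffOn hO (hf.of_le (by simp)) hx
    push_cast
    rw [contDiffOn_succ_iff_fderiv_apply hO.uniqueDiffOn]
    refine ⟨fun x hx => (key x hx).differentiableAt.differentiableWithinAt, by simp, fun v => ?_⟩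
    refine (ih (f := fun t x => fderiv ℝ (fun q : ℝ × X => f q.1 q.2) (t, x) (0, v)) ?_).congr ?_
    · exact (hf.fderiv_of_isOpen hop (m := ∞) le_rfl).clm_apply contDiffOn_const
    · intro x hx
      have hc : Continuous fun t : ℝ => (fderiv ℝ (fun q : ℝ × X => f q.1 q.2) (t, x)).comp
          (ContinuousLinearMap.inr ℝ ℝ X) :=
        ((hf.continuousOn_fderiv_of_isOpen hop (by simp)).clm_comp
          continuousOn_const).comp_continuous (f := fun t : ℝ => (t, x)) (by fun_prop)
          fun t => ⟨trivial, hx⟩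
      rw [fderivWithin_of_isOpen hO hx, (key x hx).fderiv,
        ContinuousLinearMap.intervalIntegral_apply (hc.intervalIntegrable _ _)]
      rfl

/-! ### Directional derivatives within a set -/

variable {X : Type*} [NormedAddCommGroup X] [NormedSpace ℝ X]

/-- The directional derivative along `v` within `S`. -/
def dirD (S : Set X) (v : X) (f : X → ℝ) : X → ℝ := fun p => fderivWithin ℝ f S p v

theorem contDiffOn_dirD {S : Set X} (hS : UniqueDiffOn ℝ S) {f : X → ℝ} (hf : ContDiffOn ℝ ∞ f S)
    (v : X) : ContDiffOn ℝ ∞ (dirD S v f) S :=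
  (hf.fderivWithin hS (m := ∞) le_rfl).clm_apply contDiffOn_const

theorem dirD_congr {S : Set X} {f g : X → ℝ} (h : EqOn f g S) (v : X) :
    EqOn (dirD S v f) (dirD S v g) S := fun p hp => by
  simp only [dirD, fderivWithin_congr h (h hp)]

theorem hasFDerivWithinAt_of_smooth {S : Set X} {f : X → ℝ} (hf : ContDiffOn ℝ ∞ f S)
    {p : X} (hp : p ∈ S) : HasFDerivWithinAt f (fderivWithin ℝ f S p) S p :=
  ((hf p hp).differentiableWithinAt (by simp)).hasFDerivWithinAt

theorem two_le_infty : (2 : ℕ∞ω) ≤ ∞ := ENat.LEInfty.out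

theorem dirD_comm {S : Set X} (hS : UniqueDiffOn ℝ S) (hSc : S ⊆ closure (interior S))
    {f : X → ℝ} (hf : ContDiffOn ℝ ∞ f S) (v w : X) :
    EqOn (dirD S v (dirD S w f)) (dirD S w (dirD S v f)) S := by
  intro p hp
  have hsym := (hf p hp).isSymmSndFDerivWithinAt (by simpa using two_le_infty) hS (hSc hp) hp
  have hd : DifferentiableWithinAt ℝ (fderivWithin ℝ f S) S p :=
    ((hf.fderivWithin hS (m := ∞) le_rfl) p hp).differentiableWithinAt (by simp)
  have key : ∀ v w : X, dirD S v (dirD S w f) p = fderivWithin ℝ (fderivWithin ℝ f S) S p v w := by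
    intro v w
    have := (hd.hasFDerivWithinAt.clm_apply (hasFDerivWithinAt_const w p S)).fderivWithin (hS p hp)
    have h2 : dirD S v (dirD S w f) p =
      fderivWithin ℝ (fun q => fderivWithin ℝ f S q w) S p v := rfl
    rw [h2, this]
    simp
  rw [key, key, hsym.eq]

theorem dirD_mul {S : Set X} (hS : UniqueDiffOn ℝ S) {f g : X → ℝ} (hf : ContDiffOn ℝ ∞ f S)
    (hg : ContDiffOn ℝ ∞ g S) (v : X) :
    EqOn (dirD S v (fun p => f p * g p)) (fun p => f p * dirD S v g p + dirD S v f p * g p) S := by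
  intro p hp
  have := ((hasFDerivWithinAt_of_smooth hf hp).mul (hasFDerivWithinAt_of_smooth hg hp)).fderivWithin
    (hS p hp)
  simp only [dirD]
  rw [show (fun p => f p * g p) = f * g from rfl, this]
  simp [mul_comm]

theorem dirD_add {S : Set X} (hS : UniqueDiffOn ℝ S) {f g : X → ℝ} (hf : ContDiffOn ℝ ∞ f S)
    (hg : ContDiffOn ℝ ∞ g S) (v : X) :
    EqOn (dirD S v (fun p => f p + g p)) (fun p => dirD S v f p + dirD S v g p) S := by
  intro p hp
  have := ((hasFDerivWithinAt_of_smooth hf hp).add (hasFDerivWithinAt_of_smooth hg hp)).fderivWithin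
    (hS p hp)
  simp only [dirD]
  rw [show (fun p => f p + g p) = f + g from rfl, this]
  simp

/-! ### Functions that are flat along a set -/

/-- All derivatives of order at most `n` within `S` vanish on `A`. -/
def VanishOn (S A : Set X) : ℕ → (X → ℝ) → Prop
  | 0, f => ∀ a ∈ A, f a = 0
  | n + 1, f => (∀ a ∈ A, f a = 0) ∧ ∀ v, VanishOn S A n (dirD S v f)

/-- Smooth functions on `S` all of whose derivatives vanish on `A`. -/
structure Flat (S A : Set X) (f : X → ℝ) : Prop where
  smooth : ContDiffOn ℝ ∞ f S
  vanish : ∀ n, VanishOn S A n f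

theorem Flat.eq_zero {S A : Set X} {f : X → ℝ} (h : Flat S A f) {a : X} (ha : a ∈ A) : f a = 0 :=
  h.vanish 0 a ha

theorem Flat.deriv {S A : Set X} (hS : UniqueDiffOn ℝ S) {f : X → ℝ} (h : Flat S A f) (v : X) :
    Flat S A (dirD S v f) :=
  ⟨contDiffOn_dirD hS h.smooth v, fun n => (h.vanish (n + 1)).2 v⟩

theorem VanishOn.congr {S A : Set X} (hA : A ⊆ S) {n : ℕ} {f g : X → ℝ} (h : VanishOn S A n f)
    (hfg : EqOn f g S) : VanishOn S A n g := by
  induction n generalizing f g with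
  | zero => exact fun a ha => (hfg (hA ha)).symm.trans (h a ha)
  | succ n ih =>
    exact ⟨fun a ha => (hfg (hA ha)).symm.trans (h.1 a ha), fun v => ih (h.2 v) (dirD_congr hfg v)⟩

theorem VanishOn.of_succ {S A : Set X} {n : ℕ} {f : X → ℝ} (h : VanishOn S A (n + 1) f) :
    VanishOn S A n f := by
  induction n generalizing f with
  | zero => exact h.1
  | succ n ih => exact ⟨h.1, fun v => ih (h.2 v)⟩

theorem VanishOn.add {S A : Set X} (hS : UniqueDiffOn ℝ S) (hA : A ⊆ S) {n : ℕ} {f g : X → ℝ}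
    (hf : VanishOn S A n f) (hg : VanishOn S A n g) (hfs : ContDiffOn ℝ ∞ f S)
    (hgs : ContDiffOn ℝ ∞ g S) : VanishOn S A n (fun p => f p + g p) := by
  induction n generalizing f g with
  | zero => intro a ha; simp [hf a ha, hg a ha]
  | succ n ih =>
    refine ⟨fun a ha => by simp [hf.1 a ha, hg.1 a ha], fun v => ?_⟩
    exact (ih (hf.2 v) (hg.2 v) (contDiffOn_dirD hS hfs v) (contDiffOn_dirD hS hgs v)).congr hA
      (dirD_add hS hfs hgs v).symm

/-- Leibniz rule: every term keeps some derivative of `g`, so flatness of one factor suffices. -/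
theorem VanishOn.mul {S A : Set X} (hS : UniqueDiffOn ℝ S) (hA : A ⊆ S) {n : ℕ} {f g : X → ℝ}
    (hg : VanishOn S A n g) (hfs : ContDiffOn ℝ ∞ f S)
    (hgs : ContDiffOn ℝ ∞ g S) : VanishOn S A n (fun p => f p * g p) := by
  induction n generalizing f g with
  | zero => intro a ha; simp [hg a ha]
  | succ n ih =>
    refine ⟨fun a ha => by simp [hg.1 a ha], fun v => ?_⟩
    exact ((ih (hg.2 v) hfs (contDiffOn_dirD hS hgs v)).add hS hA
      (ih hg.of_succ (contDiffOn_dirD hS hfs v) hgs) (hfs.mul (contDiffOn_dirD hS hgs v))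
      ((contDiffOn_dirD hS hfs v).mul hgs)).congr hA (dirD_mul hS hfs hgs v).symm

theorem Flat.add {S A : Set X} (hS : UniqueDiffOn ℝ S) (hA : A ⊆ S) {f g : X → ℝ}
    (hf : Flat S A f) (hg : Flat S A g) : Flat S A (fun p => f p + g p) :=
  ⟨hf.smooth.add hg.smooth, fun n => (hf.vanish n).add hS hA (hg.vanish n) hf.smooth hg.smooth⟩

theorem Flat.mul_left {S A : Set X} (hS : UniqueDiffOn ℝ S) (hA : A ⊆ S) {f g : X → ℝ}
    (hf : ContDiffOn ℝ ∞ f S) (hg : Flat S A g) : Flat S A (fun p => f p * g p) :=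
  ⟨hf.mul hg.smooth, fun n => (hg.vanish n).mul hS hA hf hg.smooth⟩

/-- Iterated directional derivative. -/
def iterD (S : Set X) : List X → (X → ℝ) → (X → ℝ)
  | [], f => f
  | v :: L, f => iterD S L (dirD S v f)

theorem contDiffOn_iterD {S : Set X} (hS : UniqueDiffOn ℝ S) {f : X → ℝ} (hf : ContDiffOn ℝ ∞ f S)
    (L : List X) : ContDiffOn ℝ ∞ (iterD S L f) S := by
  induction L generalizing f with
  | nil => exact hf
  | cons v L ih => exact ih (contDiffOn_dirD hS hf v)

theorem iterD_congr {S : Set X} {f g : X → ℝ} (h : EqOn f g S) (L : List X) :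
    EqOn (iterD S L f) (iterD S L g) S := by
  induction L generalizing f g with
  | nil => exact h
  | cons v L ih => exact ih (dirD_congr h v)

/-- For moving a transversal derivative to the outermost place, where it can be computed along a
transversal line. -/
theorem iterD_dirD {S : Set X} (hS : UniqueDiffOn ℝ S) (hSc : S ⊆ closure (interior S))
    {f : X → ℝ} (hf : ContDiffOn ℝ ∞ f S) (L : List X) (e : X) :
    EqOn (iterD S L (dirD S e f)) (dirD S e (iterD S L f)) S := by
  induction L generalizing f with
  | nil => exact fun _ _ => rfl
  | cons v L ih =>
    exact (iterD_congr (dirD_comm hS hSc hf v e) L).trans (ih (contDiffOn_dirD hS hf v))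

theorem iterD_add_smul {S : Set X} (hS : UniqueDiffOn ℝ S) {f g : X → ℝ}
    (hf : ContDiffOn ℝ ∞ f S) (hg : ContDiffOn ℝ ∞ g S) (c : ℝ) (L : List X) :
    EqOn (iterD S L (fun p => f p + c * g p)) (fun p => iterD S L f p + c * iterD S L g p) S := by
  induction L generalizing f g with
  | nil => exact fun _ _ => rfl
  | cons v L ih =>
    refine (iterD_congr ?_ L).trans (ih (contDiffOn_dirD hS hf v) (contDiffOn_dirD hS hg v))
    refine (dirD_add hS hf (contDiffOn_const.mul hg) v).trans fun p hp => ?_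
    have h0 : dirD S v (fun _ : X => c) p = 0 := by
      simp [dirD]
    simp [dirD_mul hS contDiffOn_const hg v hp, h0]

/-- A smooth function that vanishes near `A` on each level set of `ℓ` is flat along `A`. -/
theorem flat_of_slices {S A : Set X} (ℓ : X →L[ℝ] ℝ) {e : X} (he : ℓ e = 1)
    (hS : UniqueDiffOn ℝ S) (hSc : S ⊆ closure (interior S)) (hA : A ⊆ S)
    (hA₁ : ∀ a ∈ A, a ∈ closure (interior S ∩ {p | ℓ p = ℓ a}))
    (hA₂ : ∀ a ∈ A, ∀ᶠ h : ℝ in 𝓝 0, a + h • e ∈ A) {f : X → ℝ} (hf : ContDiffOn ℝ ∞ f S)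
    (hfA : ∀ a ∈ A, ∃ O, IsOpen O ∧ a ∈ O ∧ ∀ p ∈ O ∩ interior S, ℓ p = ℓ a → f p = 0) :
    Flat S A f := by
  -- Derivatives tangent to the level sets. If `f` vanishes on the slice through `a` inside the open
  -- set `O ∩ interior S`, so does its derivative along any `v` with `ℓ v = 0`, since `p + h • v`
  -- stays in the slice. The value at `a` itself is a limit along the slice.
  have tang : ∀ L : List X, (∀ v ∈ L, ℓ v = 0) → ∀ a ∈ A, iterD S L f a = 0 := by
    intro L
    induction L generalizing f with
    | nil =>
      intro _ a ha
      obtain ⟨O, hO, haO, h0⟩ := hfA a ha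
      have hc : ContinuousWithinAt f (interior S ∩ {p | ℓ p = ℓ a}) a :=
        (hf.continuousOn a (hA ha)).mono (inter_subset_left.trans interior_subset)
      have hne : (𝓝[interior S ∩ {p | ℓ p = ℓ a}] a).NeBot :=
        mem_closure_iff_nhdsWithin_neBot.1 (hA₁ a ha)
      refine tendsto_nhds_unique hc (tendsto_const_nhds.congr' ?_)
      filter_upwards [self_mem_nhdsWithin, mem_nhdsWithin_of_mem_nhds (hO.mem_nhds haO)]
        with p hp hpO
      exact (h0 p ⟨hpO, hp.1⟩ hp.2).symm
    | cons v L ih =>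
      intro hL
      refine ih (contDiffOn_dirD hS hf v) ?_ fun w hw => hL w (List.mem_cons_of_mem _ hw)
      intro a ha
      obtain ⟨O, hO, haO, h0⟩ := hfA a ha
      refine ⟨O, hO, haO, fun p hp hpa => ?_⟩
      have hmem : O ∩ interior S ∈ 𝓝 p := (hO.inter isOpen_interior).mem_nhds hp
      have hpS : S ∈ 𝓝 p := mem_of_superset hmem (inter_subset_right.trans interior_subset)
      have hd : HasFDerivAt f (fderivWithin ℝ f S p) p :=
        (hasFDerivWithinAt_of_smooth hf (mem_of_mem_nhds hpS)).hasFDerivAt hpS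
      have hl : HasDerivAt (fun h : ℝ => p + h • v) v 0 := by
        simpa using ((hasDerivAt_id (0 : ℝ)).smul_const v).const_add p
      have hd' : HasFDerivAt f (fderivWithin ℝ f S p) (p + (0 : ℝ) • v) := by simpa using hd
      have h1 := hd'.comp_hasDerivAt 0 hl
      have h2 : (f ∘ fun h : ℝ => p + h • v) =ᶠ[𝓝 0] fun _ => 0 := by
        have : ∀ᶠ h : ℝ in 𝓝 0, p + h • v ∈ O ∩ interior S :=
          (hl.continuousAt.eventually (by simpa using hmem))
        filter_upwards [this] with h hh
        exact h0 _ hh (by simp [hL v List.mem_cons_self, hpa])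
      exact h1.unique ((hasDerivAt_const (0 : ℝ) (0 : ℝ)).congr_of_eventuallyEq h2)
  -- Split `v` into the tangential vector `v - ℓ v • e` and a multiple of `e`. The first only
  -- lengthens the list of tangential derivatives. For the second, commute the `e`-derivative
  -- outwards: it then differentiates, along `a + h • e`, a function that is zero because this line
  -- stays in `A`.
  have stable : ∀ g : X → ℝ, ContDiffOn ℝ ∞ g S →
      (∀ L : List X, (∀ v ∈ L, ℓ v = 0) → ∀ a ∈ A, iterD S L g a = 0) → ∀ v,
      ∀ L : List X, (∀ v ∈ L, ℓ v = 0) → ∀ a ∈ A, iterD S L (dirD S v g) a = 0 := by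
    intro g hg hgA v L hL a ha
    have hv : EqOn (dirD S v g) (fun p => dirD S (v - ℓ v • e) g p + ℓ v * dirD S e g p) S := by
      intro p _
      simp [dirD]
    rw [iterD_congr hv L (hA ha), iterD_add_smul hS (contDiffOn_dirD hS hg _)
      (contDiffOn_dirD hS hg _) _ L (hA ha)]
    have h1 : iterD S L (dirD S (v - ℓ v • e) g) a = 0 := by
      refine hgA ((v - ℓ v • e) :: L) (fun w hw => ?_) a ha
      rcases List.mem_cons.1 hw with rfl | hw
      · simp [he]
      · exact hL w hw
    have h2 : iterD S L (dirD S e g) a = 0 := by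
      rw [iterD_dirD hS hSc hg L e (hA ha)]
      have hd := hasFDerivWithinAt_of_smooth (contDiffOn_iterD hS hg L) (hA ha)
      have hl : HasDerivAt (fun h : ℝ => a + h • e) e 0 := by
        simpa using ((hasDerivAt_id (0 : ℝ)).smul_const e).const_add a
      have hm : ∀ᶠ h : ℝ in 𝓝 0, a + h • e ∈ A := hA₂ a ha
      have h3 : HasDerivWithinAt ((iterD S L g) ∘ fun h : ℝ => a + h • e)
          (fderivWithin ℝ (iterD S L g) S a e) {h : ℝ | a + h • e ∈ A} 0 := by
        have hd' : HasFDerivWithinAt (iterD S L g) (fderivWithin ℝ (iterD S L g) S a) S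
            (a + (0 : ℝ) • e) := by simpa using hd
        exact hd'.comp_hasDerivWithinAt 0 hl.hasDerivWithinAt fun h hh => hA hh
      have h4 := h3.hasDerivAt hm
      refine h4.unique ((hasDerivAt_const (0 : ℝ) (0 : ℝ)).congr_of_eventuallyEq ?_)
      filter_upwards [hm] with h hh using hgA L hL _ hh
    simp [h1, h2]
  refine ⟨hf, fun n => ?_⟩
  -- Vanishing near `A` on slices need not pass to transversal derivatives; the property carried
  -- through the induction is that all tangential derivatives vanish on `A`.
  clear hfA
  induction n generalizing f with
  | zero => exact tang [] (by simp)
  | succ n ih =>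
    exact ⟨tang [] (by simp), fun v => ih (contDiffOn_dirD hS hf v) (stable f hf tang v)⟩

/-- Extending a function by zero across the points where it is flat gives a smooth function. -/
theorem Flat.contDiff_indicator [FiniteDimensional ℝ X] {S A : Set X} (hSc : IsClosed S)
    (hS : UniqueDiffOn ℝ S) (hA : frontier S ⊆ A) {f : X → ℝ} (hf : Flat S A f) :
    ContDiff ℝ ∞ (S.indicator f) := by
  -- At a frontier point the derivative within `S` is zero by flatness, and so is the one within the
  -- complement; the two glue. Hence differentiating commutes with extending by zero, and the
  -- derivative is flat again.
  have key : ∀ g : X → ℝ, Flat S A g → ∀ p,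
      HasFDerivAt (S.indicator g) (S.indicator (fun p => fderivWithin ℝ g S p) p) p := by
    intro g hg p
    by_cases hp : p ∈ S
    · rw [indicator_of_mem hp]
      have hin : HasFDerivWithinAt (S.indicator g) (fderivWithin ℝ g S p) S p :=
        (hasFDerivWithinAt_of_smooth hg.smooth hp).congr (fun q hq => indicator_of_mem hq g)
          (indicator_of_mem hp g)
      by_cases hi : p ∈ interior S
      · exact hin.hasFDerivAt (mem_interior_iff_mem_nhds.1 hi)
      · have hpA : p ∈ A := hA ⟨subset_closure hp, hi⟩
        have h0 : fderivWithin ℝ g S p = 0 := by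
          ext v
          exact (hg.deriv hS v).eq_zero hpA
        have hout : HasFDerivWithinAt (S.indicator g) (fderivWithin ℝ g S p) Sᶜ p := by
          rw [h0]
          refine (hasFDerivWithinAt_const (0 : ℝ) p Sᶜ).congr
            (fun q hq => indicator_of_notMem hq g) ?_
          rw [indicator_of_mem hp, hg.eq_zero hpA]
        have := hin.union hout
        rwa [union_compl_self, hasFDerivWithinAt_univ] at this
    · rw [indicator_of_notMem hp]
      refine (hasFDerivAt_const (0 : ℝ) p).congr_of_eventuallyEq ?_
      filter_upwards [hSc.isOpen_compl.mem_nhds hp] with q hq using indicator_of_notMem hq g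
  refine contDiff_infty.2 fun n => ?_
  induction n generalizing f with
  | zero =>
    exact contDiff_zero.2 (continuous_iff_continuousAt.2 fun p => (key f hf p).continuousAt)
  | succ n ih =>
    push_cast
    rw [contDiff_succ_iff_fderiv_apply]
    refine ⟨fun p => (key f hf p).differentiableAt, by simp, fun v => ?_⟩
    have : (fun p => fderiv ℝ (S.indicator f) p v) = S.indicator (dirD S v f) := by
      ext p
      rw [(key f hf p).fderiv]
      by_cases hp : p ∈ S <;> simp [hp, dirD]
    rw [this]
    exact ih (hf.deriv hS v)

end WessZumino

end

noncomputable section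

namespace WessZumino

open Set Filter Topology MeasureTheory

/-! ### Functions all of whose derivatives have a prescribed growth -/

/-- On `S`, the derivatives of `f` of order at most `n` are `O((1 + ‖p‖) ^ m)`. -/
def GrowthN (S : Set (E 3)) (m : ℤ) : ℕ → (E 3 → ℝ) → Prop
  | 0, f => ∃ C, ∀ p ∈ S, |f p| ≤ C * (1 + ‖p‖) ^ m
  | n + 1, f => (∃ C, ∀ p ∈ S, |f p| ≤ C * (1 + ‖p‖) ^ m) ∧ ∀ v, GrowthN S m n (dirD S v f)

/-- Smooth functions on `S` all of whose derivatives are `O((1 + ‖p‖) ^ m)`. -/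
structure Growth (S : Set (E 3)) (m : ℤ) (f : E 3 → ℝ) : Prop where
  smooth : ContDiffOn ℝ ∞ f S
  bound : ∀ n, GrowthN S m n f

section Growth

variable {S T : Set (E 3)} {m m' : ℤ} {n : ℕ} {f g : E 3 → ℝ}

theorem one_add_norm_zpow_pos (p : E 3) (m : ℤ) : 0 < (1 + ‖p‖) ^ m := by positivity

theorem GrowthN.of_succ (h : GrowthN S m (n + 1) f) : GrowthN S m n f := by
  induction n generalizing f with
  | zero => exact h.1
  | succ n ih => exact ⟨h.1, fun v => ih (h.2 v)⟩

theorem GrowthN.congr (h : GrowthN S m n f) (hfg : EqOn f g S) : GrowthN S m n g := by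
  induction n generalizing f g with
  | zero =>
    obtain ⟨C, hC⟩ := h
    exact ⟨C, fun p hp => hfg hp ▸ hC p hp⟩
  | succ n ih =>
    obtain ⟨⟨C, hC⟩, h2⟩ := h
    exact ⟨⟨C, fun p hp => hfg hp ▸ hC p hp⟩, fun v => ih (h2 v) (dirD_congr hfg v)⟩

theorem GrowthN.mono (h : GrowthN S m n f) (hm : m ≤ m') : GrowthN S m' n f := by
  have key : ∀ f : E 3 → ℝ, (∃ C, ∀ p ∈ S, |f p| ≤ C * (1 + ‖p‖) ^ m) →
      ∃ C, ∀ p ∈ S, |f p| ≤ C * (1 + ‖p‖) ^ m' := by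
    rintro f ⟨C, hC⟩
    refine ⟨|C|, fun p hp => (hC p hp).trans ?_⟩
    gcongr
    · exact le_abs_self C
    · linarith [norm_nonneg p]
  induction n generalizing f with
  | zero => exact key f h
  | succ n ih => exact ⟨key f h.1, fun v => ih (h.2 v)⟩

theorem GrowthN.add (hS : UniqueDiffOn ℝ S) (hf : GrowthN S m n f) (hg : GrowthN S m n g)
    (hfs : ContDiffOn ℝ ∞ f S) (hgs : ContDiffOn ℝ ∞ g S) :
    GrowthN S m n (fun p => f p + g p) := by
  have key : ∀ f g : E 3 → ℝ, (∃ C, ∀ p ∈ S, |f p| ≤ C * (1 + ‖p‖) ^ m) →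
      (∃ C, ∀ p ∈ S, |g p| ≤ C * (1 + ‖p‖) ^ m) →
      ∃ C, ∀ p ∈ S, |f p + g p| ≤ C * (1 + ‖p‖) ^ m := by
    rintro f g ⟨C, hC⟩ ⟨D, hD⟩
    refine ⟨C + D, fun p hp => (abs_add_le _ _).trans ?_⟩
    linarith [hC p hp, hD p hp]
  induction n generalizing f g with
  | zero => exact key f g hf hg
  | succ n ih =>
    exact ⟨key f g hf.1 hg.1, fun v => (ih (hf.2 v) (hg.2 v) (contDiffOn_dirD hS hfs v)
      (contDiffOn_dirD hS hgs v)).congr (dirD_add hS hfs hgs v).symm⟩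

theorem GrowthN.mul (hS : UniqueDiffOn ℝ S) (hf : GrowthN S m n f) (hg : GrowthN S m' n g)
    (hfs : ContDiffOn ℝ ∞ f S) (hgs : ContDiffOn ℝ ∞ g S) :
    GrowthN S (m + m') n (fun p => f p * g p) := by
  have key : ∀ f g : E 3 → ℝ, (∃ C, ∀ p ∈ S, |f p| ≤ C * (1 + ‖p‖) ^ m) →
      (∃ C, ∀ p ∈ S, |g p| ≤ C * (1 + ‖p‖) ^ m') →
      ∃ C, ∀ p ∈ S, |f p * g p| ≤ C * (1 + ‖p‖) ^ (m + m') := by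
    rintro f g ⟨C, hC⟩ ⟨D, hD⟩
    refine ⟨C * D, fun p hp => ?_⟩
    have h0 : (0 : ℝ) < 1 + ‖p‖ := by positivity
    rw [abs_mul, zpow_add₀ h0.ne']
    calc |f p| * |g p| ≤ (C * (1 + ‖p‖) ^ m) * (D * (1 + ‖p‖) ^ m') :=
          mul_le_mul (hC p hp) (hD p hp) (abs_nonneg _) ((abs_nonneg _).trans (hC p hp))
      _ = _ := by ring
  induction n generalizing f g with
  | zero => exact key f g hf hg
  | succ n ih =>
    exact ⟨key f g hf.1 hg.1, fun v => ((ih hf.of_succ (hg.2 v) hfs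
      (contDiffOn_dirD hS hgs v)).add hS (ih (hf.2 v) hg.of_succ (contDiffOn_dirD hS hfs v) hgs)
      (hfs.mul (contDiffOn_dirD hS hgs v)) ((contDiffOn_dirD hS hfs v).mul hgs)).congr
      (dirD_mul hS hfs hgs v).symm⟩

theorem Growth.congr (h : Growth S m f) (hfg : EqOn f g S) : Growth S m g :=
  ⟨h.smooth.congr hfg.symm, fun n => (h.bound n).congr hfg⟩

theorem Growth.mono (h : Growth S m f) (hm : m ≤ m') : Growth S m' f :=
  ⟨h.smooth, fun n => (h.bound n).mono hm⟩

theorem Growth.add (hS : UniqueDiffOn ℝ S) (hf : Growth S m f) (hg : Growth S m g) :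
    Growth S m (fun p => f p + g p) :=
  ⟨hf.smooth.add hg.smooth, fun n => (hf.bound n).add hS (hg.bound n) hf.smooth hg.smooth⟩

theorem Growth.mul (hS : UniqueDiffOn ℝ S) (hf : Growth S m f) (hg : Growth S m' g) :
    Growth S (m + m') (fun p => f p * g p) :=
  ⟨hf.smooth.mul hg.smooth, fun n => (hf.bound n).mul hS (hg.bound n) hf.smooth hg.smooth⟩

theorem Growth.deriv (hS : UniqueDiffOn ℝ S) (hf : Growth S m f) (v : E 3) :
    Growth S m (dirD S v f) :=
  ⟨contDiffOn_dirD hS hf.smooth v, fun n => (hf.bound (n + 1)).2 v⟩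

theorem GrowthN.zero_fun (S : Set (E 3)) (m : ℤ) (n : ℕ) : GrowthN S m n (fun _ => 0) := by
  induction n with
  | zero => exact ⟨0, by simp⟩
  | succ n ih => exact ⟨⟨0, by simp⟩, fun v => ih.congr fun p _ => by simp [dirD]⟩

theorem Growth.const (S : Set (E 3)) (c : ℝ) : Growth S 0 (fun _ => c) := by
  refine ⟨contDiffOn_const, fun n => ?_⟩
  cases n with
  | zero => exact ⟨|c|, by simp⟩
  | succ n =>
    exact ⟨⟨|c|, by simp⟩, fun v => (GrowthN.zero_fun S 0 n).congr fun p _ => by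
      simp [dirD]⟩

theorem Growth.const_mul (hS : UniqueDiffOn ℝ S) (hf : Growth S m f) (c : ℝ) :
    Growth S m (fun p => c * f p) := by
  simpa using (Growth.const S c).mul hS hf

theorem Growth.neg (hS : UniqueDiffOn ℝ S) (hf : Growth S m f) : Growth S m (fun p => -f p) := by
  simpa using hf.const_mul hS (-1)

theorem Growth.sub (hS : UniqueDiffOn ℝ S) (hf : Growth S m f) (hg : Growth S m g) :
    Growth S m (fun p => f p - g p) := by
  simpa [sub_eq_add_neg] using hf.add hS (hg.neg hS)

theorem dirD_coord (hS : UniqueDiffOn ℝ S) (i : Fin 3) (v : E 3) :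
    EqOn (dirD S v (fun p : E 3 => p i)) (fun _ => v i) S := by
  intro p hp
  have h : HasFDerivWithinAt (fun p : E 3 => p i) (EuclideanSpace.proj i : E 3 →L[ℝ] ℝ) S p :=
    (EuclideanSpace.proj i : E 3 →L[ℝ] ℝ).hasFDerivWithinAt
  simp [dirD, h.fderivWithin (hS p hp)]

theorem Growth.coord (hS : UniqueDiffOn ℝ S) (i : Fin 3) : Growth S 1 (fun p => p i) := by
  have h0 : ∃ C, ∀ p ∈ S, |p i| ≤ C * (1 + ‖p‖) ^ (1 : ℤ) := by
    refine ⟨1, fun p _ => ?_⟩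
    have := PiLp.norm_apply_le p i
    rw [Real.norm_eq_abs] at this
    simp only [zpow_one]
    linarith
  refine ⟨by fun_prop, fun n => ?_⟩
  cases n with
  | zero => exact h0
  | succ n =>
    exact ⟨h0, fun v => (((Growth.const S (v i)).bound n).mono zero_le_one).congr
      (dirD_coord hS i v).symm⟩

theorem dirD_inv (hS : UniqueDiffOn ℝ S) (hf : ContDiffOn ℝ ∞ f S) (h0 : ∀ p ∈ S, f p ≠ 0)
    (v : E 3) : EqOn (dirD S v (fun p => (f p)⁻¹))
      (fun p => -((f p)⁻¹ * (f p)⁻¹) * dirD S v f p) S := by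
  intro p hp
  have := ((hasDerivAt_inv (h0 p hp)).comp_hasFDerivWithinAt p
    (hasFDerivWithinAt_of_smooth hf hp)).fderivWithin (hS p hp)
  simp only [dirD]
  rw [show (fun p => (f p)⁻¹) = Inv.inv ∘ f from rfl, this]
  simp [pow_two]

/-- The exponent `0` is stable under products, so the induction through `(1/f)' = -f'/f²` closes;
the lower bound is only needed at order zero. -/
theorem Growth.inv (hS : UniqueDiffOn ℝ S) (hf : Growth S 0 f) {c : ℝ} (hc : 0 < c)
    (hfc : ∀ p ∈ S, c ≤ f p) : Growth S 0 (fun p => (f p)⁻¹) := by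
  have h0 : ∀ p ∈ S, f p ≠ 0 := fun p hp => (hc.trans_le (hfc p hp)).ne'
  have hs : ContDiffOn ℝ ∞ (fun p => (f p)⁻¹) S := hf.smooth.inv h0
  have hb : ∃ C, ∀ p ∈ S, |(f p)⁻¹| ≤ C * (1 + ‖p‖) ^ (0 : ℤ) := by
    refine ⟨c⁻¹, fun p hp => ?_⟩
    have hp' := hfc p hp
    rw [abs_of_pos (inv_pos.2 (hc.trans_le hp'))]
    simpa using inv_anti₀ hc hp'
  refine ⟨hs, fun n => ?_⟩
  induction n with
  | zero => exact hb
  | succ n ih =>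
    refine ⟨hb, fun v => ?_⟩
    have h1 : GrowthN S 0 n fun p => (f p)⁻¹ * (f p)⁻¹ := by simpa using ih.mul hS ih hs hs
    have h2 : GrowthN S 0 n fun p => -1 * ((f p)⁻¹ * (f p)⁻¹) := by
      simpa using ((Growth.const S (-1)).bound n).mul hS h1 contDiffOn_const (hs.mul hs)
    have h3 : GrowthN S 0 n fun p => -1 * ((f p)⁻¹ * (f p)⁻¹) * dirD S v f p := by
      simpa using h2.mul hS ((hf.bound (n + 1)).2 v) (contDiffOn_const.mul (hs.mul hs))
        (contDiffOn_dirD hS hf.smooth v)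
    refine h3.congr fun p hp => ?_
    rw [dirD_inv hS hf.smooth h0 v hp]
    ring

theorem dirD_of_isOpen (hS : IsOpen S) (f : E 3 → ℝ) (v : E 3) :
    EqOn (dirD S v f) (fun p => fderiv ℝ f p v) S := fun p hp => by
  simp only [dirD, fderivWithin_of_isOpen hS hp]

/-- On open sets the derivative within the set is the full derivative, so both pieces bound the same
functions. -/
theorem GrowthN.union (hS : IsOpen S) (hT : IsOpen T) (hf : GrowthN S m n f)
    (hg : GrowthN T m n f) : GrowthN (S ∪ T) m n f := by
  have key : ∀ f : E 3 → ℝ, (∃ C, ∀ p ∈ S, |f p| ≤ C * (1 + ‖p‖) ^ m) →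
      (∃ C, ∀ p ∈ T, |f p| ≤ C * (1 + ‖p‖) ^ m) →
      ∃ C, ∀ p ∈ S ∪ T, |f p| ≤ C * (1 + ‖p‖) ^ m := by
    rintro f ⟨C, hC⟩ ⟨D, hD⟩
    refine ⟨max C D, fun p hp => ?_⟩
    rcases hp with hp | hp
    · exact (hC p hp).trans (by gcongr; exact le_max_left _ _)
    · exact (hD p hp).trans (by gcongr; exact le_max_right _ _)
  induction n generalizing f with
  | zero => exact key f hf hg
  | succ n ih =>
    refine ⟨key f hf.1 hg.1, fun v => ih ?_ ?_⟩
    · exact (hf.2 v).congr ((dirD_of_isOpen hS f v).trans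
        (((dirD_of_isOpen (hS.union hT) f v).mono subset_union_left).symm))
    · exact (hg.2 v).congr ((dirD_of_isOpen hT f v).trans
        (((dirD_of_isOpen (hS.union hT) f v).mono subset_union_right).symm))

theorem Growth.union (hS : IsOpen S) (hT : IsOpen T) (hf : Growth S m f)
    (hg : Growth T m f) : Growth (S ∪ T) m f :=
  ⟨hf.smooth.union_of_isOpen hg.smooth hS hT,
    fun n => (hf.bound n).union hS hT (hg.bound n)⟩

/-- On a bounded set every weight `(1 + ‖p‖) ^ m` is bounded below by a positive constant, so the
exponent is immaterial. -/
theorem growth_of_isBounded (hS : IsOpen S) (hb : Bornology.IsBounded S) (m : ℤ)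
    (hf : ContDiff ℝ ∞ f) : Growth S m f := by
  have key : ∀ f : E 3 → ℝ, Continuous f → ∃ C, ∀ p ∈ S, |f p| ≤ C * (1 + ‖p‖) ^ m := by
    intro f hf
    obtain ⟨R, hR⟩ := hb.subset_closedBall 0
    have hc : Continuous fun p : E 3 => f p * (1 + ‖p‖) ^ (-m) :=
      hf.mul ((continuous_const.add continuous_norm).zpow₀ _ fun p => Or.inl
        (add_pos_of_pos_of_nonneg one_pos (norm_nonneg p)).ne')
    obtain ⟨C, hC⟩ := (isCompact_closedBall (0 : E 3) R).exists_bound_of_continuousOn hc.continuousOn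
    refine ⟨C, fun p hp => ?_⟩
    have := hC p (hR hp)
    have h0 := one_add_norm_zpow_pos p m
    rw [norm_mul, Real.norm_eq_abs, Real.norm_eq_abs, zpow_neg, abs_inv, abs_of_pos h0,
      ← div_eq_mul_inv, div_le_iff₀ h0] at this
    exact this
  refine ⟨hf.contDiffOn, fun n => ?_⟩
  induction n generalizing f with
  | zero => exact key f hf.continuous
  | succ n ih =>
    refine ⟨key f hf.continuous, fun v => (ih (f := fun p => fderiv ℝ f p v) ?_).congr
      (dirD_of_isOpen hS f v).symm⟩
    exact (hf.fderiv_right (m := ∞) le_rfl).clm_apply contDiff_const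

end Growth

/-! ### Flatness along the axis and decay at infinity -/

/-- The axis `w = 0`, `0 ≤ ρ ≤ 1` in the coordinates `(ρ, w)`. -/
def axis : Set (E 3) := {p | p 0 ∈ Icc (0 : ℝ) 1 ∧ p 1 = 0 ∧ p 2 = 0}

/-- The distance of a point to the line `w = 0`. -/
def axisDist (p : E 3) : ℝ := √(p 1 ^ 2 + p 2 ^ 2)

theorem E3_eq_sum (v : E 3) : v = v 0 • EuclideanSpace.single 0 1 + v 1 • EuclideanSpace.single 1 1
    + v 2 • EuclideanSpace.single 2 1 := by
  ext i; fin_cases i <;> simp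

theorem fderiv_eq_sum (f : E 3 → ℝ) (p v : E 3) :
    fderiv ℝ f p v = v 0 * dirD univ (EuclideanSpace.single 0 1) f p
      + v 1 * dirD univ (EuclideanSpace.single 1 1) f p
      + v 2 * dirD univ (EuclideanSpace.single 2 1) f p := by
  conv_lhs => rw [E3_eq_sum v]
  simp [dirD]

/-- Taylor estimate by induction on `N`: along the segment from the axis to `p` at constant `ρ` the
derivative in the `w`-directions is already `O(axisDist ^ N)`, and the segment has length `axisDist
p`. The range of `ρ` is compact, so the constant is uniform. -/
theorem Flat.abs_le {f : E 3 → ℝ} (hf : Flat univ axis f) (N : ℕ) :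
    ∃ C, 0 ≤ C ∧ ∀ p : E 3, p 0 ∈ Icc (0 : ℝ) 1 → axisDist p ≤ 1 → |f p| ≤ C * axisDist p ^ N := by
  induction N generalizing f with
  | zero =>
    have hc : IsCompact {p : E 3 | p 0 ∈ Icc (0 : ℝ) 1 ∧ axisDist p ≤ 1} := by
      refine Metric.isCompact_of_isClosed_isBounded ?_ ?_
      · have hcont : Continuous axisDist := by unfold axisDist; fun_prop
        exact (isClosed_Icc.preimage (by fun_prop)).inter (isClosed_Iic.preimage hcont)
      · refine (Metric.isBounded_closedBall (x := (0 : E 3)) (r := 2)).subset ?_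
        rintro p ⟨h1, h2⟩
        have h3 : p 1 ^ 2 + p 2 ^ 2 ≤ 1 := by
          rwa [axisDist, Real.sqrt_le_one] at h2
        rw [mem_closedBall_zero_iff, EuclideanSpace.norm_eq, Real.sqrt_le_left (by norm_num)]
        simp only [Real.norm_eq_abs, sq_abs, Fin.sum_univ_three]
        nlinarith [h1.1, h1.2]
    obtain ⟨C, hC⟩ := hc.exists_bound_of_continuousOn (hf.smooth.continuousOn.mono (subset_univ _))
    refine ⟨|C|, abs_nonneg _, fun p h1 h2 => ?_⟩
    simpa using (hC p ⟨h1, h2⟩).trans (le_abs_self C)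
  | succ N ih =>
    obtain ⟨C, hC, hCb⟩ := ih (hf.deriv uniqueDiffOn_univ (EuclideanSpace.single 1 1))
    obtain ⟨D, hD, hDb⟩ := ih (hf.deriv uniqueDiffOn_univ (EuclideanSpace.single 2 1))
    refine ⟨C + D, by positivity, fun p h1 h2 => ?_⟩
    have h0 : 0 ≤ axisDist p := Real.sqrt_nonneg _
    have hp1 : |p 1| ≤ axisDist p := Real.abs_le_sqrt (by nlinarith [sq_nonneg (p 2)])
    have hp2 : |p 2| ≤ axisDist p := Real.abs_le_sqrt (by nlinarith [sq_nonneg (p 1)])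
    set l : ℝ → E 3 := fun t => !₂[p 0, t * p 1, t * p 2] with hl
    have hdl : ∀ t, HasDerivAt l !₂[0, p 1, p 2] t := by
      intro t
      have h : l = fun t => !₂[p 0, 0, 0] + t • !₂[0, p 1, p 2] := by
        funext t; ext i; fin_cases i <;> simp [hl]
      rw [h]
      simpa using ((hasDerivAt_id t).smul_const (!₂[0, p 1, p 2] : E 3)).const_add !₂[p 0, 0, 0]
    have hfd : ∀ q, HasFDerivAt f (fderiv ℝ f q) q := fun q =>
      ((contDiffOn_univ.1 hf.smooth).differentiable (by simp) q).hasFDerivAt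
    have hd : ∀ t ∈ Icc (0 : ℝ) 1, HasDerivWithinAt (f ∘ l) (fderiv ℝ f (l t) !₂[0, p 1, p 2])
        (Icc 0 1) t := fun t _ => ((hfd (l t)).comp_hasDerivAt t (hdl t)).hasDerivWithinAt
    have hb : ∀ t ∈ Ico (0 : ℝ) 1, ‖fderiv ℝ f (l t) !₂[0, p 1, p 2]‖ ≤
        (C + D) * axisDist p ^ (N + 1) := by
      intro t ht
      have hlt : axisDist (l t) = t * axisDist p := by
        have : (t * p 1) ^ 2 + (t * p 2) ^ 2 = t ^ 2 * (p 1 ^ 2 + p 2 ^ 2) := by ring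
        simp only [axisDist, hl, PiLp.toLp_apply, Matrix.cons_val_one, Matrix.cons_val_zero,
          Matrix.cons_val, this, Real.sqrt_mul (sq_nonneg t), Real.sqrt_sq ht.1]
      have hle : axisDist (l t) ≤ axisDist p := by
        rw [hlt]; nlinarith [ht.2]
      have hpw : axisDist (l t) ^ N ≤ axisDist p ^ N :=
        pow_le_pow_left₀ (Real.sqrt_nonneg _) hle N
      have e1 := (hCb (l t) (by simpa [hl] using h1) (hle.trans h2)).trans
        (mul_le_mul_of_nonneg_left hpw hC)
      have e2 := (hDb (l t) (by simpa [hl] using h1) (hle.trans h2)).trans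
        (mul_le_mul_of_nonneg_left hpw hD)
      rw [fderiv_eq_sum]
      simp only [Matrix.cons_val_zero, Matrix.cons_val_one, Matrix.cons_val,
        zero_mul, zero_add, Real.norm_eq_abs]
      refine (abs_add_le _ _).trans ?_
      rw [abs_mul, abs_mul]
      calc _ ≤ axisDist p * (C * axisDist p ^ N) + axisDist p * (D * axisDist p ^ N) := by
            gcongr
        _ = _ := by ring
    have := norm_image_sub_le_of_norm_deriv_le_segment_01' hd hb
    have hl1 : l 1 = p := by ext i; fin_cases i <;> simp [hl]
    have hl0 : f (l 0) = 0 := hf.eq_zero (by simpa [hl, axis] using h1)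
    simpa [hl1, hl0] using this

/-- The inversion `(ρ, z) ↦ (ρ, z / |z|²)`. -/
def inversion (p : E 3) : E 3 :=
  !₂[p 0, p 1 / (p 1 ^ 2 + p 2 ^ 2), p 2 / (p 1 ^ 2 + p 2 ^ 2)]

/-- The part `|z| > 1` of the coordinate domain. -/
def outerDomain : Set (E 3) := {p | 0 < p 0 ∧ p 0 < 1 ∧ 1 < p 1 ^ 2 + p 2 ^ 2}

theorem isOpen_outerDomain : IsOpen outerDomain := by
  have h0 : Continuous fun p : E 3 => p 0 := by fun_prop
  have h1 : Continuous fun p : E 3 => p 1 ^ 2 + p 2 ^ 2 := by fun_prop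
  exact (isOpen_Ioi.preimage h0).inter ((isOpen_Iio.preimage h0).inter (isOpen_Ioi.preimage h1))

theorem contDiffOn_inversion : ContDiffOn ℝ ∞ inversion outerDomain := by
  rw [contDiffOn_euclidean]
  have h0 : ∀ p ∈ outerDomain, p 1 ^ 2 + p 2 ^ 2 ≠ 0 := fun p hp => (zero_lt_one.trans hp.2.2).ne'
  intro i
  fin_cases i
  · simpa [inversion] using (by fun_prop : ContDiffOn ℝ ∞ (fun p : E 3 => p 0) outerDomain)
  · exact ContDiffOn.div (𝕜 := ℝ) (f := fun p : E 3 => p 1) (by fun_prop)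
      (g := fun p : E 3 => p 1 ^ 2 + p 2 ^ 2) (by fun_prop) h0
  · exact ContDiffOn.div (𝕜 := ℝ) (f := fun p : E 3 => p 2) (by fun_prop)
      (g := fun p : E 3 => p 1 ^ 2 + p 2 ^ 2) (by fun_prop) h0

/-- The derivative is written in terms of the image `w = inversion p`, as `|w|² v - 2 w ⟨w, v⟩`.
Being polynomial in `w`, it keeps the chain rule inside the class of flat functions composed with
the inversion. -/
theorem hasFDerivAt_inversion {p : E 3} (hp : p ∈ outerDomain) (v : E 3) :
    fderiv ℝ inversion p v = !₂[v 0,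
      v 1 * (inversion p 1 ^ 2 + inversion p 2 ^ 2)
        - 2 * inversion p 1 * (inversion p 1 * v 1 + inversion p 2 * v 2),
      v 2 * (inversion p 1 ^ 2 + inversion p 2 ^ 2)
        - 2 * inversion p 2 * (inversion p 1 * v 1 + inversion p 2 * v 2)] := by
  have h0 : p 1 ^ 2 + p 2 ^ 2 ≠ 0 := (zero_lt_one.trans hp.2.2).ne'
  have hd : DifferentiableAt ℝ inversion p :=
    (contDiffOn_inversion.contDiffAt (isOpen_outerDomain.mem_nhds hp)).differentiableAt (by simp)
  have hc : ∀ i, fderiv ℝ inversion p v i = fderiv ℝ (fun q => inversion q i) p v := by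
    intro i
    have := (((EuclideanSpace.proj i : E 3 →L[ℝ] ℝ).hasFDerivAt).comp p hd.hasFDerivAt).fderiv
    have h2 : (fun q => inversion q i) = (EuclideanSpace.proj i : E 3 →L[ℝ] ℝ) ∘ inversion := rfl
    rw [h2, this]
    rfl
  have hcoord : ∀ i : Fin 3, HasFDerivAt (fun q : E 3 => q i)
      (EuclideanSpace.proj i : E 3 →L[ℝ] ℝ) p := fun i =>
    (EuclideanSpace.proj i : E 3 →L[ℝ] ℝ).hasFDerivAt
  have hr := ((hcoord 1).pow 2).add ((hcoord 2).pow 2)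
  have hq : ∀ i : Fin 3, fderiv ℝ (fun q : E 3 => q i / (q 1 ^ 2 + q 2 ^ 2)) p v =
      v i / (p 1 ^ 2 + p 2 ^ 2) - p i * (2 * p 1 * v 1 + 2 * p 2 * v 2)
        / (p 1 ^ 2 + p 2 ^ 2) ^ 2 := by
    intro i
    have := ((hcoord i).mul ((hasDerivAt_inv h0).comp_hasFDerivAt p hr)).fderiv
    have h2 : (fun q : E 3 => q i / (q 1 ^ 2 + q 2 ^ 2)) = ((fun q : E 3 => q i) *
        (Inv.inv ∘ ((fun q : E 3 => q 1 ^ 2) + fun q : E 3 => q 2 ^ 2))) := by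
      funext q; simp [div_eq_mul_inv]
    rw [h2, this]
    simp
    field_simp
    ring
  ext i
  rw [hc i]
  fin_cases i
  · have h1 : (fun q => inversion q 0) = fun q : E 3 => q 0 := rfl
    simpa [h1] using congrArg (fun L => L v) (hcoord 0).fderiv
  · have h1 : (fun q => inversion q 1) = fun q : E 3 => q 1 / (q 1 ^ 2 + q 2 ^ 2) := rfl
    simp only [Fin.mk_one, h1, hq]
    simp [inversion]
    field_simp
  · have h1 : (fun q => inversion q 2) = fun q : E 3 => q 2 / (q 1 ^ 2 + q 2 ^ 2) := rfl
    simp only [Fin.reduceFinMk, h1, hq]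
    simp [inversion]
    field_simp

theorem axis_subset_univ : axis ⊆ univ := subset_univ _

/-- Flatness at `w = 0` becomes rapid decay at `z = ∞`. -/
theorem Flat.growth_comp_inversion {f : E 3 → ℝ} (hf : Flat univ axis f) (m : ℤ) :
    Growth outerDomain m (f ∘ inversion) := by
  have hsm := fun {f : E 3 → ℝ} (hf : Flat univ axis f) =>
    hf.smooth.comp contDiffOn_inversion (mapsTo_univ _ _)
  refine ⟨hsm hf, fun n => ?_⟩
  -- Here `|w| = 1/|z|`, and `1 + ‖p‖ ≤ 3|z|` since `|z| > 1` and `0 < ρ < 1`. So a bound by `|w| ^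
  -- |m|` becomes a bound by `(1 + ‖p‖) ^ (-|m|)`, which is at most `(1 + ‖p‖) ^ m`.
  have key : ∀ f : E 3 → ℝ, Flat univ axis f →
      ∃ C, ∀ p ∈ outerDomain, |(f ∘ inversion) p| ≤ C * (1 + ‖p‖) ^ m := by
    intro f hf
    obtain ⟨C, hC, hb⟩ := hf.abs_le m.natAbs
    refine ⟨C * 3 ^ m.natAbs, fun p hp => ?_⟩
    obtain ⟨h0, h1, h2⟩ := hp
    set r := p 1 ^ 2 + p 2 ^ 2 with hr
    have hr0 : 0 < r := zero_lt_one.trans h2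
    have hr1 : 1 < √r := by rwa [Real.lt_sqrt zero_le_one, one_pow]
    have hd : axisDist (inversion p) = (√r)⁻¹ := by
      have : (p 1 / r) ^ 2 + (p 2 / r) ^ 2 = r⁻¹ := by
        rw [div_pow, div_pow, ← add_div, ← hr]; field_simp
      rw [← Real.sqrt_inv, ← this]; rfl
    have hn : 1 + ‖p‖ ≤ 3 * √r := by
      have : ‖p‖ ≤ 2 * √r := by
        rw [EuclideanSpace.norm_eq, Real.sqrt_le_left (by positivity)]
        simp only [Real.norm_eq_abs, sq_abs, Fin.sum_univ_three]
        rw [mul_pow, Real.sq_sqrt hr0.le]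
        nlinarith
      linarith
    have h3 := hb (inversion p) ⟨h0.le, h1.le⟩ (by rw [hd]; exact inv_le_one_of_one_le₀ hr1.le)
    refine h3.trans ?_
    rw [mul_assoc]
    refine mul_le_mul_of_nonneg_left ?_ hC
    have hp1 : (1 : ℝ) ≤ 1 + ‖p‖ := by linarith [norm_nonneg p]
    have h4 : (1 + ‖p‖) ^ (-(m.natAbs : ℤ)) ≤ (1 + ‖p‖) ^ m :=
      zpow_le_zpow_right₀ hp1 (by omega)
    refine le_trans ?_ (mul_le_mul_of_nonneg_left h4 (by positivity))
    rw [hd, zpow_neg, zpow_natCast, inv_pow, ← div_eq_mul_inv, inv_eq_one_div,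
      div_le_div_iff₀ (by positivity) (by positivity), one_mul, ← mul_pow]
    exact pow_le_pow_left₀ (by positivity) hn _
  induction n generalizing f with
  | zero => exact key f hf
  | succ n ih =>
    refine ⟨key f hf, fun v => ?_⟩
    -- By the chain rule, the derivative of `f ∘ inversion` along `v` is this function composed with
    -- the inversion. It is flat, since its coefficients are polynomials.
    have hfl : Flat univ axis fun q : E 3 =>
        (v 0 * dirD univ (EuclideanSpace.single 0 1) f q
        + (v 1 * (q 1 ^ 2 + q 2 ^ 2) - 2 * q 1 * (q 1 * v 1 + q 2 * v 2)) *
          dirD univ (EuclideanSpace.single 1 1) f q)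
        + (v 2 * (q 1 ^ 2 + q 2 ^ 2) - 2 * q 2 * (q 1 * v 1 + q 2 * v 2)) *
          dirD univ (EuclideanSpace.single 2 1) f q := by
      have hu := uniqueDiffOn_univ (𝕜 := ℝ) (E := E 3)
      refine Flat.add hu axis_subset_univ (Flat.add hu axis_subset_univ ?_ ?_) ?_
      · exact Flat.mul_left hu axis_subset_univ contDiffOn_const (hf.deriv hu _)
      · exact Flat.mul_left hu axis_subset_univ (by fun_prop) (hf.deriv hu _)
      · exact Flat.mul_left hu axis_subset_univ (by fun_prop) (hf.deriv hu _)
    refine (ih hfl).congr fun p hp => ?_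
    have hd : DifferentiableAt ℝ inversion p :=
      (contDiffOn_inversion.contDiffAt (isOpen_outerDomain.mem_nhds hp)).differentiableAt (by simp)
    have hfd : DifferentiableAt ℝ f (inversion p) :=
      (contDiffOn_univ.1 hf.smooth).differentiable (by simp) _
    rw [dirD_of_isOpen isOpen_outerDomain _ _ hp]
    simp only [Function.comp_apply]
    rw [fderiv_comp p hfd hd, ContinuousLinearMap.comp_apply, hasFDerivAt_inversion hp,
      fderiv_eq_sum]
    simp

end WessZumino

end

noncomputable section

namespace WessZumino

open Set Filter Topology MeasureTheory

/-! ### The angular form -/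

section Angular

variable {X : Type*} [NormedAddCommGroup X] [NormedSpace ℝ X]

theorem dirD_sub {S : Set X} (hS : UniqueDiffOn ℝ S) {f g : X → ℝ} (hf : ContDiffOn ℝ ∞ f S)
    (hg : ContDiffOn ℝ ∞ g S) (v : X) :
    EqOn (dirD S v (fun p => f p - g p)) (fun p => dirD S v f p - dirD S v g p) S := by
  intro p hp
  have := ((hasFDerivWithinAt_of_smooth hf hp).sub (hasFDerivWithinAt_of_smooth hg hp)).fderivWithin
    (hS p hp)
  simp only [dirD]
  rw [show (fun p => f p - g p) = f - g from rfl, this]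
  simp

/-- The 1-form `(f dg - g df) / N` on the vector `v`. -/
def angular (S : Set X) (N f g : X → ℝ) (v : X) : X → ℝ :=
  fun x => (f x * dirD S v g x - g x * dirD S v f x) * (N x)⁻¹

variable {S : Set X} {N f g : X → ℝ}

theorem dirD_inv' (hS : UniqueDiffOn ℝ S) (hN : ContDiffOn ℝ ∞ N S)
    (hN0 : ∀ x ∈ S, N x ≠ 0) (v : X) :
    EqOn (dirD S v (fun p => (N p)⁻¹)) (fun p => -((N p)⁻¹ * (N p)⁻¹) * dirD S v N p) S := by
  intro p hp
  have := ((hasDerivAt_inv (hN0 p hp)).comp_hasFDerivWithinAt p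
    (hasFDerivWithinAt_of_smooth hN hp)).fderivWithin (hS p hp)
  simp only [dirD]
  rw [show (fun p => (N p)⁻¹) = Inv.inv ∘ N from rfl, this]
  simp [pow_two]

/-- The exterior derivative of the angular form. -/
theorem dirD_angular_sub (hS : UniqueDiffOn ℝ S) (hSc : S ⊆ closure (interior S))
    (hN : ContDiffOn ℝ ∞ N S) (hN0 : ∀ x ∈ S, N x ≠ 0) (hf : ContDiffOn ℝ ∞ f S)
    (hg : ContDiffOn ℝ ∞ g S) (v w : X) {x : X} (hx : x ∈ S) :
    dirD S w (angular S N f g v) x - dirD S v (angular S N f g w) x =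
      2 * (dirD S w f x * dirD S v g x - dirD S w g x * dirD S v f x) * (N x)⁻¹ -
      ((f x * dirD S v g x - g x * dirD S v f x) * dirD S w N x -
        (f x * dirD S w g x - g x * dirD S w f x) * dirD S v N x) * ((N x)⁻¹ * (N x)⁻¹) := by
  have key : ∀ v w : X, dirD S w (angular S N f g v) x =
      (f x * dirD S w (dirD S v g) x + dirD S w f x * dirD S v g x -
        (g x * dirD S w (dirD S v f) x + dirD S w g x * dirD S v f x)) * (N x)⁻¹ -
      (f x * dirD S v g x - g x * dirD S v f x) * ((N x)⁻¹ * (N x)⁻¹) * dirD S w N x := by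
    intro v w
    have h1 := contDiffOn_dirD hS hf v
    have h2 := contDiffOn_dirD hS hg v
    have h3 : ContDiffOn ℝ ∞ (fun x => (N x)⁻¹) S := hN.inv hN0
    unfold angular
    rw [dirD_mul hS ((hf.mul h2).sub (hg.mul h1)) h3 w hx]
    beta_reduce
    rw [dirD_sub hS (hf.mul h2) (hg.mul h1) w hx]
    beta_reduce
    rw [dirD_mul hS hf h2 w hx, dirD_mul hS hg h1 w hx, dirD_inv' hS hN hN0 w hx]
    ring
  rw [key v w, key w v, dirD_comm hS hSc hf v w hx, dirD_comm hS hSc hg v w hx]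
  ring

end Angular

/-! ### The trace of the wedge cube -/

theorem sum_perm_fin_three {M : Type*} [AddCommGroup M] (f : Fin 3 → Fin 3 → Fin 3 → M) :
    ∑ σ : Equiv.Perm (Fin 3), (Equiv.Perm.sign σ : ℤ) • f (σ 0) (σ 1) (σ 2) =
      f 0 1 2 + f 1 2 0 + f 2 0 1 - f 0 2 1 - f 1 0 2 - f 2 1 0 := by
  have hu : (Finset.univ : Finset (Equiv.Perm (Fin 3))) =
      {1, Equiv.swap 0 1 * Equiv.swap 1 2, Equiv.swap 0 1 * Equiv.swap 0 2, Equiv.swap 1 2,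
        Equiv.swap 0 1, Equiv.swap 0 2} := by decide
  rw [hu]
  repeat rw [Finset.sum_insert (by decide)]
  rw [Finset.sum_singleton]
  have e1 : (Equiv.swap (1 : Fin 3) 2) 0 = 0 := by decide
  have e2 : (Equiv.swap (0 : Fin 3) 2) 1 = 1 := by decide
  have e3 : (Equiv.swap (0 : Fin 3) 1) 2 = 2 := by decide
  have hs : ∀ i j : Fin 3, i ≠ j → (Equiv.Perm.sign (Equiv.swap i j)) = -1 := fun i j h =>
    Equiv.Perm.sign_swap h
  simp [e1, e2, e3]
  abel

/-- The zero first row makes `u` and `v` drop out of the trace; what remains is the cube of the 2×2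
block. -/
theorem trace_wedgeCube_aux (u v α β γ δ : Fin 3 → ℝ) :
    (wedgeCube (fun k : Fin 3 => !![0, 0, 0; u k, α k, β k; v k, γ k, δ k]) id).trace =
      3 * ((α 0 * (β 1 * γ 2 - β 2 * γ 1)) + β 0 * (γ 1 * α 2 + δ 1 * γ 2 - γ 2 * α 1 - δ 2 * γ 1)
        + γ 0 * (α 1 * β 2 + β 1 * δ 2 - α 2 * β 1 - β 2 * δ 1)
        + δ 0 * (γ 1 * β 2 - γ 2 * β 1)) := by
  unfold wedgeCube
  simp only [id]
  rw [sum_perm_fin_three (fun i j k =>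
    (!![0, 0, 0; u i, α i, β i; v i, γ i, δ i] : Matrix (Fin 3) (Fin 3) ℝ) *
    !![0, 0, 0; u j, α j, β j; v j, γ j, δ j] * !![0, 0, 0; u k, α k, β k; v k, γ k, δ k])]
  simp [Matrix.trace_fin_three]
  ring

/-- The entries `b₁`, `b₂`, the `ρ`-derivatives of the layers, only meet the zero row and disappear
from the product. -/
theorem inv_mul_lower (b₁ b₂ a b c d : ℝ) (h : a * d - b * c ≠ 0) (x y a' b' c' d' : ℝ) :
    (!![1, 0, 0; b₁, a, b; b₂, c, d] : Matrix (Fin 3) (Fin 3) ℝ)⁻¹ *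
      !![0, 0, 0; x, a', b'; y, c', d'] =
    !![0, 0, 0;
      (d * x - b * y) / (a * d - b * c), (d * a' - b * c') / (a * d - b * c),
        (d * b' - b * d') / (a * d - b * c);
      (a * y - c * x) / (a * d - b * c), (a * c' - c * a') / (a * d - b * c),
        (a * d' - c * b') / (a * d - b * c)] := by
  have hdet : (!![1, 0, 0; b₁, a, b; b₂, c, d] : Matrix (Fin 3) (Fin 3) ℝ).det = a * d - b * c := by
    simp [Matrix.det_fin_three]
  have hu : IsUnit (!![1, 0, 0; b₁, a, b; b₂, c, d] : Matrix (Fin 3) (Fin 3) ℝ).det := by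
    rw [hdet]; exact isUnit_iff_ne_zero.2 h
  have key : (!![1, 0, 0; b₁, a, b; b₂, c, d] : Matrix (Fin 3) (Fin 3) ℝ) * !![0, 0, 0;
      (d * x - b * y) / (a * d - b * c), (d * a' - b * c') / (a * d - b * c),
        (d * b' - b * d') / (a * d - b * c);
      (a * y - c * x) / (a * d - b * c), (a * c' - c * a') / (a * d - b * c),
        (a * d' - c * b') / (a * d - b * c)] = !![0, 0, 0; x, a', b'; y, c', d'] := by
    clear hdet hu
    generalize hD : a * d - b * c = D at h
    ext i j
    fin_cases i <;> fin_cases j <;> simp [Matrix.mul_apply, Fin.sum_univ_three] <;>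
      field_simp <;> (try rw [← hD]) <;> ring
  rw [← key, Matrix.nonsing_inv_mul_cancel_left _ _ hu]

/-- The determinant of the four rows `(p, q, r, s)` and `(pₖ, qₖ, rₖ, sₖ)`, expanded along the
first row. -/
def rowDet (p q r s : ℝ) (P Q R T : Fin 3 → ℝ) : ℝ :=
  p * (Q 0 * (R 1 * T 2 - R 2 * T 1) - Q 1 * (R 0 * T 2 - R 2 * T 0)
    + Q 2 * (R 0 * T 1 - R 1 * T 0))
  - q * (P 0 * (R 1 * T 2 - R 2 * T 1) - P 1 * (R 0 * T 2 - R 2 * T 0)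
    + P 2 * (R 0 * T 1 - R 1 * T 0))
  + r * (P 0 * (Q 1 * T 2 - Q 2 * T 1) - P 1 * (Q 0 * T 2 - Q 2 * T 0)
    + P 2 * (Q 0 * T 1 - Q 1 * T 0))
  - s * (P 0 * (Q 1 * R 2 - Q 2 * R 1) - P 1 * (Q 0 * R 2 - Q 2 * R 0)
    + P 2 * (Q 0 * R 1 - Q 1 * R 0))

/-- The form `tr (A⁻¹ dA)³` on `GL₂` is invariant under multiplication and is annihilated by the
radial field, because `tr (A⁻¹ dA)²` vanishes as a wedge square. Hence it is a multiple of the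
radial contraction of `dp dq dr ds`, divided by `det²`. The row determinant is this contraction, and
the computation gives the factor 12. -/
theorem trace_wedgeCube_eq_rowDet (b₁ b₂ p q r s : ℝ) (x y P Q R T : Fin 3 → ℝ)
    (h : p ^ 2 + q ^ 2 - r ^ 2 - s ^ 2 ≠ 0) :
    (wedgeCube (fun k : Fin 3 => (!![1, 0, 0; b₁, p + r, s - q; b₂, s + q, p - r] :
        Matrix (Fin 3) (Fin 3) ℝ)⁻¹ *
      !![0, 0, 0; x k, P k + R k, T k - Q k; y k, T k + Q k, P k - R k]) id).trace =
    12 * rowDet p q r s P Q R T / (p ^ 2 + q ^ 2 - r ^ 2 - s ^ 2) ^ 2 := by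
  have h' : (p + r) * (p - r) - (s - q) * (s + q) ≠ 0 := by
    convert h using 1; ring
  simp_rw [inv_mul_lower b₁ b₂ _ _ _ _ h']
  rw [trace_wedgeCube_aux]
  have hΔ : (p + r) * (p - r) - (s - q) * (s + q) = p ^ 2 + q ^ 2 - r ^ 2 - s ^ 2 := by ring
  rw [hΔ]
  rw [eq_div_iff (pow_ne_zero 2 h)]
  simp only [rowDet]
  generalize hD : p ^ 2 + q ^ 2 - r ^ 2 - s ^ 2 = D at h
  field_simp
  rw [← hD]
  ring

/-- In polar coordinates `p + iq = a e^{iα}`, `r + is = b e^{iβ}` one has `φ = dα` and `σ = b² dβ /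
(a² - b²)`. Then `dα ∧ dσ` is twice the radial contraction of `ab da dα db dβ`, divided by `(a² -
b²)²`. In the hypothesis `hσ`, `dσ` is expanded by the quotient rule. -/
theorem angular_wedge_eq_rowDet (p q r s : ℝ) (P Q R T : Fin 3 → ℝ)
    (hN : p ^ 2 + q ^ 2 ≠ 0) (h : p ^ 2 + q ^ 2 - r ^ 2 - s ^ 2 ≠ 0) (φ : Fin 3 → ℝ)
    (dσ : Fin 3 → Fin 3 → ℝ) (hφ : ∀ k, φ k = (p * Q k - q * P k) * (p ^ 2 + q ^ 2)⁻¹)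
    (hσ : ∀ j k, dσ j k = 2 * (R j * T k - T j * R k) * (p ^ 2 + q ^ 2 - r ^ 2 - s ^ 2)⁻¹ -
      ((r * T k - s * R k) * (2 * (p * P j + q * Q j - r * R j - s * T j)) -
        (r * T j - s * R j) * (2 * (p * P k + q * Q k - r * R k - s * T k))) *
        ((p ^ 2 + q ^ 2 - r ^ 2 - s ^ 2)⁻¹ * (p ^ 2 + q ^ 2 - r ^ 2 - s ^ 2)⁻¹)) :
    φ 0 * dσ 1 2 + φ 1 * dσ 2 0 + φ 2 * dσ 0 1 =
      2 * rowDet p q r s P Q R T / (p ^ 2 + q ^ 2 - r ^ 2 - s ^ 2) ^ 2 := by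
  simp only [hφ, hσ, rowDet]
  rw [eq_div_iff (pow_ne_zero 2 h)]
  generalize hD : p ^ 2 + q ^ 2 - r ^ 2 - s ^ 2 = D at h
  generalize hM : p ^ 2 + q ^ 2 = M at hN
  field_simp
  rw [← hD, ← hM]
  ring

end WessZumino

end

noncomputable section

namespace WessZumino

open Set Filter Topology MeasureTheory

/-! ### Integration over the coordinate domain -/

theorem isOpen_coordDomain : IsOpen coordDomain := by
  have h0 : Continuous fun p : E 3 => p 0 := by fun_prop
  exact (isOpen_Ioi.preimage h0).inter (isOpen_Iio.preimage h0)

theorem uniqueDiffOn_coordDomain : UniqueDiffOn ℝ coordDomain := isOpen_coordDomain.uniqueDiffOn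

theorem integrable_one_add_norm_zpow {V : Type*} [NormedAddCommGroup V] [NormedSpace ℝ V]
    [FiniteDimensional ℝ V] [MeasurableSpace V] [BorelSpace V] (μ : Measure V) [μ.IsAddHaarMeasure]
    (h : (Module.finrank ℝ V : ℝ) < 4) : Integrable (fun x : V => (1 + ‖x‖) ^ (-4 : ℤ)) μ := by
  have := integrable_one_add_norm (μ := μ) h
  refine this.congr (Eventually.of_forall fun x => ?_)
  have : (-4 : ℝ) = ((-4 : ℤ) : ℝ) := by norm_num
  simp only
  rw [this, Real.rpow_intCast]

/-- The exponent `-4` lies below minus the dimension, so comparison with an integrable function on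
all of `ℝ³` suffices. -/
theorem Growth.integrableOn {f : E 3 → ℝ} (hf : Growth coordDomain (-4) f) :
    IntegrableOn f coordDomain := by
  obtain ⟨C, hC⟩ := hf.bound 0
  have hi : Integrable (fun p : E 3 => C * (1 + ‖p‖) ^ (-4 : ℤ)) :=
    (integrable_one_add_norm_zpow volume (by simp; norm_num)).const_mul C
  refine hi.integrableOn.mono'
    (hf.smooth.continuousOn.aestronglyMeasurable isOpen_coordDomain.measurableSet) ?_
  exact (ae_restrict_iff' isOpen_coordDomain.measurableSet).2
    (Eventually.of_forall fun p hp => hC p hp)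

/-- The point with `i`-th coordinate `t` and the other coordinates `y`. -/
def insertCoord (i : Fin 3) (t : ℝ) (y : Fin 2 → ℝ) : E 3 := WithLp.toLp 2 (i.insertNth t y)

theorem insertCoord_same (i : Fin 3) (t : ℝ) (y : Fin 2 → ℝ) : insertCoord i t y i = t := by
  simp [insertCoord]

theorem insertCoord_succ_zero (k : Fin 2) (t : ℝ) (y : Fin 2 → ℝ) :
    insertCoord k.succ t y 0 = y 0 := by
  fin_cases k
  · exact Fin.insertNth_apply_succAbove (α := fun _ => ℝ) 1 t y 0
  · exact Fin.insertNth_apply_succAbove (α := fun _ => ℝ) 2 t y 0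

theorem hasDerivAt_insertCoord (i : Fin 3) (t : ℝ) (y : Fin 2 → ℝ) :
    HasDerivAt (fun t => insertCoord i t y) (EuclideanSpace.single i 1) t := by
  have h : (fun t => insertCoord i t y) =
      fun t => insertCoord i 0 y + t • (EuclideanSpace.single i 1 : E 3) := by
    funext t; ext j
    rcases eq_or_ne j i with rfl | hj
    · simp [insertCoord]
    · obtain ⟨k, rfl⟩ := Fin.exists_succAbove_eq hj
      simp [insertCoord]
  rw [h]
  simpa using ((hasDerivAt_id t).smul_const (EuclideanSpace.single i 1 : E 3)).const_add
    (insertCoord i 0 y)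

/-- Fubini, with the `i`-th coordinate integrated first, ready for the fundamental theorem of
calculus in that direction. -/
theorem integral_eq_iterated {g : E 3 → ℝ} (hg : Integrable g) (i : Fin 3) :
    ∫ p, g p = ∫ y : Fin 2 → ℝ, ∫ t : ℝ, g (insertCoord i t y) := by
  have h1 := (EuclideanSpace.volume_preserving_symm_measurableEquiv_toLp (Fin 3)).symm
  have h2 := (volume_preserving_piFinSuccAbove (fun _ : Fin 3 => ℝ) i).symm
  have hc := h1.comp h2
  have he : MeasurableEmbedding ((MeasurableEquiv.toLp 2 (Fin 3 → ℝ)) ∘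
      (MeasurableEquiv.piFinSuccAbove (fun _ : Fin 3 => ℝ) i).symm) :=
    (MeasurableEquiv.measurableEmbedding _).comp (MeasurableEquiv.measurableEmbedding _)
  have hf : ∀ q : ℝ × (Fin 2 → ℝ), ((MeasurableEquiv.toLp 2 (Fin 3 → ℝ)) ∘
      (MeasurableEquiv.piFinSuccAbove (fun _ : Fin 3 => ℝ) i).symm) q = insertCoord i q.1 q.2 :=
    fun q => rfl
  have hi : Integrable (fun q : ℝ × (Fin 2 → ℝ) => g (insertCoord i q.1 q.2))
      (volume.prod volume) := (hc.integrable_comp_emb he).2 hg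
  have hI := hc.integral_comp he g
  rw [← hI, ← integral_prod_symm _ hi]
  rfl

theorem Growth.abs_insertCoord_le {f : E 3 → ℝ} (hf : Growth coordDomain (-4) f) (i : Fin 3) :
    ∃ C, ∀ y t, insertCoord i t y ∈ coordDomain →
      |f (insertCoord i t y)| ≤ C * (1 + ‖t‖) ^ (-4 : ℤ) := by
  obtain ⟨C, hC⟩ := hf.bound 0
  refine ⟨|C|, fun y t ht => (hC _ ht).trans ?_⟩
  have h1 : ‖t‖ ≤ ‖insertCoord i t y‖ := by
    simpa [insertCoord_same] using PiLp.norm_apply_le (insertCoord i t y) i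
  refine mul_le_mul (le_abs_self C) ?_ (by positivity) (abs_nonneg C)
  rw [zpow_neg, zpow_neg]
  refine inv_anti₀ (by positivity) ?_
  have h2 : (1 + ‖t‖) ^ 4 ≤ (1 + ‖insertCoord i t y‖) ^ 4 :=
    pow_le_pow_left₀ (by positivity) (by linarith) 4
  exact_mod_cast h2

theorem hasDerivAt_comp_insertCoord {f : E 3 → ℝ} (hf : ContDiffOn ℝ ∞ f coordDomain) (i : Fin 3)
    (t : ℝ) (y : Fin 2 → ℝ) (h : insertCoord i t y ∈ coordDomain) :
    HasDerivAt (fun t => f (insertCoord i t y))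
      (dirD coordDomain (EuclideanSpace.single i 1) f (insertCoord i t y)) t := by
  have h1 := (hasFDerivWithinAt_of_smooth hf h).hasFDerivAt (isOpen_coordDomain.mem_nhds h)
  exact h1.comp_hasDerivAt t (hasDerivAt_insertCoord i t y)

/-- A line in a `z`-direction lies inside the slab or misses it. On a line inside, the integral of
the derivative is the difference of the limits at `±∞`, both zero by decay. -/
theorem setIntegral_dirD_eq_zero_of_succ {f : E 3 → ℝ} (hf : Growth coordDomain (-4) f)
    (k : Fin 2) :
    ∫ p in coordDomain, dirD coordDomain (EuclideanSpace.single k.succ 1) f p = 0 := by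
  have hd := hf.deriv uniqueDiffOn_coordDomain (EuclideanSpace.single k.succ 1)
  rw [← integral_indicator isOpen_coordDomain.measurableSet, integral_eq_iterated
    ((integrable_indicator_iff isOpen_coordDomain.measurableSet).2 hd.integrableOn) k.succ]
  refine integral_eq_zero_of_ae (Eventually.of_forall fun y => ?_)
  have hmem : ∀ t, insertCoord k.succ t y ∈ coordDomain ↔ 0 < y 0 ∧ y 0 < 1 := fun t => by
    simp [coordDomain, insertCoord_succ_zero]
  by_cases hy : 0 < y 0 ∧ y 0 < 1
  · have hin : ∀ t, insertCoord k.succ t y ∈ coordDomain := fun t => (hmem t).2 hy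
    have hind : ∀ (g : E 3 → ℝ) t, coordDomain.indicator g (insertCoord k.succ t y) =
        g (insertCoord k.succ t y) := fun g t => indicator_of_mem (hin t) g
    simp only [hind]
    obtain ⟨C, hC⟩ := hf.abs_insertCoord_le k.succ
    obtain ⟨D, hD⟩ := hd.abs_insertCoord_le k.succ
    have hder := fun t => hasDerivAt_comp_insertCoord hf.smooth k.succ t y (hin t)
    have hcont : Continuous fun t => insertCoord k.succ t y :=
      continuous_iff_continuousAt.2 fun t => (hasDerivAt_insertCoord k.succ t y).continuousAt
    have hi : Integrable fun t => dirD coordDomain (EuclideanSpace.single k.succ 1) f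
        (insertCoord k.succ t y) := by
      have hi : Integrable (fun t : ℝ => D * (1 + ‖t‖) ^ (-4 : ℤ)) :=
        (integrable_one_add_norm_zpow volume (by simp)).const_mul D
      exact hi.mono' (hd.smooth.continuousOn.comp_continuous hcont hin).aestronglyMeasurable
        (Eventually.of_forall fun t => hD y t (hin t))
    have hdecay : ∀ l : Filter ℝ, Tendsto (fun t : ℝ => ‖t‖) l atTop →
        Tendsto (fun t => f (insertCoord k.succ t y)) l (𝓝 0) := by
      intro l hl
      have h1 : Tendsto (fun t : ℝ => C * (1 + ‖t‖) ^ (-4 : ℤ)) l (𝓝 0) := by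
        rw [← mul_zero C]
        refine tendsto_const_nhds.mul ?_
        exact (tendsto_zpow_atTop_zero (by norm_num)).comp (tendsto_atTop_add_const_left _ 1 hl)
      exact squeeze_zero_norm (fun t => hC y t (hin t)) h1
    have := integral_of_hasDerivAt_of_tendsto hder hi (hdecay _ (by
      simpa using tendsto_abs_atBot_atTop))
      (hdecay _ (by simpa using tendsto_abs_atTop_atTop))
    simpa using this
  · have hout : ∀ t, insertCoord k.succ t y ∉ coordDomain := fun t h => hy ((hmem t).1 h)
    have hind : ∀ (g : E 3 → ℝ) t, coordDomain.indicator g (insertCoord k.succ t y) = 0 :=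
      fun g t => indicator_of_notMem (hout t) g
    simp [hind]

/-- In the `ρ`-direction the line meets the slab in `(0,1)`, so the limits at both ends are the only
boundary terms and must be assumed to vanish. -/
theorem setIntegral_dirD_zero_eq_zero {f : E 3 → ℝ} (hf : Growth coordDomain (-4) f)
    (h₀ : ∀ y, Tendsto (fun t => f (insertCoord 0 t y)) (𝓝[>] 0) (𝓝 0))
    (h₁ : ∀ y, Tendsto (fun t => f (insertCoord 0 t y)) (𝓝[<] 1) (𝓝 0)) :
    ∫ p in coordDomain, dirD coordDomain (EuclideanSpace.single 0 1) f p = 0 := by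
  have hd := hf.deriv uniqueDiffOn_coordDomain (EuclideanSpace.single 0 1)
  rw [← integral_indicator isOpen_coordDomain.measurableSet, integral_eq_iterated
    ((integrable_indicator_iff isOpen_coordDomain.measurableSet).2 hd.integrableOn) 0]
  refine integral_eq_zero_of_ae (Eventually.of_forall fun y => ?_)
  have hmem : ∀ t, insertCoord 0 t y ∈ coordDomain ↔ t ∈ Ioo (0 : ℝ) 1 := fun t => by
    simp [coordDomain, insertCoord_same]
  obtain ⟨D, hD⟩ := hd.abs_insertCoord_le 0
  have hcont : Continuous fun t => insertCoord 0 t y :=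
    continuous_iff_continuousAt.2 fun t => (hasDerivAt_insertCoord 0 t y).continuousAt
  have hind : (fun t => coordDomain.indicator
      (dirD coordDomain (EuclideanSpace.single 0 1) f) (insertCoord 0 t y)) =
      (Ioo (0 : ℝ) 1).indicator fun t =>
        dirD coordDomain (EuclideanSpace.single 0 1) f (insertCoord 0 t y) := by
    funext t
    by_cases ht : t ∈ Ioo (0 : ℝ) 1
    · rw [indicator_of_mem ht, indicator_of_mem ((hmem t).2 ht)]
    · rw [indicator_of_notMem ht, indicator_of_notMem fun h => ht ((hmem t).1 h)]
  beta_reduce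
  rw [hind, integral_indicator measurableSet_Ioo]
  have hi : IntegrableOn (fun t => dirD coordDomain (EuclideanSpace.single 0 1) f
      (insertCoord 0 t y)) (Ioo 0 1) := by
    have hi : Integrable (fun t : ℝ => D * (1 + ‖t‖) ^ (-4 : ℤ)) :=
      (integrable_one_add_norm_zpow volume (by simp)).const_mul D
    refine hi.integrableOn.mono' ((hd.smooth.continuousOn.comp hcont.continuousOn
      fun t ht => (hmem t).2 ht).aestronglyMeasurable measurableSet_Ioo) ?_
    exact (ae_restrict_iff' measurableSet_Ioo).2
      (Eventually.of_forall fun t ht => hD y t ((hmem t).2 ht))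
  have := intervalIntegral.integral_eq_sub_of_hasDerivAt_of_tendsto zero_lt_one
    (fun t ht => hasDerivAt_comp_insertCoord hf.smooth 0 t y ((hmem t).2 ht))
    ((intervalIntegrable_iff_integrableOn_Ioo_of_le zero_le_one).2 hi) (h₀ y) (h₁ y)
  rw [intervalIntegral.integral_of_le zero_le_one, integral_Ioc_eq_integral_Ioo] at this
  simpa using this

end WessZumino

end

noncomputable section

namespace WessZumino

open Set Filter Topology MeasureTheory

/-! ### Extension of the diffeomorphisms of the ball past the boundary -/

/-- A smooth norm-preserving map of the closed ball with left inverse `h'`, homogeneous on a collar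
of the boundary, and equal to the identity on each sphere near the point at infinity. -/
structure LayeredOnBall (h h' : E 3 → E 3) (ε : ℝ) : Prop where
  smooth : ContDiffOn ℝ ∞ h (Ball 3)
  left_inv : ∀ x ∈ Ball 3, h' (h x) = x
  norm_map : ∀ x ∈ Ball 3, ‖h x‖ = ‖x‖
  collar : ∀ ρ ∈ Ioc (1 - ε) 1, ∀ u, ‖u‖ = 1 → h (ρ • u) = ρ • h u
  pole : ∀ ρ ∈ Ioo (0 : ℝ) 1, ∀ᶠ u in 𝓝 infinity, ‖u‖ = 1 → h (ρ • u) = ρ • u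

/-- A smooth norm-preserving map of `ℝ³` with left inverse `G'`, equal to the identity on each
sphere of radius less than one near the point at infinity. -/
structure Layered (G G' : E 3 → E 3) : Prop where
  smooth : ContDiff ℝ ∞ G
  left_inv : ∀ x, G' (G x) = x
  norm_map : ∀ x, ‖G x‖ = ‖x‖
  pole : ∀ ρ ∈ Ioo (0 : ℝ) 1, ∀ᶠ u in 𝓝 infinity, ‖u‖ = 1 → G (ρ • u) = ρ • u

theorem ext_mem {n : ℕ} (g : Equiv.Perm (Ball n)) {x : E n} (hx : x ∈ Ball n) :
    ext g x ∈ Ball n := by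
  simp only [ext, hx, dif_pos]
  exact (g ⟨x, hx⟩).2

theorem ext_inv_ext {n : ℕ} (g : Equiv.Perm (Ball n)) {x : E n} (hx : x ∈ Ball n) :
    ext g⁻¹ (ext g x) = x := by
  have h1 : ext g x = g ⟨x, hx⟩ := dif_pos hx
  rw [h1, ext, dif_pos (g ⟨x, hx⟩).2]
  simp

theorem smul_unit_mem_ball {n : ℕ} {ρ : ℝ} (h0 : 0 ≤ ρ) (h1 : ρ ≤ 1) {u : E n} (hu : ‖u‖ = 1) :
    ρ • u ∈ Ball n := by
  rw [mem_closedBall_zero_iff, norm_smul, hu, mul_one, Real.norm_of_nonneg h0]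
  exact h1

theorem norm_infinity : ‖infinity‖ = 1 := by
  simp [infinity, EuclideanSpace.norm_eq, Fin.sum_univ_three]

theorem exists_polar (x : E 3) : ∃ u : E 3, ‖u‖ = 1 ∧ x = ‖x‖ • u := by
  rcases eq_or_ne x 0 with rfl | hx
  · exact ⟨infinity, norm_infinity, by simp⟩
  · exact ⟨‖x‖⁻¹ • x, by simp [norm_smul, hx], by simp [smul_smul, hx]⟩

/-- Layers preserve the norm, radiality on the collar is homogeneity, and a support away from
infinity means that the layer fixes a neighbourhood of the pole. The inverse inherits each of these
from `g` itself. -/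
theorem layeredOnBall_of_mem {g : Equiv.Perm (Ball 3)} (hg : g ∈ BallDiffStar) :
    ∃ ε ∈ Ioo (0 : ℝ) 1, LayeredOnBall (ext g) (ext g⁻¹) ε ∧
      LayeredOnBall (ext g⁻¹) (ext g) ε := by
  obtain ⟨⟨⟨hs, hs', -⟩, B, ε, hε, hcol⟩, -, b, hb⟩ := hg
  have hnorm : ∀ x ∈ Ball 3, ‖ext g x‖ = ‖x‖ := by
    intro x hx
    obtain ⟨u, hu, hxu⟩ := exists_polar x
    have hmem : ‖x‖ ∈ Icc (0 : ℝ) 1 := ⟨norm_nonneg x, mem_closedBall_zero_iff.1 hx⟩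
    have h2 := (hb ‖x‖ hmem).2 ⟨u, mem_sphere_zero_iff_norm.2 hu⟩
    simp only at h2
    rw [← hxu] at h2
    rw [h2, norm_smul, norm_norm, mem_sphere_zero_iff_norm.1 (b ‖x‖ _).2, mul_one]
  have hcol' : ∀ ρ ∈ Ioc (1 - ε) 1, ∀ u, ‖u‖ = 1 → ext g (ρ • u) = ρ • ext g u := by
    intro ρ hρ u hu
    have h1 := hcol ρ hρ ⟨u, mem_sphere_zero_iff_norm.2 hu⟩
    have h2 := hcol 1 ⟨by linarith [hε.1], le_rfl⟩ ⟨u, mem_sphere_zero_iff_norm.2 hu⟩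
    simp only [one_smul] at h1 h2
    rw [h1, h2]
  have hpole : ∀ ρ ∈ Ioo (0 : ℝ) 1, ∀ᶠ u in 𝓝 infinity, ‖u‖ = 1 → ext g (ρ • u) = ρ • u := by
    intro ρ hρ
    obtain ⟨⟨-, -, hinf⟩, h2⟩ := hb ρ ⟨hρ.1.le, hρ.2.le⟩
    set I : S 2 := ⟨infinity, mem_sphere_zero_iff_norm.2 norm_infinity⟩ with hI
    have h3 : (closure {u : S 2 | b ρ u ≠ u})ᶜ ∈ 𝓝 I :=
      isClosed_closure.isOpen_compl.mem_nhds fun h => hinf I h rfl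
    rw [nhds_subtype_eq_comap, mem_comap] at h3
    obtain ⟨t, ht, hsub⟩ := h3
    filter_upwards [ht] with u hut hu
    have h4 : (⟨u, mem_sphere_zero_iff_norm.2 hu⟩ : S 2) ∈ (closure {u : S 2 | b ρ u ≠ u})ᶜ :=
      hsub hut
    have h5 : b ρ ⟨u, mem_sphere_zero_iff_norm.2 hu⟩ = ⟨u, mem_sphere_zero_iff_norm.2 hu⟩ := by
      by_contra h
      exact h4 (subset_closure h)
    have h6 := h2 ⟨u, mem_sphere_zero_iff_norm.2 hu⟩
    rwa [h5] at h6
  have hε0 : 0 < 1 - ε := by linarith [hε.2]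
  have hnorm' : ∀ x ∈ Ball 3, ‖ext g⁻¹ x‖ = ‖x‖ := by
    intro x hx
    have h1 := hnorm _ (ext_mem g⁻¹ hx)
    have h2 := ext_inv_ext g⁻¹ hx
    rw [inv_inv] at h2
    rw [← h1, h2]
  refine ⟨ε, hε, ⟨hs, fun x hx => ext_inv_ext g hx, hnorm, hcol', hpole⟩,
    ⟨hs', fun x hx => ?_, hnorm', ?_, ?_⟩⟩
  · have h2 := ext_inv_ext g⁻¹ hx
    rwa [inv_inv] at h2
  · intro ρ hρ u hu
    have hub : u ∈ Ball 3 := mem_closedBall_zero_iff.2 hu.le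
    have h1 := hcol' ρ hρ (ext g⁻¹ u) (by rw [hnorm' u hub, hu])
    have h2 := ext_inv_ext g⁻¹ hub
    rw [inv_inv] at h2
    rw [h2] at h1
    rw [← h1, ext_inv_ext g (smul_unit_mem_ball (hε0.trans hρ.1).le hρ.2
      (by rw [hnorm' u hub, hu]))]
  · intro ρ hρ
    filter_upwards [hpole ρ hρ] with u hu hu1
    conv_lhs => rw [← hu hu1]
    exact ext_inv_ext g (smul_unit_mem_ball hρ.1.le hρ.2.le hu1)

/-- The extension of `h` from the ball of radius `c` that is homogeneous past this ball. -/
def homogeneousExtension (c : ℝ) (h : E 3 → E 3) (x : E 3) : E 3 :=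
  if ‖x‖ ≤ c then h x else (‖x‖ / c) • h ((c / ‖x‖) • x)

/-- The radius `1 - ε / 2` lies strictly inside the collar, where `h` is already homogeneous. So
both branches agree on a neighbourhood of the gluing sphere, which gives smoothness there. -/
theorem homogeneousExtension_of_collar {h h' : E 3 → E 3} {ε : ℝ} (hε : ε ∈ Ioo (0 : ℝ) 1)
    (hh : LayeredOnBall h h' ε) {x : E 3} (hx : 1 - ε < ‖x‖) :
    homogeneousExtension (1 - ε / 2) h x =
      (‖x‖ / (1 - ε / 2)) • h (((1 - ε / 2) / ‖x‖) • x) := by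
  obtain ⟨h0, h1⟩ := hε
  have hx0 : 0 < ‖x‖ := by linarith
  have hc0 : (1 - ε / 2) ≠ 0 := by linarith
  unfold homogeneousExtension
  split_ifs with hle
  · obtain ⟨u, hu, hxu⟩ := exists_polar x
    have e1 : ((1 - ε / 2) / ‖x‖) • x = (1 - ε / 2) • u := by
      conv_lhs => rw [hxu, norm_smul, norm_norm, hu]
      rw [smul_smul]; field_simp
    rw [e1, hh.collar (1 - ε / 2) ⟨by linarith, by linarith⟩ u hu, smul_smul,
      div_mul_cancel₀ _ hc0, ← hh.collar ‖x‖ ⟨hx, by linarith⟩ u hu, ← hxu]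
  · rfl

theorem homogeneousExtension_of_mem {h h' : E 3 → E 3} {ε : ℝ} (hε : ε ∈ Ioo (0 : ℝ) 1)
    (hh : LayeredOnBall h h' ε) {x : E 3} (hx : x ∈ Ball 3) :
    homogeneousExtension (1 - ε / 2) h x = h x := by
  by_cases hle : ‖x‖ ≤ 1 - ε / 2
  · rw [homogeneousExtension, if_pos hle]
  · have h0 := hε.1
    have h1 := hε.2
    have hx0 : 0 < ‖x‖ := by linarith
    rw [homogeneousExtension_of_collar hε hh (by linarith)]
    obtain ⟨u, hu, hxu⟩ := exists_polar x
    have hc0 : (1 - ε / 2) ≠ 0 := by linarith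
    have e1 : ((1 - ε / 2) / ‖x‖) • x = (1 - ε / 2) • u := by
      conv_lhs => rw [hxu, norm_smul, norm_norm, hu]
      rw [smul_smul]; field_simp
    rw [e1, hh.collar (1 - ε / 2) ⟨by linarith, by linarith⟩ u hu, smul_smul,
      div_mul_cancel₀ _ hc0,
      ← hh.collar ‖x‖ ⟨by linarith, mem_closedBall_zero_iff.1 hx⟩ u hu, ← hxu]

theorem norm_rescale {c : ℝ} (hc : 0 < c) {x : E 3} (hx : x ≠ 0) : ‖(c / ‖x‖) • x‖ = c := by
  have := norm_pos_iff.2 hx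
  rw [norm_smul, Real.norm_of_nonneg (by positivity)]
  field_simp

/-- This removes the boundary: smoothness up to `ρ = 1` becomes ordinary smoothness on `ℝ³`, so full
derivatives may be used on a neighbourhood of the closed slab. -/
theorem layered_homogeneousExtension {h h' : E 3 → E 3} {ε : ℝ} (hε : ε ∈ Ioo (0 : ℝ) 1)
    (hh : LayeredOnBall h h' ε) :
    Layered (homogeneousExtension (1 - ε / 2) h) (homogeneousExtension (1 - ε / 2) h') := by
  have hε' := hε
  obtain ⟨h0, h1⟩ := hε'
  have hc0 : 0 < 1 - ε / 2 := by linarith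
  have hnorm : ∀ x, ‖homogeneousExtension (1 - ε / 2) h x‖ = ‖x‖ := by
    intro x
    by_cases hle : ‖x‖ ≤ 1 - ε / 2
    · rw [homogeneousExtension, if_pos hle, hh.norm_map x
        (mem_closedBall_zero_iff.2 (by linarith))]
    · have hx : x ≠ 0 := fun hx => hle (by simpa [hx] using hc0.le)
      rw [homogeneousExtension, if_neg hle, norm_smul, hh.norm_map _
        (mem_closedBall_zero_iff.2 (by rw [norm_rescale hc0 hx]; linarith)), norm_rescale hc0 hx,
        Real.norm_of_nonneg (by positivity), div_mul_cancel₀ _ hc0.ne']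
  refine ⟨contDiff_iff_contDiffAt.2 fun x => ?_, fun x => ?_, hnorm, fun ρ hρ => ?_⟩
  · have hint : ∀ y : E 3, ‖y‖ < 1 → ContDiffAt ℝ ∞ h y := fun y hy =>
      hh.smooth.contDiffAt (Metric.closedBall_mem_nhds_of_mem (by simpa using hy))
    by_cases hlt : ‖x‖ < 1 - ε / 2
    · refine (hint x (by linarith)).congr_of_eventuallyEq ?_
      filter_upwards [continuous_norm.continuousAt.eventually_lt continuousAt_const hlt] with y hy
      rw [homogeneousExtension, if_pos hy.le]
    · have hx : x ≠ 0 := fun hx => hlt (by simpa [hx] using hc0)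
      have hform : ContDiffAt ℝ ∞ (fun x : E 3 =>
          (‖x‖ / (1 - ε / 2)) • h (((1 - ε / 2) / ‖x‖) • x)) x := by
        have hn : ContDiffAt ℝ ∞ (fun x : E 3 => ‖x‖) x := contDiffAt_norm ℝ hx
        have hin : ContDiffAt ℝ ∞ (fun x : E 3 => ((1 - ε / 2) / ‖x‖) • x) x :=
          (contDiffAt_const.div hn (norm_ne_zero_iff.2 hx)).smul contDiffAt_id
        refine (hn.div_const _).smul (ContDiffAt.comp x (hint _ ?_) hin)
        rw [norm_rescale hc0 hx]; linarith
      refine hform.congr_of_eventuallyEq ?_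
      filter_upwards [continuousAt_const.eventually_lt continuous_norm.continuousAt
        (show 1 - ε < ‖x‖ by linarith)] with y hy
      exact homogeneousExtension_of_collar hε hh hy
  · by_cases hle : ‖x‖ ≤ 1 - ε / 2
    · have hxb : x ∈ Ball 3 := mem_closedBall_zero_iff.2 (by linarith)
      have e1 : homogeneousExtension (1 - ε / 2) h x = h x := by
        rw [homogeneousExtension, if_pos hle]
      rw [e1, homogeneousExtension, if_pos (by rwa [hh.norm_map x hxb]), hh.left_inv x hxb]
    · have hx : x ≠ 0 := fun hx => hle (by simpa [hx] using hc0.le)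
      have hx0 := norm_pos_iff.2 hx
      rw [homogeneousExtension, if_neg (by rwa [hnorm x]), hnorm x]
      nth_rw 1 [homogeneousExtension]
      rw [if_neg hle, smul_smul]
      have e2 : (1 - ε / 2) / ‖x‖ * (‖x‖ / (1 - ε / 2)) = 1 := by
        rw [div_mul_div_cancel₀ hx0.ne', div_self hc0.ne']
      have e3 : ‖x‖ / (1 - ε / 2) * ((1 - ε / 2) / ‖x‖) = 1 := by
        rw [div_mul_div_cancel₀ hc0.ne', div_self hx0.ne']
      rw [e2, one_smul, hh.left_inv _ (mem_closedBall_zero_iff.2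
        (by rw [norm_rescale hc0 hx]; linarith)), smul_smul, e3, one_smul]
  · filter_upwards [hh.pole ρ hρ] with u hu hu1
    rw [homogeneousExtension_of_mem hε hh (smul_unit_mem_ball hρ.1.le hρ.2.le hu1), hu hu1]

theorem exists_layered {g : Equiv.Perm (Ball 3)} (hg : g ∈ BallDiffStar) :
    ∃ G G' : E 3 → E 3, Layered G G' ∧ Layered G' G ∧ ∀ x ∈ Ball 3, G x = ext g x := by
  obtain ⟨ε, hε, h1, h2⟩ := layeredOnBall_of_mem hg
  exact ⟨_, _, layered_homogeneousExtension hε h1, layered_homogeneousExtension hε h2,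
    fun x hx => homogeneousExtension_of_mem hε h1 hx⟩

/-! ### The rescaled map on spheres -/

/-- The rescaled map `G (ρ v) / ρ`, extended smoothly to `ρ = 0`. -/
def rescaled (G : E 3 → E 3) (ρ : ℝ) (v : E 3) : E 3 :=
  ∫ t in (0 : ℝ)..1, fderiv ℝ G ((t * ρ) • v) v

/-- The division by `ρ` is performed by Hadamard's integral formula, which is what makes `ρ = 0` a
smooth point. -/
theorem contDiff_rescaled {G : E 3 → E 3} (hG : ContDiff ℝ ∞ G) :
    ContDiff ℝ ∞ fun q : ℝ × E 3 => rescaled G q.1 q.2 := by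
  rw [← contDiffOn_univ]
  refine contDiffOn_intervalIntegral isOpen_univ (f := fun t (q : ℝ × E 3) =>
    fderiv ℝ G ((t * q.1) • q.2) q.2) ?_
  have h1 : ContDiff ℝ ∞ (fderiv ℝ G) := hG.fderiv_right le_rfl
  refine ContDiff.contDiffOn ?_
  exact (h1.comp (by fun_prop : ContDiff ℝ ∞ fun q : ℝ × ℝ × E 3 =>
    (q.1 * q.2.1) • q.2.2)).clm_apply (by fun_prop)

theorem smul_rescaled {G : E 3 → E 3} (hG : ContDiff ℝ ∞ G) (ρ : ℝ) (v : E 3) :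
    ρ • rescaled G ρ v = G (ρ • v) - G 0 := by
  have hd : ∀ t ∈ uIcc (0 : ℝ) 1, HasDerivAt (fun t : ℝ => G ((t * ρ) • v))
      (ρ • fderiv ℝ G ((t * ρ) • v) v) t := by
    intro t _
    have h1 : HasDerivAt (fun t : ℝ => (t * ρ) • v) (ρ • v) t := by
      simpa using ((hasDerivAt_id t).mul_const ρ).smul_const v
    have h2 := (hG.differentiable (by simp) ((t * ρ) • v)).hasFDerivAt.comp_hasDerivAt t h1
    rw [map_smul] at h2
    exact h2
  have hc : Continuous fun t : ℝ => ρ • fderiv ℝ G ((t * ρ) • v) v := by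
    have h1 : Continuous (fderiv ℝ G) := hG.continuous_fderiv (by simp)
    fun_prop
  have := intervalIntegral.integral_eq_sub_of_hasDerivAt hd (hc.intervalIntegrable _ _)
  rw [intervalIntegral.integral_smul] at this
  simpa [rescaled] using this

theorem rescaled_zero (G : E 3 → E 3) (v : E 3) : rescaled G 0 v = fderiv ℝ G 0 v := by
  simp [rescaled]

theorem Layered.map_zero {G G' : E 3 → E 3} (h : Layered G G') : G 0 = 0 := by
  rw [← norm_eq_zero, h.norm_map, norm_zero]

theorem Layered.rescaled_eq {G G' : E 3 → E 3} (h : Layered G G') {ρ : ℝ} (hρ : ρ ≠ 0)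
    (v : E 3) : rescaled G ρ v = ρ⁻¹ • G (ρ • v) := by
  have := smul_rescaled h.smooth ρ v
  rw [h.map_zero, sub_zero] at this
  rw [← this, smul_smul, inv_mul_cancel₀ hρ, one_smul]

theorem Layered.norm_rescaled {G G' : E 3 → E 3} (h : Layered G G') {ρ : ℝ} (hρ : ρ ≠ 0)
    (v : E 3) : ‖rescaled G ρ v‖ = ‖v‖ := by
  rw [h.rescaled_eq hρ, norm_smul, h.norm_map, norm_smul, norm_inv, ← mul_assoc,
    inv_mul_cancel₀ (norm_ne_zero_iff.2 hρ), one_mul]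

/-- The point of the sphere with stereographic coordinate `w` with respect to the other pole. -/
def invStereoSouth (p : E 3) : E 3 :=
  (1 + (p 1 ^ 2 + p 2 ^ 2))⁻¹ • !₂[2 * p 1, 2 * p 2, p 1 ^ 2 + p 2 ^ 2 - 1]

/-- The point of the sphere with stereographic coordinate `z = (p₁, p₂)`. -/
def invStereoCoord (p : E 3) : E 3 := invStereo !₂[p 1, p 2]

theorem invStereoCoord_eq (p : E 3) : invStereoCoord p =
    (1 + (p 1 ^ 2 + p 2 ^ 2))⁻¹ • !₂[2 * p 1, 2 * p 2, 1 - (p 1 ^ 2 + p 2 ^ 2)] := by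
  simp [invStereoCoord, invStereo, EuclideanSpace.norm_sq_eq]

theorem one_add_sq_pos (p : E 3) : 0 < 1 + (p 1 ^ 2 + p 2 ^ 2) := by positivity

theorem contDiff_invStereoSouth : ContDiff ℝ ∞ invStereoSouth := by
  unfold invStereoSouth
  refine ContDiff.smul ((by fun_prop : ContDiff ℝ ∞ fun p : E 3 =>
    1 + (p 1 ^ 2 + p 2 ^ 2)).inv fun p => (one_add_sq_pos p).ne') ?_
  rw [contDiff_euclidean]
  intro i
  fin_cases i <;> simp <;> fun_prop

theorem contDiff_invStereoCoord : ContDiff ℝ ∞ invStereoCoord := by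
  rw [show invStereoCoord = _ from funext invStereoCoord_eq]
  refine ContDiff.smul ((by fun_prop : ContDiff ℝ ∞ fun p : E 3 =>
    1 + (p 1 ^ 2 + p 2 ^ 2)).inv fun p => (one_add_sq_pos p).ne') ?_
  rw [contDiff_euclidean]
  intro i
  fin_cases i <;> simp <;> fun_prop

theorem norm_invStereoSouth (p : E 3) : ‖invStereoSouth p‖ = 1 := by
  have h0 := one_add_sq_pos p
  rw [invStereoSouth, norm_smul, norm_inv, Real.norm_of_nonneg h0.le, EuclideanSpace.norm_eq,
    inv_mul_eq_one₀ h0.ne']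
  rw [eq_comm, Real.sqrt_eq_iff_mul_self_eq (by positivity) h0.le]
  simp [Fin.sum_univ_three]
  ring

theorem norm_invStereoCoord (p : E 3) : ‖invStereoCoord p‖ = 1 := by
  have h0 := one_add_sq_pos p
  rw [invStereoCoord_eq, norm_smul, norm_inv, Real.norm_of_nonneg h0.le, EuclideanSpace.norm_eq,
    inv_mul_eq_one₀ h0.ne']
  rw [eq_comm, Real.sqrt_eq_iff_mul_self_eq (by positivity) h0.le]
  simp [Fin.sum_univ_three]
  ring

/-- The map `z ↦ z / |z|²` is the transition between the two stereographic charts. It reverses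
orientation, which is harmless because the chart at infinity only serves for estimates. -/
theorem invStereoSouth_inversion {p : E 3} (hp : p ∈ outerDomain) :
    invStereoSouth (inversion p) = invStereoCoord p := by
  have h0 : p 1 ^ 2 + p 2 ^ 2 ≠ 0 := (zero_lt_one.trans hp.2.2).ne'
  have h1 := (one_add_sq_pos p).ne'
  rw [invStereoCoord_eq]
  have h2 : (p 1 / (p 1 ^ 2 + p 2 ^ 2)) ^ 2 + (p 2 / (p 1 ^ 2 + p 2 ^ 2)) ^ 2 =
      (p 1 ^ 2 + p 2 ^ 2)⁻¹ := by
    rw [div_pow, div_pow, ← add_div]; field_simp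
  have h3 : (1 + (p 1 ^ 2 + p 2 ^ 2)⁻¹)⁻¹ = (p 1 ^ 2 + p 2 ^ 2) * (1 + (p 1 ^ 2 + p 2 ^ 2))⁻¹ := by
    rw [inv_eq_iff_eq_inv, mul_inv, inv_inv]; field_simp; ring
  ext i
  fin_cases i <;> simp [invStereoSouth, inversion, h2, h3] <;> field_simp

/-- The displacement of the rescaled map, in the stereographic coordinate. -/
def displacement (G : E 3 → E 3) (p : E 3) : E 3 :=
  rescaled G (p 0) (invStereoCoord p) - invStereoCoord p

/-- The displacement of the rescaled map, in the coordinate at infinity. -/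
def displacementSouth (G : E 3 → E 3) (p : E 3) : E 3 :=
  rescaled G (p 0) (invStereoSouth p) - invStereoSouth p

theorem contDiff_displacement {G : E 3 → E 3} (hG : ContDiff ℝ ∞ G) :
    ContDiff ℝ ∞ (displacement G) :=
  ((contDiff_rescaled hG).comp ((by fun_prop : ContDiff ℝ ∞ fun p : E 3 => p 0).prodMk
    contDiff_invStereoCoord)).sub contDiff_invStereoCoord

theorem contDiff_displacementSouth {G : E 3 → E 3} (hG : ContDiff ℝ ∞ G) :
    ContDiff ℝ ∞ (displacementSouth G) :=
  ((contDiff_rescaled hG).comp ((by fun_prop : ContDiff ℝ ∞ fun p : E 3 => p 0).prodMk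
    contDiff_invStereoSouth)).sub contDiff_invStereoSouth

/-- Every derivative is continuous, so its zeros form a closed set. -/
theorem Flat.of_closure {A B : Set (E 3)} {f : E 3 → ℝ} (hf : Flat univ A f)
    (hB : B ⊆ closure A) : Flat univ B f := by
  have key : ∀ f : E 3 → ℝ, Flat univ A f → ∀ b ∈ B, f b = 0 := by
    intro f hf b hb
    have hc : Continuous f := (contDiffOn_univ.1 hf.smooth).continuous
    exact closure_minimal (s := A) (t := f ⁻¹' {0}) (fun a ha => hf.eq_zero ha)
      (isClosed_singleton.preimage hc) (hB hb)
  refine ⟨hf.smooth, fun n => ?_⟩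
  induction n generalizing f with
  | zero => exact key f hf
  | succ n ih => exact ⟨key f hf, fun v => ih (hf.deriv uniqueDiffOn_univ v)⟩

/-- For each fixed `ρ` in `(0,1)` the displacement vanishes near `w = 0`, on a neighbourhood that
may shrink with `ρ`. `flat_of_slices` with the slices `ρ = const` needs no uniformity; the ends `ρ =
0, 1`, where nothing is known near the pole, follow by closure. -/
theorem Layered.flat_displacementSouth {G G' : E 3 → E 3} (h : Layered G G') (i : Fin 3) :
    Flat univ axis fun p => displacementSouth G p i := by
  set A : Set (E 3) := {p | p 0 ∈ Ioo (0 : ℝ) 1 ∧ p 1 = 0 ∧ p 2 = 0} with hA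
  have hcl : axis ⊆ closure A := by
    rintro p ⟨h0, h1, h2⟩
    have hc : Continuous fun t : ℝ => t • (EuclideanSpace.single 0 1 : E 3) := by fun_prop
    have hp : p = p 0 • (EuclideanSpace.single 0 1 : E 3) := by
      ext i; fin_cases i <;> simp [h1, h2]
    rw [hp]
    refine map_mem_closure hc (s := Ioo (0 : ℝ) 1) ?_ ?_
    · rwa [closure_Ioo zero_ne_one]
    · intro t ht
      simpa [hA] using ht
  refine Flat.of_closure (A := A) ?_ hcl
  refine flat_of_slices (EuclideanSpace.proj 0 : E 3 →L[ℝ] ℝ) (e := EuclideanSpace.single 0 1)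
    (by simp) uniqueDiffOn_univ (by simp) (subset_univ _) ?_ ?_ ?_ ?_
  · intro a _
    exact subset_closure (by simp)
  · rintro a ⟨h0, h1, h2⟩
    have hc : Continuous fun t : ℝ => a 0 + t := by fun_prop
    have : ∀ᶠ t in 𝓝 (0 : ℝ), a 0 + t ∈ Ioo (0 : ℝ) 1 :=
      hc.continuousAt.eventually (isOpen_Ioo.mem_nhds (by simpa using h0))
    filter_upwards [this] with t ht
    simpa [hA, h1, h2] using ht
  · exact ((EuclideanSpace.proj i : E 3 →L[ℝ] ℝ).contDiff.comp
      (contDiff_displacementSouth h.smooth)).contDiffOn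
  · rintro a ⟨h0, h1, h2⟩
    have hinf : invStereoSouth a = infinity := by
      ext i; fin_cases i <;> simp [invStereoSouth, infinity, h1, h2]
    have hev : ∀ᶠ p in 𝓝 a, ‖invStereoSouth p‖ = 1 →
        G (a 0 • invStereoSouth p) = a 0 • invStereoSouth p :=
      (contDiff_invStereoSouth.continuous.continuousAt (x := a)).eventually
        (hinf ▸ h.pole (a 0) h0)
    obtain ⟨O, hO, hOo, haO⟩ := mem_nhds_iff.1 hev
    refine ⟨O, hOo, haO, fun p hp hpa => ?_⟩
    have hpa' : p 0 = a 0 := hpa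
    have h3 := hO hp.1 (norm_invStereoSouth p)
    have h4 : displacementSouth G p = 0 := by
      rw [displacementSouth, hpa', h.rescaled_eq h0.1.ne', h3, smul_smul,
        inv_mul_cancel₀ h0.1.ne', one_smul, sub_self]
    simp [h4]

/-- The derivative at the origin is the identity. -/
theorem Layered.fderiv_zero {G G' : E 3 → E 3} (h : Layered G G') (v : E 3) :
    fderiv ℝ G 0 v = v := by
  -- At `ρ = 0` the displacement is the linear map `M` evaluated on the unit sphere. Flatness at the
  -- pole will force `M = 0`.
  set M : E 3 →L[ℝ] E 3 := fderiv ℝ G 0 - ContinuousLinearMap.id ℝ (E 3) with hM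
  have hdisp : ∀ p : E 3, p 0 = 0 → displacementSouth G p = M (invStereoSouth p) := by
    intro p hp
    simp [displacementSouth, hp, rescaled_zero, hM]
  have h2 : M (EuclideanSpace.single 2 1) = 0 := by
    ext i
    have := (h.flat_displacementSouth i).eq_zero (a := 0) (by simp [axis])
    rw [hdisp 0 (by simp)] at this
    have e : invStereoSouth 0 = -EuclideanSpace.single 2 1 := by
      ext i; fin_cases i <;> simp [invStereoSouth]
    rw [e, map_neg] at this
    simpa using this
  -- At `w = s` along a horizontal direction the sphere point is `2s / (1 + s²)` times the
  -- horizontal basis vector plus a multiple of the vertical one, which `M` kills. Flatness bounds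
  -- the image by `C s²`; dividing by `s` and letting `s → 0` gives zero.
  have h01 : ∀ k : Fin 2, M (EuclideanSpace.single k.castSucc 1) = 0 := by
    intro k
    ext i
    obtain ⟨C, hC, hb⟩ := (h.flat_displacementSouth i).abs_le 2
    have key : ∀ s ∈ Ioo (0 : ℝ) 1, |M (EuclideanSpace.single k.castSucc 1) i| ≤ C * s := by
      intro s hs
      have hax : axisDist (s • EuclideanSpace.single k.succ 1) = s := by
        fin_cases k <;> simp [axisDist, Real.sqrt_sq hs.1.le]
      have e : invStereoSouth (s • EuclideanSpace.single k.succ 1) =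
          (2 * s * (1 + s ^ 2)⁻¹) • EuclideanSpace.single k.castSucc 1 +
            ((s ^ 2 - 1) * (1 + s ^ 2)⁻¹) • EuclideanSpace.single 2 1 := by
        ext i; fin_cases k <;> fin_cases i <;> simp [invStereoSouth] <;> ring
      have h3 := hb (s • EuclideanSpace.single k.succ 1) (by simp) (by rw [hax]; exact hs.2.le)
      rw [hdisp _ (by simp), e, map_add, map_smul, map_smul, h2, smul_zero, add_zero, hax] at h3
      simp only [PiLp.smul_apply, smul_eq_mul, abs_mul, abs_inv, abs_of_pos hs.1,
        abs_of_pos (show (0 : ℝ) < 1 + s ^ 2 by positivity), abs_two] at h3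
      have h4 : s * (1 + s ^ 2)⁻¹ * 2 * |M (EuclideanSpace.single k.castSucc 1) i| ≤
          s * (1 + s ^ 2)⁻¹ * 2 * (C * s) := by
        calc _ = 2 * s * (1 + s ^ 2)⁻¹ * |M (EuclideanSpace.single k.castSucc 1) i| := by ring
          _ ≤ C * s ^ 2 := h3
          _ ≤ ((1 + s ^ 2)⁻¹ * 2) * (C * s ^ 2) := by
            refine le_mul_of_one_le_left (by positivity) ?_
            rw [inv_mul_eq_div, one_le_div (by positivity)]
            nlinarith [hs.1, hs.2]
          _ = _ := by ring
      exact le_of_mul_le_mul_left h4 (by have := hs.1; positivity)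
    have hlim : Tendsto (fun s : ℝ => C * s) (𝓝[>] 0) (𝓝 0) := by
      have : Continuous fun s : ℝ => C * s := by fun_prop
      simpa using (this.tendsto 0).mono_left nhdsWithin_le_nhds
    have h5 : |M (EuclideanSpace.single k.castSucc 1) i| ≤ 0 := by
      refine ge_of_tendsto hlim ?_
      filter_upwards [Ioo_mem_nhdsGT one_pos] with s hs using key s hs
    simpa using abs_nonpos_iff.1 h5
  have hMv : M v = 0 := by
    rw [E3_eq_sum v]
    have e0 : M (EuclideanSpace.single 0 1) = 0 := h01 0
    have e1 : M (EuclideanSpace.single 1 1) = 0 := h01 1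
    simp [e0, e1, h2]
  exact sub_eq_zero.1 hMv

theorem Layered.displacement_zero {G G' : E 3 → E 3} (h : Layered G G') {p : E 3}
    (hp : p 0 = 0) : displacement G p = 0 := by
  rw [displacement, hp, rescaled_zero, h.fderiv_zero, sub_self]

/-- The displacement and all its derivatives decay rapidly. -/
theorem Layered.growth_displacement {G G' : E 3 → E 3} (h : Layered G G') (i : Fin 3) (m : ℤ) :
    Growth coordDomain m fun p => displacement G p i := by
  have hout : Growth outerDomain m fun p => displacement G p i := by
    refine ((h.flat_displacementSouth i).growth_comp_inversion m).congr fun p hp => ?_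
    have : inversion p 0 = p 0 := rfl
    simp only [Function.comp_apply, displacementSouth, displacement, invStereoSouth_inversion hp,
      this]
  set inner : Set (E 3) := {p | 0 < p 0 ∧ p 0 < 1 ∧ p 1 ^ 2 + p 2 ^ 2 < 2} with hinner
  have hopen : IsOpen inner := by
    have h0 : Continuous fun p : E 3 => p 0 := by fun_prop
    have h1 : Continuous fun p : E 3 => p 1 ^ 2 + p 2 ^ 2 := by fun_prop
    exact (isOpen_Ioi.preimage h0).inter ((isOpen_Iio.preimage h0).inter (isOpen_Iio.preimage h1))
  have hin : Growth inner m fun p => displacement G p i := by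
    refine growth_of_isBounded hopen ?_ m ((EuclideanSpace.proj i : E 3 →L[ℝ] ℝ).contDiff.comp
      (contDiff_displacement h.smooth))
    refine (Metric.isBounded_closedBall (x := (0 : E 3)) (r := 2)).subset ?_
    rintro p ⟨h1, h2, h3⟩
    rw [mem_closedBall_zero_iff, EuclideanSpace.norm_eq, Real.sqrt_le_left (by norm_num)]
    simp only [Real.norm_eq_abs, sq_abs, Fin.sum_univ_three]
    nlinarith
  have hU : coordDomain = inner ∪ outerDomain := by
    ext p
    constructor
    · rintro ⟨h1, h2⟩
      by_cases h3 : p 1 ^ 2 + p 2 ^ 2 < 2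
      · exact Or.inl ⟨h1, h2, h3⟩
      · exact Or.inr ⟨h1, h2, by linarith⟩
    · rintro (⟨h1, h2, -⟩ | ⟨h1, h2, -⟩) <;> exact ⟨h1, h2⟩
  rw [hU]
  exact hin.union hopen isOpen_outerDomain hout

end WessZumino

end

noncomputable section

namespace WessZumino

open Set Filter Topology MeasureTheory

/-! ### The primitive of the Wess-Zumino density -/

/-- The partial derivative on the coordinate domain. -/
def pd (j : Fin 3) (f : E 3 → ℝ) : E 3 → ℝ := dirD coordDomain (EuclideanSpace.single j 1) f

/-- Smooth functions on the coordinate domain that decay rapidly with all their derivatives. -/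
def Rapid (f : E 3 → ℝ) : Prop := ∀ m, Growth coordDomain m f

section Rapid

variable {f g : E 3 → ℝ}

local notation "hU" => uniqueDiffOn_coordDomain

theorem Rapid.rapid_pd (hf : Rapid f) (j : Fin 3) : Rapid (pd j f) := fun m => (hf m).deriv hU _
theorem Rapid.add (hf : Rapid f) (hg : Rapid g) : Rapid fun p => f p + g p :=
  fun m => (hf m).add hU (hg m)
theorem Rapid.sub (hf : Rapid f) (hg : Rapid g) : Rapid fun p => f p - g p :=
  fun m => (hf m).sub hU (hg m)
theorem Rapid.const_mul (hf : Rapid f) (c : ℝ) : Rapid fun p => c * f p :=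
  fun m => (hf m).const_mul hU c
theorem Rapid.mul_left {k : ℤ} (hg : Growth coordDomain k g) (hf : Rapid f) :
    Rapid fun p => g p * f p := fun m => by simpa using hg.mul hU (hf (m - k))
theorem Rapid.mul_right {k : ℤ} (hf : Rapid f) (hg : Growth coordDomain k g) :
    Rapid fun p => f p * g p := fun m => by simpa using (hf (m - k)).mul hU hg
theorem Rapid.smooth (hf : Rapid f) : ContDiffOn ℝ ∞ f coordDomain := (hf 0).smooth
theorem Rapid.congr (hf : Rapid f) (h : EqOn f g coordDomain) : Rapid g := fun m => (hf m).congr h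

theorem Rapid.integrableOn (hf : Rapid f) : IntegrableOn f coordDomain := (hf (-4)).integrableOn

end Rapid

/-- The components of the Jacobian matrix of `z ↦ z + (f, g)` in the basis `1, i` of the conformal
matrices and the basis of the reflections. -/
def confRe (f g : E 3 → ℝ) (p : E 3) : ℝ := 1 + 2⁻¹ * (pd 1 f p + pd 2 g p)
/-- See `confRe`. -/
def confIm (f g : E 3 → ℝ) (p : E 3) : ℝ := 2⁻¹ * (pd 1 g p - pd 2 f p)
/-- See `confRe`. -/
def reflRe (f g : E 3 → ℝ) (p : E 3) : ℝ := 2⁻¹ * (pd 1 f p - pd 2 g p)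
/-- See `confRe`. -/
def reflIm (f g : E 3 → ℝ) (p : E 3) : ℝ := 2⁻¹ * (pd 2 f p + pd 1 g p)
/-- The determinant of the conformal part. -/
def confDet (f g : E 3 → ℝ) (p : E 3) : ℝ := confRe f g p ^ 2 + confIm f g p ^ 2
/-- The Jacobian determinant of `z ↦ z + (f, g)`. -/
def layerDet (f g : E 3 → ℝ) (p : E 3) : ℝ :=
  confRe f g p ^ 2 + confIm f g p ^ 2 - reflRe f g p ^ 2 - reflIm f g p ^ 2

/-- The angular form of the conformal part. -/
def confAngle (f g : E 3 → ℝ) (j : Fin 3) : E 3 → ℝ :=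
  angular coordDomain (confDet f g) (confRe f g) (confIm f g) (EuclideanSpace.single j 1)
/-- The angular form of the reflection part. -/
def reflAngle (f g : E 3 → ℝ) (j : Fin 3) : E 3 → ℝ :=
  angular coordDomain (layerDet f g) (reflRe f g) (reflIm f g) (EuclideanSpace.single j 1)
/-- The coefficients of the primitive. -/
def primitive (f g : E 3 → ℝ) (j k : Fin 3) (p : E 3) : ℝ :=
  confAngle f g j p * reflAngle f g k p - confAngle f g k p * reflAngle f g j p

/-! ### The primitive `φ ∧ σ` and Stokes' theorem -/

section Primitive

variable {f g : E 3 → ℝ}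

local notation "hU" => uniqueDiffOn_coordDomain

theorem Rapid.confRe_sub_one (hf : Rapid f) (hg : Rapid g) : Rapid fun p => confRe f g p - 1 :=
  (((hf.rapid_pd 1).add (hg.rapid_pd 2)).const_mul 2⁻¹).congr fun p _ => by simp [confRe]

theorem Rapid.growth_confRe (hf : Rapid f) (hg : Rapid g) : Growth coordDomain 0 (confRe f g) :=
  (Growth.const coordDomain 1).add hU ((((hf.rapid_pd 1).add (hg.rapid_pd 2)).const_mul 2⁻¹) 0)

theorem Rapid.rapid_confIm (hf : Rapid f) (hg : Rapid g) : Rapid (confIm f g) :=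
  ((hg.rapid_pd 1).sub (hf.rapid_pd 2)).const_mul 2⁻¹
theorem Rapid.rapid_reflRe (hf : Rapid f) (hg : Rapid g) : Rapid (reflRe f g) :=
  ((hf.rapid_pd 1).sub (hg.rapid_pd 2)).const_mul 2⁻¹
theorem Rapid.rapid_reflIm (hf : Rapid f) (hg : Rapid g) : Rapid (reflIm f g) :=
  ((hf.rapid_pd 2).add (hg.rapid_pd 1)).const_mul 2⁻¹

theorem Rapid.growth_confDet (hf : Rapid f) (hg : Rapid g) : Growth coordDomain 0 (confDet f g) := by
  have h1 := (hf.growth_confRe hg).mul hU (hf.growth_confRe hg)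
  have h2 := ((hf.rapid_confIm hg).mul_left ((hf.rapid_confIm hg) 0)) 0
  exact (Growth.add hU h1 h2).congr fun p _ => by simp [confDet, pow_two]

theorem Rapid.layerDet_sub_one (hf : Rapid f) (hg : Rapid g) :
    Rapid fun p => layerDet f g p - 1 := by
  have h1 := (hf.confRe_sub_one hg).mul_right
    ((hf.growth_confRe hg).add hU (Growth.const coordDomain 1))
  have h2 := (hf.rapid_confIm hg).mul_left ((hf.rapid_confIm hg) 0)
  have h3 := (hf.rapid_reflRe hg).mul_left ((hf.rapid_reflRe hg) 0)
  have h4 := (hf.rapid_reflIm hg).mul_left ((hf.rapid_reflIm hg) 0)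
  exact (((h1.add h2).sub h3).sub h4).congr fun p _ => by simp only [layerDet]; ring

theorem Rapid.growth_layerDet (hf : Rapid f) (hg : Rapid g) : Growth coordDomain 0 (layerDet f g) :=
  ((Growth.const coordDomain 1).add hU (hf.layerDet_sub_one hg 0)).congr fun p _ => by simp

/-- A positive determinant keeps the conformal part away from zero, so its angular form is defined
everywhere. This is the retraction of `GL₂⁺(ℝ)` onto the conformal matrices. -/
theorem layerDet_le_confDet (p : E 3) : layerDet f g p ≤ confDet f g p := by
  simp only [layerDet, confDet]
  nlinarith [sq_nonneg (reflRe f g p), sq_nonneg (reflIm f g p)]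

variable {c : ℝ}

theorem Rapid.rapid_confAngle (hf : Rapid f) (hg : Rapid g) (hc : 0 < c)
    (hd : ∀ p ∈ coordDomain, c ≤ layerDet f g p) (j : Fin 3) : Rapid (confAngle f g j) := by
  have h1 := ((hf.rapid_confIm hg).rapid_pd j).mul_left (hf.growth_confRe hg)
  have h2 := (hf.rapid_confIm hg).mul_right ((hf.growth_confRe hg).deriv hU (EuclideanSpace.single j 1))
  exact (h1.sub h2).mul_right ((hf.growth_confDet hg).inv hU hc
    fun p hp => (hd p hp).trans (layerDet_le_confDet p))

theorem Rapid.rapid_reflAngle (hf : Rapid f) (hg : Rapid g) (hc : 0 < c)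
    (hd : ∀ p ∈ coordDomain, c ≤ layerDet f g p) (j : Fin 3) : Rapid (reflAngle f g j) := by
  have h1 := ((hf.rapid_reflIm hg).rapid_pd j).mul_left ((hf.rapid_reflRe hg) 0)
  have h2 := (hf.rapid_reflIm hg).mul_right (((hf.rapid_reflRe hg).rapid_pd j) 0)
  exact (h1.sub h2).mul_right ((hf.growth_layerDet hg).inv hU hc hd)

theorem Rapid.rapid_primitive (hf : Rapid f) (hg : Rapid g) (hc : 0 < c)
    (hd : ∀ p ∈ coordDomain, c ≤ layerDet f g p) (j k : Fin 3) : Rapid (primitive f g j k) :=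
  ((hf.rapid_confAngle hg hc hd j).mul_right (hf.rapid_reflAngle hg hc hd k 0)).sub
    ((hf.rapid_confAngle hg hc hd k).mul_right (hf.rapid_reflAngle hg hc hd j 0))

theorem dirD_sq {X : Type*} [NormedAddCommGroup X] [NormedSpace ℝ X] {S : Set X}
    (hS : UniqueDiffOn ℝ S) {f : X → ℝ} (hf : ContDiffOn ℝ ∞ f S) (v : X) :
    EqOn (dirD S v (fun p => f p ^ 2)) (fun p => 2 * f p * dirD S v f p) S := by
  intro p hp
  have := dirD_mul hS hf hf v hp
  simp only [pow_two]
  rw [this]; ring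

theorem coordDomain_subset_closure : coordDomain ⊆ closure (interior coordDomain) := by
  rw [isOpen_coordDomain.interior_eq]; exact subset_closure

theorem pd_confDet (hf : Rapid f) (hg : Rapid g) (j : Fin 3) {p : E 3} (hp : p ∈ coordDomain) :
    pd j (confDet f g) p = 2 * confRe f g p * pd j (confRe f g) p +
      2 * confIm f g p * pd j (confIm f g) p := by
  have h1 := (hf.growth_confRe hg).smooth
  have h2 := (hf.rapid_confIm hg).smooth
  have e : confDet f g = fun p => confRe f g p ^ 2 + confIm f g p ^ 2 := rfl
  simp only [pd, e]
  rw [dirD_add hU (h1.pow 2) (h2.pow 2) _ hp]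
  beta_reduce
  rw [dirD_sq hU h1 _ hp, dirD_sq hU h2 _ hp]

theorem pd_layerDet (hf : Rapid f) (hg : Rapid g) (j : Fin 3) {p : E 3} (hp : p ∈ coordDomain) :
    pd j (layerDet f g) p = 2 * (confRe f g p * pd j (confRe f g) p +
      confIm f g p * pd j (confIm f g) p - reflRe f g p * pd j (reflRe f g) p -
      reflIm f g p * pd j (reflIm f g) p) := by
  have h1 := (hf.growth_confDet hg).smooth
  have h3 := (hf.rapid_reflRe hg).smooth
  have h4 := (hf.rapid_reflIm hg).smooth
  have e : layerDet f g = fun p => confDet f g p - reflRe f g p ^ 2 -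
    reflIm f g p ^ 2 := rfl
  have := pd_confDet hf hg j hp
  simp only [pd, e] at this ⊢
  rw [dirD_sub hU (h1.sub (h3.pow 2)) (h4.pow 2) _ hp]
  beta_reduce
  rw [dirD_sub hU h1 (h3.pow 2) _ hp]
  beta_reduce
  rw [this, dirD_sq hU h3 _ hp, dirD_sq hU h4 _ hp]
  ring

/-- The density as the exterior derivative of the primitive. -/
theorem rowDet_eq_div_primitive (hf : Rapid f) (hg : Rapid g) (hc : 0 < c)
    (hd : ∀ p ∈ coordDomain, c ≤ layerDet f g p) {p : E 3} (hp : p ∈ coordDomain) :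
    12 * rowDet (confRe f g p) (confIm f g p) (reflRe f g p) (reflIm f g p)
      (fun k => pd k (confRe f g) p) (fun k => pd k (confIm f g) p)
      (fun k => pd k (reflRe f g) p) (fun k => pd k (reflIm f g) p) / layerDet f g p ^ 2 =
    -6 * (pd 0 (primitive f g 1 2) p + pd 1 (primitive f g 2 0) p + pd 2 (primitive f g 0 1) p) := by
  have hΔ : layerDet f g p ≠ 0 := (hc.trans_le (hd p hp)).ne'
  have hN : confDet f g p ≠ 0 := (hc.trans_le ((hd p hp).trans (layerDet_le_confDet p))).ne'
  have hN0 : ∀ x ∈ coordDomain, confDet f g x ≠ 0 := fun x hx =>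
    (hc.trans_le ((hd x hx).trans (layerDet_le_confDet x))).ne'
  have hΔ0 : ∀ x ∈ coordDomain, layerDet f g x ≠ 0 := fun x hx => (hc.trans_le (hd x hx)).ne'
  have hσ : ∀ j k, pd j (reflAngle f g k) p - pd k (reflAngle f g j) p = _ := fun j k =>
    dirD_angular_sub hU coordDomain_subset_closure (hf.growth_layerDet hg).smooth hΔ0 (hf.rapid_reflRe hg).smooth
      (hf.rapid_reflIm hg).smooth (EuclideanSpace.single k 1) (EuclideanSpace.single j 1) hp
  -- The angular form of the conformal part is closed because its denominator is exactly the sum of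
  -- the two squares.
  have hφ : ∀ j k, pd j (confAngle f g k) p - pd k (confAngle f g j) p = 0 := by
    intro j k
    have h1 : pd j (confAngle f g k) p - pd k (confAngle f g j) p = _ :=
      dirD_angular_sub hU coordDomain_subset_closure (hf.growth_confDet hg).smooth hN0
        (hf.growth_confRe hg).smooth (hf.rapid_confIm hg).smooth (EuclideanSpace.single k 1)
        (EuclideanSpace.single j 1) hp
    rw [h1]
    have e1 := pd_confDet hf hg j hp
    have e2 := pd_confDet hf hg k hp
    simp only [pd] at e1 e2
    rw [e1, e2]
    have e3 : confDet f g p = confRe f g p ^ 2 + confIm f g p ^ 2 := rfl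
    generalize confDet f g p = M at hN e3 ⊢
    field_simp
    rw [e3]
    ring
  have hwedge := angular_wedge_eq_rowDet (confRe f g p) (confIm f g p) (reflRe f g p)
    (reflIm f g p) (fun k => pd k (confRe f g) p) (fun k => pd k (confIm f g) p)
    (fun k => pd k (reflRe f g) p) (fun k => pd k (reflIm f g) p) hN hΔ
    (fun k => confAngle f g k p) (fun j k => pd j (reflAngle f g k) p - pd k (reflAngle f g j) p)
    (fun k => rfl) (fun j k => by
      rw [hσ j k]
      have e1 := pd_layerDet hf hg j hp
      have e2 := pd_layerDet hf hg k hp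
      simp only [pd] at e1 e2 ⊢
      rw [e1, e2]
      rfl)
  have hprod : ∀ i j k, pd i (primitive f g j k) p =
      (confAngle f g j p * pd i (reflAngle f g k) p + pd i (confAngle f g j) p * reflAngle f g k p) -
      (confAngle f g k p * pd i (reflAngle f g j) p + pd i (confAngle f g k) p *
        reflAngle f g j p) := by
    intro i j k
    have hA := fun j => (hf.rapid_confAngle hg hc hd j).smooth
    have hB := fun j => (hf.rapid_reflAngle hg hc hd j).smooth
    have e : primitive f g j k = fun p => confAngle f g j p * reflAngle f g k p -
      confAngle f g k p * reflAngle f g j p := rfl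
    simp only [pd, e]
    rw [dirD_sub hU ((hA j).mul (hB k)) ((hA k).mul (hB j)) _ hp]
    beta_reduce
    rw [dirD_mul hU (hA j) (hB k) _ hp, dirD_mul hU (hA k) (hB j) _ hp]
  have hΔe : confRe f g p ^ 2 + confIm f g p ^ 2 - reflRe f g p ^ 2 - reflIm f g p ^ 2 =
      layerDet f g p := rfl
  rw [hΔe] at hwedge
  rw [hprod, hprod, hprod]
  have h12 : (12 : ℝ) = 6 * 2 := by norm_num
  rw [h12, mul_assoc, mul_div_assoc, ← hwedge]
  -- Since `dφ = 0`, the product rule leaves `d(φ ∧ σ) = -φ ∧ dσ`, whence the sign in front of the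
  -- 6.
  linear_combination 6 * reflAngle f g 2 p * hφ 0 1 + 6 * reflAngle f g 0 p * hφ 1 2 +
    6 * reflAngle f g 1 p * hφ 2 0

/-- The integral of the exterior derivative of the primitive only depends on the primitive near
`ρ = 1`, when the layers tend to the identity as `ρ → 0`. -/
theorem integral_div_primitive_eq {f' g' : E 3 → ℝ} {c' : ℝ} (hf : Rapid f) (hg : Rapid g)
    (hc : 0 < c) (hd : ∀ p ∈ coordDomain, c ≤ layerDet f g p) (hf' : Rapid f') (hg' : Rapid g')
    (hc' : 0 < c') (hd' : ∀ p ∈ coordDomain, c' ≤ layerDet f' g' p)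
    (h0 : ∀ y, Tendsto (fun t => primitive f g 1 2 (insertCoord 0 t y)) (𝓝[>] 0) (𝓝 0))
    (h0' : ∀ y, Tendsto (fun t => primitive f' g' 1 2 (insertCoord 0 t y)) (𝓝[>] 0) (𝓝 0))
    (h1 : ∀ y, ∀ᶠ t in 𝓝[<] 1, primitive f g 1 2 (insertCoord 0 t y) =
      primitive f' g' 1 2 (insertCoord 0 t y)) :
    ∫ p in coordDomain, (pd 0 (primitive f g 1 2) p + pd 1 (primitive f g 2 0) p +
      pd 2 (primitive f g 0 1) p) =
    ∫ p in coordDomain, (pd 0 (primitive f' g' 1 2) p + pd 1 (primitive f' g' 2 0) p +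
      pd 2 (primitive f' g' 0 1) p) := by
  -- The `z`-derivatives integrate to zero by decay; only the `ρ`-derivative of the `dx ∧ dy`
  -- coefficient survives.
  have hred : ∀ {f g : E 3 → ℝ} {c : ℝ}, Rapid f → Rapid g → 0 < c →
      (∀ p ∈ coordDomain, c ≤ layerDet f g p) →
      ∫ p in coordDomain, (pd 0 (primitive f g 1 2) p + pd 1 (primitive f g 2 0) p +
        pd 2 (primitive f g 0 1) p) = ∫ p in coordDomain, pd 0 (primitive f g 1 2) p := by
    intro f g c hf hg hc hd
    have hP := fun j k => hf.rapid_primitive hg hc hd j k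
    have i0 := ((hP 1 2).rapid_pd 0).integrableOn
    have i1 := ((hP 2 0).rapid_pd 1).integrableOn
    have i2 := ((hP 0 1).rapid_pd 2).integrableOn
    have z1 : ∫ p in coordDomain, pd 1 (primitive f g 2 0) p = 0 :=
      setIntegral_dirD_eq_zero_of_succ (hP 2 0 (-4)) 0
    have z2 : ∫ p in coordDomain, pd 2 (primitive f g 0 1) p = 0 :=
      setIntegral_dirD_eq_zero_of_succ (hP 0 1 (-4)) 1
    have e1 := integral_add (i0.add i1) i2
    have e2 := integral_add i0 i1
    simp only [Pi.add_apply] at e1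
    rw [e1, e2, z1, z2, add_zero, add_zero]
  rw [hred hf hg hc hd, hred hf' hg' hc' hd', ← sub_eq_zero]
  have hP := hf.rapid_primitive hg hc hd 1 2
  have hP' := hf'.rapid_primitive hg' hc' hd' 1 2
  rw [← integral_sub (hP.rapid_pd 0).integrableOn (hP'.rapid_pd 0).integrableOn]
  -- The two primitives are subtracted first: near `ρ = 1` neither need vanish, but their difference
  -- does.
  have := setIntegral_dirD_zero_eq_zero ((hP.sub hP') (-4))
    (fun y => by simpa using (h0 y).sub (h0' y)) (fun y => by
      refine tendsto_const_nhds.congr' ?_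
      filter_upwards [h1 y] with t ht
      rw [ht, sub_self])
  rw [← this]
  refine setIntegral_congr_fun isOpen_coordDomain.measurableSet fun p hp => ?_
  exact (dirD_sub hU hP.smooth hP'.smooth _ hp).symm

/-- The primitive is a local differential expression in `(f, g)`; openness of `V` lets derivatives
be compared there. -/
theorem primitive_congr {f' g' : E 3 → ℝ} {V : Set (E 3)} (hV : IsOpen V) (hVU : V ⊆ coordDomain)
    (hff : EqOn f f' V) (hgg : EqOn g g' V) (j k : Fin 3) :
    EqOn (primitive f g j k) (primitive f' g' j k) V := by
  have hpd : ∀ {f f' : E 3 → ℝ} (j : Fin 3), EqOn f f' V → EqOn (pd j f) (pd j f') V := by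
    intro f f' j h p hp
    have e := dirD_of_isOpen isOpen_coordDomain
    simp only [pd]
    rw [e f _ (hVU hp), e f' _ (hVU hp)]
    have : f =ᶠ[𝓝 p] f' := by filter_upwards [hV.mem_nhds hp] with q hq using h hq
    simp only [this.fderiv_eq]
  have h1 : EqOn (confRe f g) (confRe f' g') V := fun p hp => by
    simp only [confRe, hpd 1 hff hp, hpd 2 hgg hp]
  have h2 : EqOn (confIm f g) (confIm f' g') V := fun p hp => by
    simp only [confIm, hpd 2 hff hp, hpd 1 hgg hp]
  have h3 : EqOn (reflRe f g) (reflRe f' g') V := fun p hp => by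
    simp only [reflRe, hpd 1 hff hp, hpd 2 hgg hp]
  have h4 : EqOn (reflIm f g) (reflIm f' g') V := fun p hp => by
    simp only [reflIm, hpd 2 hff hp, hpd 1 hgg hp]
  have h5 : ∀ j, EqOn (confAngle f g j) (confAngle f' g' j) V := fun j p hp => by
    have e1 := hpd j h1 hp
    have e2 := hpd j h2 hp
    simp only [pd] at e1 e2
    simp only [confAngle, angular, confDet, e1, e2, h1 hp, h2 hp]
  have h6 : ∀ j, EqOn (reflAngle f g j) (reflAngle f' g' j) V := fun j p hp => by
    have e1 := hpd j h3 hp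
    have e2 := hpd j h4 hp
    simp only [pd] at e1 e2
    simp only [reflAngle, angular, layerDet, e1, e2, h1 hp, h2 hp, h3 hp, h4 hp]
  intro p hp
  simp only [primitive, h5 j hp, h5 k hp, h6 j hp, h6 k hp]

theorem pd_half_add (hf : Rapid f) (hg : Rapid g) (j : Fin 3) {p : E 3} (hp : p ∈ coordDomain) :
    pd j (fun p => 2⁻¹ * (f p + g p)) p = 2⁻¹ * (pd j f p + pd j g p) := by
  have h0 : dirD coordDomain (EuclideanSpace.single j 1) (fun _ : E 3 => (2⁻¹ : ℝ)) p = 0 := by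
    simp [dirD]
  simp only [pd]
  rw [dirD_mul hU contDiffOn_const (hf.smooth.add hg.smooth) _ hp]
  beta_reduce
  rw [h0, dirD_add hU hf.smooth hg.smooth _ hp, zero_mul, add_zero]

theorem pd_half_sub (hf : Rapid f) (hg : Rapid g) (j : Fin 3) {p : E 3} (hp : p ∈ coordDomain) :
    pd j (fun p => 2⁻¹ * (f p - g p)) p = 2⁻¹ * (pd j f p - pd j g p) := by
  have h0 : dirD coordDomain (EuclideanSpace.single j 1) (fun _ : E 3 => (2⁻¹ : ℝ)) p = 0 := by
    simp [dirD]
  simp only [pd]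
  rw [dirD_mul hU contDiffOn_const (hf.smooth.sub hg.smooth) _ hp]
  beta_reduce
  rw [h0, dirD_sub hU hf.smooth hg.smooth _ hp, zero_mul, add_zero]

theorem pd_confRe (hf : Rapid f) (hg : Rapid g) (j : Fin 3) {p : E 3} (hp : p ∈ coordDomain) :
    pd j (confRe f g) p = 2⁻¹ * (pd j (pd 1 f) p + pd j (pd 2 g) p) := by
  have h0 : dirD coordDomain (EuclideanSpace.single j 1) (fun _ : E 3 => (1 : ℝ)) p = 0 := by
    simp [dirD]
  have h1 := pd_half_add (hf.rapid_pd 1) (hg.rapid_pd 2) j hp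
  have e : confRe f g = fun p => 1 + 2⁻¹ * (pd 1 f p + pd 2 g p) := rfl
  have h2 := dirD_add hU (contDiffOn_const (c := (1 : ℝ))) (contDiffOn_const (c := (2⁻¹ : ℝ)).mul
    ((hf.rapid_pd 1).smooth.add (hg.rapid_pd 2).smooth)) (EuclideanSpace.single j 1) hp
  beta_reduce at h2
  rw [h0, zero_add] at h2
  rw [← h1, e]
  exact h2

theorem insertCoord_mem {t : ℝ} (ht : t ∈ Ioo (0 : ℝ) 1) (y : Fin 2 → ℝ) :
    insertCoord 0 t y ∈ coordDomain := by
  simpa [coordDomain, insertCoord_same] using ht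

theorem fderiv_eq_zero_of_slice {f : E 3 → ℝ} {p v : E 3} (hf : DifferentiableAt ℝ f p)
    (h0 : ∀ q : E 3, q 0 = 0 → f q = 0) (hp : p 0 = 0) (hv : v 0 = 0) : fderiv ℝ f p v = 0 := by
  have hl : HasDerivAt (fun h : ℝ => p + h • v) v 0 := by
    simpa using ((hasDerivAt_id (0 : ℝ)).smul_const v).const_add p
  have hd : HasFDerivAt f (fderiv ℝ f p) (p + (0 : ℝ) • v) := by simpa using hf.hasFDerivAt
  have h1 := hd.comp_hasDerivAt 0 hl
  have h2 : (f ∘ fun h : ℝ => p + h • v) = fun _ => 0 := by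
    funext h
    exact h0 _ (by simp [hp, hv])
  rw [h2] at h1
  exact h1.unique (hasDerivAt_const (0 : ℝ) (0 : ℝ))

/-- If the layers tend to the identity as `ρ → 0`, then the primitive tends to zero. -/
theorem tendsto_primitive (hfr : Rapid f) (hgr : Rapid g) {Ω : Set (E 3)} (hΩ : IsOpen Ω) (hΩ0 : {p : E 3 | p 0 = 0} ⊆ Ω)
    (hf : ContDiffOn ℝ ∞ f Ω) (hg : ContDiffOn ℝ ∞ g Ω) (hf0 : ∀ p : E 3, p 0 = 0 → f p = 0)
    (hg0 : ∀ p : E 3, p 0 = 0 → g p = 0) (y : Fin 2 → ℝ) :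
    Tendsto (fun t => primitive f g 1 2 (insertCoord 0 t y)) (𝓝[>] 0) (𝓝 0) := by
  have hcont : Continuous fun t => insertCoord 0 t y :=
    continuous_iff_continuousAt.2 fun t => (hasDerivAt_insertCoord 0 t y).continuousAt
  have hmemU : ∀ᶠ t in 𝓝[>] (0 : ℝ), insertCoord 0 t y ∈ coordDomain := by
    filter_upwards [Ioo_mem_nhdsGT one_pos] with t ht using insertCoord_mem ht y
  have hslice0 : insertCoord 0 0 y ∈ Ω := hΩ0 (insertCoord_same 0 0 y)
  have hdf : ∀ {f : E 3 → ℝ}, ContDiffOn ℝ ∞ f Ω → ∀ v, ContDiffOn ℝ ∞ (fun p => fderiv ℝ f p v) Ω :=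
    fun hf v => (hf.fderiv_of_isOpen hΩ (m := ∞) le_rfl).clm_apply contDiffOn_const
  have hlim : ∀ {f : E 3 → ℝ}, ContDiffOn ℝ ∞ f Ω → (∀ p : E 3, p 0 = 0 → f p = 0) →
      Tendsto (fun t => f (insertCoord 0 t y)) (𝓝[>] 0) (𝓝 0) := by
    intro f hf h0
    have h1 : ContinuousAt f (insertCoord 0 0 y) :=
      (hf.contDiffAt (hΩ.mem_nhds hslice0)).continuousAt
    have h2 : ContinuousAt (fun t => f (insertCoord 0 t y)) 0 :=
      ContinuousAt.comp (g := f) (f := fun t => insertCoord 0 t y) h1 hcont.continuousAt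
    have h3 := h2.tendsto.mono_left (nhdsWithin_le_nhds (s := Ioi 0))
    rwa [h0 _ (insertCoord_same 0 0 y)] at h3
  -- The `dx ∧ dy` coefficient only involves derivatives tangent to the slice `ρ = 0`, and these
  -- vanish with the function on that slice.
  have hz : ∀ {f : E 3 → ℝ}, ContDiffOn ℝ ∞ f Ω → (∀ p : E 3, p 0 = 0 → f p = 0) →
      ∀ k : Fin 2, ∀ p : E 3, p 0 = 0 → fderiv ℝ f p (EuclideanSpace.single k.succ 1) = 0 := by
    intro f hf h0 k p hp
    exact fderiv_eq_zero_of_slice ((hf.contDiffAt (hΩ.mem_nhds (hΩ0 hp))).differentiableAt (by simp))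
      h0 hp (by simp)
  have hpd : ∀ (f : E 3 → ℝ) (j : Fin 3), EqOn (pd j f)
      (fun p => fderiv ℝ f p (EuclideanSpace.single j 1)) coordDomain :=
    fun f j => dirD_of_isOpen isOpen_coordDomain f _
  have hlim1 : ∀ {f : E 3 → ℝ}, ContDiffOn ℝ ∞ f Ω → (∀ p : E 3, p 0 = 0 → f p = 0) →
      ∀ k : Fin 2, Tendsto (fun t => pd k.succ f (insertCoord 0 t y)) (𝓝[>] 0) (𝓝 0) := by
    intro f hf h0 k
    refine (hlim (hdf hf (EuclideanSpace.single k.succ 1)) (hz hf h0 k)).congr' ?_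
    filter_upwards [hmemU] with t ht using (hpd f k.succ ht).symm
  have hlim2 : ∀ {f : E 3 → ℝ}, ContDiffOn ℝ ∞ f Ω → (∀ p : E 3, p 0 = 0 → f p = 0) →
      ∀ j k : Fin 2, Tendsto (fun t => pd j.succ (pd k.succ f) (insertCoord 0 t y))
        (𝓝[>] 0) (𝓝 0) := by
    intro f hf h0 j k
    refine (hlim1 (hdf hf (EuclideanSpace.single k.succ 1)) (hz hf h0 k) j).congr' ?_
    filter_upwards [hmemU] with t ht using (dirD_congr (hpd f k.succ) _ ht).symm
  have c1 : Tendsto (fun t => confRe f g (insertCoord 0 t y)) (𝓝[>] 0) (𝓝 1) := by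
    have h := (((hlim1 hf hf0 0).add (hlim1 hg hg0 1)).const_mul 2⁻¹).const_add 1
    simp at h
    exact h
  have c2 : Tendsto (fun t => confIm f g (insertCoord 0 t y)) (𝓝[>] 0) (𝓝 0) := by
    have h := ((hlim1 hg hg0 0).sub (hlim1 hf hf0 1)).const_mul 2⁻¹
    simp at h
    exact h
  have c3 : Tendsto (fun t => reflRe f g (insertCoord 0 t y)) (𝓝[>] 0) (𝓝 0) := by
    have h := ((hlim1 hf hf0 0).sub (hlim1 hg hg0 1)).const_mul 2⁻¹
    simp at h
    exact h
  have c4 : Tendsto (fun t => reflIm f g (insertCoord 0 t y)) (𝓝[>] 0) (𝓝 0) := by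
    have h := ((hlim1 hf hf0 1).add (hlim1 hg hg0 0)).const_mul 2⁻¹
    simp at h
    exact h
  have d1 : ∀ j : Fin 2, Tendsto (fun t => pd j.succ (confRe f g) (insertCoord 0 t y))
      (𝓝[>] 0) (𝓝 0) := fun j => by
    have := ((hlim2 hf hf0 j 0).add (hlim2 hg hg0 j 1)).const_mul 2⁻¹
    rw [add_zero, mul_zero] at this
    refine this.congr' ?_
    filter_upwards [hmemU] with t ht using (pd_confRe hfr hgr j.succ ht).symm
  have d2 : ∀ j : Fin 2, Tendsto (fun t => pd j.succ (confIm f g) (insertCoord 0 t y))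
      (𝓝[>] 0) (𝓝 0) := fun j => by
    have := ((hlim2 hg hg0 j 0).sub (hlim2 hf hf0 j 1)).const_mul 2⁻¹
    rw [sub_zero, mul_zero] at this
    refine this.congr' ?_
    filter_upwards [hmemU] with t ht using
      (pd_half_sub (hgr.rapid_pd 1) (hfr.rapid_pd 2) j.succ ht).symm
  have d3 : ∀ j : Fin 2, Tendsto (fun t => pd j.succ (reflRe f g) (insertCoord 0 t y))
      (𝓝[>] 0) (𝓝 0) := fun j => by
    have := ((hlim2 hf hf0 j 0).sub (hlim2 hg hg0 j 1)).const_mul 2⁻¹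
    rw [sub_zero, mul_zero] at this
    refine this.congr' ?_
    filter_upwards [hmemU] with t ht using
      (pd_half_sub (hfr.rapid_pd 1) (hgr.rapid_pd 2) j.succ ht).symm
  have d4 : ∀ j : Fin 2, Tendsto (fun t => pd j.succ (reflIm f g) (insertCoord 0 t y))
      (𝓝[>] 0) (𝓝 0) := fun j => by
    have := ((hlim2 hf hf0 j 1).add (hlim2 hg hg0 j 0)).const_mul 2⁻¹
    rw [add_zero, mul_zero] at this
    refine this.congr' ?_
    filter_upwards [hmemU] with t ht using
      (pd_half_add (hfr.rapid_pd 2) (hgr.rapid_pd 1) j.succ ht).symm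
  have cN : Tendsto (fun t => (confDet f g (insertCoord 0 t y))⁻¹) (𝓝[>] 0) (𝓝 1) := by
    have h := ((c1.pow 2).add (c2.pow 2)).inv₀ (by norm_num)
    simp at h
    exact h
  have cΔ : Tendsto (fun t => (layerDet f g (insertCoord 0 t y))⁻¹) (𝓝[>] 0) (𝓝 1) := by
    have h := ((((c1.pow 2).add (c2.pow 2)).sub (c3.pow 2)).sub (c4.pow 2)).inv₀ (by norm_num)
    simp at h
    exact h
  have a1 : ∀ j : Fin 2, Tendsto (fun t => confAngle f g j.succ (insertCoord 0 t y))
      (𝓝[>] 0) (𝓝 0) := fun j => by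
    have h := ((c1.mul (d2 j)).sub (c2.mul (d1 j))).mul cN
    simp at h
    exact h
  have a2 : ∀ j : Fin 2, Tendsto (fun t => reflAngle f g j.succ (insertCoord 0 t y))
      (𝓝[>] 0) (𝓝 0) := fun j => by
    have h := ((c3.mul (d4 j)).sub (c4.mul (d3 j))).mul cΔ
    simp at h
    exact h
  have h := ((a1 0).mul (a2 1)).sub ((a1 1).mul (a2 0))
  simp at h
  exact h

end Primitive

end WessZumino

end

noncomputable section

namespace WessZumino

open Set Filter Topology MeasureTheory

/-! ### Layered maps in coordinates -/

/-- A positive function on the closed slab that tends to one at infinity is bounded below. -/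
theorem exists_pos_le {f : E 3 → ℝ} (hc : ContinuousOn f {p | p 0 ∈ Icc (0 : ℝ) 1})
    (hpos : ∀ p : E 3, p 0 ∈ Icc (0 : ℝ) 1 → 0 < f p)
    (hf : Growth coordDomain (-1) fun p => f p - 1) : ∃ c, 0 < c ∧ ∀ p ∈ coordDomain, c ≤ f p := by
  obtain ⟨C, hC⟩ := hf.bound 0
  -- Beyond the radius `2|C|` the growth bound gives `|f - 1| ≤ 1/2`; on the remaining compact piece
  -- of the closed slab the minimum is positive.
  set K : Set (E 3) := {p | p 0 ∈ Icc (0 : ℝ) 1} ∩ Metric.closedBall 0 (2 * |C|) with hK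
  have hKc : IsCompact K := by
    have h0 : Continuous fun p : E 3 => p 0 := by fun_prop
    exact (isCompact_closedBall (0 : E 3) (2 * |C|)).inter_left (isClosed_Icc.preimage h0)
  have hKne : K.Nonempty := ⟨0, by simp [hK]⟩
  obtain ⟨a, haK, ha⟩ := hKc.exists_isMinOn hKne (hc.mono inter_subset_left)
  refine ⟨min (f a) 2⁻¹, lt_min (hpos a haK.1) (by norm_num), fun p hp => ?_⟩
  by_cases hpK : ‖p‖ ≤ 2 * |C|
  · exact (min_le_left _ _).trans (ha ⟨⟨hp.1.le, hp.2.le⟩, mem_closedBall_zero_iff.2 hpK⟩)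
  · refine (min_le_right _ _).trans ?_
    have h1 := hC p hp
    have h2 : C * (1 + ‖p‖) ^ (-1 : ℤ) ≤ 2⁻¹ := by
      rw [zpow_neg_one, ← div_eq_mul_inv, div_le_iff₀ (by positivity)]
      nlinarith [le_abs_self C]
    have := (abs_le.1 (h1.trans h2)).1
    linarith

/-- The factor `(1 + |z|²) / 2`. -/
def conformalFactor (p : E 3) : ℝ := 2⁻¹ * (1 + (p 1 ^ 2 + p 2 ^ 2))

/-- The denominator of the stereographic projection of the rescaled map. -/
def denom (G : E 3 → E 3) (p : E 3) : ℝ := 1 + conformalFactor p * displacement G p 2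

/-- The displacement of the stereographic coordinate. -/
def shift (G : E 3 → E 3) (k : Fin 2) (p : E 3) : ℝ :=
  conformalFactor p * (displacement G p k.castSucc - p k.succ * displacement G p 2) * (denom G p)⁻¹

theorem growth_conformalFactor : Growth coordDomain 2 conformalFactor := by
  have hU := uniqueDiffOn_coordDomain
  have h1 := (Growth.coord hU 1).mul hU (Growth.coord hU 1)
  have h2 := (Growth.coord hU 2).mul hU (Growth.coord hU 2)
  have h0 := (Growth.const coordDomain 1).mono (m' := 2) (by norm_num)
  exact ((h0.add hU (Growth.add hU h1 h2)).const_mul hU 2⁻¹).congr fun p _ => by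
    simp [conformalFactor, pow_two]

theorem conformalFactor_pos (p : E 3) : 0 < conformalFactor p := by
  have := one_add_sq_pos p
  unfold conformalFactor; positivity

theorem contDiff_conformalFactor : ContDiff ℝ ∞ conformalFactor := by
  unfold conformalFactor; fun_prop

theorem invStereoCoord_apply_castSucc (p : E 3) (k : Fin 2) :
    conformalFactor p * invStereoCoord p k.castSucc = p k.succ := by
  have := (one_add_sq_pos p).ne'
  rw [invStereoCoord_eq]
  fin_cases k <;> simp [conformalFactor] <;> field_simp

theorem invStereoCoord_apply_two (p : E 3) :
    conformalFactor p * (1 + invStereoCoord p 2) = 1 := by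
  have := (one_add_sq_pos p).ne'
  rw [invStereoCoord_eq]
  simp [conformalFactor]
  field_simp
  ring

/-! ### Shift, denominator and Jacobian determinant of a layered map -/

section Coordinates

variable {G G' : E 3 → E 3}

/-- The definition shows that the denominator tends to 1 at infinity; this form shows that it
vanishes only where the image is the pole. -/
theorem denom_eq (p : E 3) :
    denom G p = conformalFactor p * (1 + rescaled G (p 0) (invStereoCoord p) 2) := by
  have := invStereoCoord_apply_two p
  simp only [denom, displacement, PiLp.sub_apply]
  linear_combination -this

theorem contDiff_displacement_apply (hG : ContDiff ℝ ∞ G) (i : Fin 3) :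
    ContDiff ℝ ∞ fun p => displacement G p i :=
  (EuclideanSpace.proj i : E 3 →L[ℝ] ℝ).contDiff.comp (contDiff_displacement hG)

theorem contDiff_denom (hG : ContDiff ℝ ∞ G) : ContDiff ℝ ∞ (denom G) :=
  contDiff_const.add (contDiff_conformalFactor.mul (contDiff_displacement_apply hG 2))

theorem isOpen_denom_pos (hG : ContDiff ℝ ∞ G) : IsOpen {p | 0 < denom G p} :=
  isOpen_Ioi.preimage (contDiff_denom hG).continuous

theorem contDiffOn_shift (hG : ContDiff ℝ ∞ G) (k : Fin 2) :
    ContDiffOn ℝ ∞ (shift G k) {p | 0 < denom G p} := by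
  refine ContDiffOn.mul (ContDiff.contDiffOn ?_)
    ((contDiff_denom hG).contDiffOn.inv fun p hp => (ne_of_gt hp))
  exact contDiff_conformalFactor.mul ((contDiff_displacement_apply hG _).sub
    ((by fun_prop : ContDiff ℝ ∞ fun p : E 3 => p k.succ).mul (contDiff_displacement_apply hG 2)))

theorem stereo_smul {ρ : ℝ} (hρ : 0 < ρ) (x : E 3) : stereo (ρ • x) = stereo x := by
  have h : ‖ρ • x‖ + (ρ • x) 2 = ρ * (‖x‖ + x 2) := by
    rw [norm_smul, Real.norm_of_nonneg hρ.le, PiLp.smul_apply, smul_eq_mul]; ring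
  ext i
  fin_cases i <;> simp only [stereo, h] <;> simp [mul_div_mul_left _ _ hρ.ne']

/-- For `ρ > 0`, a nonpositive denominator means that a unit vector goes to the pole. But the pole
is fixed and the map is injective, so that vector would be the pole, which has no stereographic
coordinate. At `ρ = 0` the displacement is zero. -/
theorem Layered.denom_pos (h : Layered G G') {p : E 3} (hp : p 0 ∈ Icc (0 : ℝ) 1) :
    0 < denom G p := by
  rcases hp.1.eq_or_lt with h0 | h0
  · simp [denom, h.displacement_zero h0.symm]
  rw [denom_eq]
  refine mul_pos (conformalFactor_pos p) ?_
  set x := rescaled G (p 0) (invStereoCoord p) with hx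
  have hnorm : ‖x‖ = 1 := by rw [hx, h.norm_rescaled h0.ne', norm_invStereoCoord]
  by_contra hneg
  have hsq : x 0 ^ 2 + x 1 ^ 2 + x 2 ^ 2 = 1 := by
    have := EuclideanSpace.norm_sq_eq x
    rw [hnorm] at this
    simp only [Real.norm_eq_abs, sq_abs, Fin.sum_univ_three] at this
    linarith
  have h2 : x 2 = -1 := by nlinarith [sq_nonneg (x 0), sq_nonneg (x 1)]
  have hinf : x = infinity := by
    have h3 : x 0 ^ 2 + x 1 ^ 2 = 0 := by rw [h2] at hsq; linarith
    have h4 : x 0 = 0 := by nlinarith [sq_nonneg (x 0), sq_nonneg (x 1)]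
    have h5 : x 1 = 0 := by nlinarith [sq_nonneg (x 0), sq_nonneg (x 1)]
    ext i; fin_cases i <;> simp [infinity, h2, h4, h5]
  -- The structure only controls radii in `(0,1)`; radius 1 is reached by continuity.
  have hfix : G (p 0 • infinity) = p 0 • infinity := by
    have hcl : IsClosed {t : ℝ | G (t • infinity) = t • infinity} := by
      have h1 : Continuous fun t : ℝ => t • infinity := by fun_prop
      exact isClosed_eq (h.smooth.continuous.comp h1) h1
    have hsub : Ioo (0 : ℝ) 1 ⊆ {t : ℝ | G (t • infinity) = t • infinity} :=
      fun t ht => (h.pole t ht).self_of_nhds norm_infinity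
    have := hcl.closure_subset_iff.2 hsub
    rw [closure_Ioo zero_ne_one] at this
    exact this hp
  have h6 : G (p 0 • invStereoCoord p) = p 0 • infinity := by
    rw [← hinf, hx, h.rescaled_eq h0.ne', smul_smul, mul_inv_cancel₀ h0.ne', one_smul]
  have h7 : p 0 • invStereoCoord p = p 0 • infinity := by
    rw [← h.left_inv (p 0 • invStereoCoord p), h6]
    nth_rw 1 [← hfix]
    exact h.left_inv _
  have h8 : invStereoCoord p = infinity := by
    simpa using smul_right_injective (E 3) h0.ne' h7
  have h9 := invStereoCoord_apply_two p
  rw [h8] at h9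
  simp [infinity] at h9

/-- The map in coordinates. -/
def coordMap (G : E 3 → E 3) (p : E 3) : E 3 := !₂[p 0, p 1 + shift G 0 p, p 2 + shift G 1 p]

theorem fromCoords_eq (p : E 3) : fromCoords p = p 0 • invStereoCoord p := rfl

theorem Layered.toCoords_map (h : Layered G G') {p : E 3} (hp : 0 < p 0) (hd : 0 < denom G p) :
    toCoords (G (fromCoords p)) = coordMap G p := by
  have e1 : G (fromCoords p) = p 0 • rescaled G (p 0) (invStereoCoord p) := by
    rw [fromCoords_eq, h.rescaled_eq hp.ne', smul_smul, mul_inv_cancel₀ hp.ne', one_smul]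
  have hn : ‖rescaled G (p 0) (invStereoCoord p)‖ = 1 := by
    rw [h.norm_rescaled hp.ne', norm_invStereoCoord]
  have hcoord : ∀ k : Fin 2, rescaled G (p 0) (invStereoCoord p) k.castSucc /
      (1 + rescaled G (p 0) (invStereoCoord p) 2) = p k.succ + shift G k p := by
    intro k
    have hs := (conformalFactor_pos p).ne'
    have hd' := denom_eq (G := G) p
    have h1 := invStereoCoord_apply_castSucc p k
    have h2 := invStereoCoord_apply_two p
    have h3 : 1 + rescaled G (p 0) (invStereoCoord p) 2 ≠ 0 := by
      intro h0; rw [hd', h0, mul_zero] at hd; exact hd.ne' rfl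
    rw [shift, hd', ← div_eq_mul_inv, mul_div_mul_left _ _ hs]
    simp only [displacement, PiLp.sub_apply]
    rw [eq_comm, ← h1]
    field_simp
    linear_combination invStereoCoord p k.castSucc * h2
  rw [e1, toCoords, stereo_smul hp, norm_smul, hn, Real.norm_of_nonneg hp.le, mul_one]
  have c0 := hcoord 0
  have c1 := hcoord 1
  ext i
  fin_cases i
  · rfl
  · simpa [stereo, hn, coordMap] using c0
  · simpa [stereo, hn, coordMap] using c1

theorem toCoords_fromCoords {p : E 3} (hp : 0 < p 0) : toCoords (fromCoords p) = p := by
  have hl : Layered (fun x : E 3 => x) (fun x => x) :=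
    ⟨contDiff_id, fun _ => rfl, fun _ => rfl, fun _ _ => Eventually.of_forall fun _ _ => rfl⟩
  have hz : displacement (fun x : E 3 => x) p = 0 := by
    rw [displacement, hl.rescaled_eq hp.ne', smul_smul, inv_mul_cancel₀ hp.ne', one_smul, sub_self]
  have := hl.toCoords_map hp (by simp [denom, hz])
  rw [this]
  ext i; fin_cases i <;> simp [coordMap, shift, hz]

theorem fromCoords_toCoords {x : E 3} (hx : 0 < ‖x‖ + x 2) : fromCoords (toCoords x) = x := by
  have hx0 : ‖x‖ ≠ 0 := fun h => by
    rw [norm_eq_zero] at h; simp [h] at hx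
  have hsq : x 0 ^ 2 + x 1 ^ 2 + x 2 ^ 2 = ‖x‖ ^ 2 := by
    have := EuclideanSpace.norm_sq_eq x
    simp only [Real.norm_eq_abs, sq_abs, Fin.sum_univ_three] at this
    linarith
  have hr : (x 0 / (‖x‖ + x 2)) ^ 2 + (x 1 / (‖x‖ + x 2)) ^ 2 = (‖x‖ - x 2) / (‖x‖ + x 2) := by
    field_simp; linarith
  have hinv : (1 + (‖x‖ - x 2) / (‖x‖ + x 2))⁻¹ = (‖x‖ + x 2) / (2 * ‖x‖) := by
    rw [inv_eq_iff_eq_inv, inv_div]; field_simp; ring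
  rw [fromCoords_eq, invStereoCoord_eq]
  ext i
  fin_cases i <;> simp [toCoords, stereo, hr, hinv] <;> field_simp <;> ring

theorem Layered.coordMap_coordMap (h : Layered G G') (h' : Layered G' G) {p : E 3}
    (hp : 0 < p 0) (hd : 0 < denom G p) (hd' : 0 < denom G' (coordMap G p)) :
    coordMap G' (coordMap G p) = p := by
  have hpos : 0 < ‖G (fromCoords p)‖ + G (fromCoords p) 2 := by
    have e1 : G (fromCoords p) = p 0 • rescaled G (p 0) (invStereoCoord p) := by
      rw [fromCoords_eq, h.rescaled_eq hp.ne', smul_smul, mul_inv_cancel₀ hp.ne', one_smul]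
    rw [denom_eq] at hd
    have h1 := (mul_pos_iff_of_pos_left (conformalFactor_pos p)).1 hd
    rw [e1, norm_smul, h.norm_rescaled hp.ne', norm_invStereoCoord, Real.norm_of_nonneg hp.le,
      PiLp.smul_apply, smul_eq_mul]
    nlinarith
  have e2 : fromCoords (coordMap G p) = G (fromCoords p) := by
    rw [← h.toCoords_map hp hd, fromCoords_toCoords hpos]
  rw [← h'.toCoords_map (by simpa [coordMap] using hp) hd', e2, h.left_inv,
    toCoords_fromCoords hp]

theorem contDiffOn_coordMap (hG : ContDiff ℝ ∞ G) :
    ContDiffOn ℝ ∞ (coordMap G) {p | 0 < denom G p} := by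
  rw [contDiffOn_euclidean]
  have h0 := contDiffOn_shift hG 0
  have h1 := contDiffOn_shift hG 1
  intro i
  fin_cases i <;> simp [coordMap] <;> fun_prop

theorem Layered.rapid_denom_sub_one (h : Layered G G') : Rapid fun p => denom G p - 1 :=
  (Rapid.mul_left growth_conformalFactor fun m => h.growth_displacement 2 m).congr
    fun p _ => by simp [denom]

/-- The factors `(1 + |z|²) / 2` and `z` grow polynomially, so they do not spoil rapid decay; the
denominator is bounded below by positivity on the closed slab and its limit 1. -/
theorem Layered.rapid_shift (h : Layered G G') (k : Fin 2) : Rapid (shift G k) := by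
  have hU := uniqueDiffOn_coordDomain
  obtain ⟨c, hc, hcd⟩ := exists_pos_le (contDiff_denom h.smooth).continuous.continuousOn
    (fun p hp => h.denom_pos hp) (h.rapid_denom_sub_one (-1))
  have hd : Growth coordDomain 0 (denom G) :=
    ((Growth.const coordDomain 1).add hU (h.rapid_denom_sub_one 0)).congr fun p _ => by simp
  have h1 : Rapid fun p => displacement G p k.castSucc - p k.succ * displacement G p 2 :=
    Rapid.sub (fun m => h.growth_displacement _ m)
      (Rapid.mul_left (Growth.coord hU k.succ) fun m => h.growth_displacement 2 m)
  exact (Rapid.mul_left growth_conformalFactor h1).mul_right (hd.inv hU hc hcd)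

theorem Layered.shift_zero (h : Layered G G') (k : Fin 2) {p : E 3} (hp : p 0 = 0) :
    shift G k p = 0 := by
  simp [shift, h.displacement_zero hp]

/-- The partial derivatives of the shift, on the whole closed slab. -/
def shiftDeriv (G : E 3 → E 3) (k j : Fin 2) (p : E 3) : ℝ :=
  fderiv ℝ (shift G k) p (EuclideanSpace.single j.succ 1)

/-- The Jacobian determinant of the layers, on the whole closed slab. -/
def shiftDet (G : E 3 → E 3) (p : E 3) : ℝ :=
  (1 + shiftDeriv G 0 0 p) * (1 + shiftDeriv G 1 1 p) - shiftDeriv G 0 1 p * shiftDeriv G 1 0 p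

theorem shiftDeriv_eq_pd (k j : Fin 2) :
    EqOn (shiftDeriv G k j) (pd j.succ (shift G k)) coordDomain :=
  (dirD_of_isOpen isOpen_coordDomain _ _).symm

/-- Links the determinant on the open domain with one that is continuous up to `ρ = 0` and `ρ = 1`,
where compactness and the intermediate value theorem can be applied. -/
theorem layerDet_eq_shiftDet :
    EqOn (layerDet (shift G 0) (shift G 1)) (shiftDet G) coordDomain := by
  intro p hp
  have e := fun k j => shiftDeriv_eq_pd (G := G) k j hp
  simp only [shiftDet, e, layerDet, confRe, confIm, reflRe, reflIm]
  simp only [Fin.succ_zero_eq_one, Fin.succ_one_eq_two]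
  ring

theorem continuousOn_shiftDet (hG : ContDiff ℝ ∞ G) :
    ContinuousOn (shiftDet G) {p | 0 < denom G p} := by
  have h : ∀ k j, ContinuousOn (shiftDeriv G k j) {p | 0 < denom G p} := fun k j =>
    ((contDiffOn_shift hG k).continuousOn_fderiv_of_isOpen (isOpen_denom_pos hG)
      (by simp)).clm_apply continuousOn_const
  exact ((continuousOn_const.add (h 0 0)).mul (continuousOn_const.add (h 1 1))).sub
    ((h 0 1).mul (h 1 0))

theorem fderiv_coordMap_apply (hG : ContDiff ℝ ∞ G) {p : E 3} (hd : 0 < denom G p) (v : E 3) :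
    fderiv ℝ (coordMap G) p v =
      v + !₂[0, fderiv ℝ (shift G 0) p v, fderiv ℝ (shift G 1) p v] := by
  have hO := (isOpen_denom_pos hG).mem_nhds hd
  have hs : ∀ k, HasFDerivAt (shift G k) (fderiv ℝ (shift G k) p) p := fun k =>
    (((contDiffOn_shift hG k).contDiffAt hO).differentiableAt (by simp)).hasFDerivAt
  have hm : HasFDerivAt (coordMap G) (fderiv ℝ (coordMap G) p) p :=
    (((contDiffOn_coordMap hG).contDiffAt hO).differentiableAt (by simp)).hasFDerivAt
  have hc : ∀ i : Fin 3, HasFDerivAt (fun q : E 3 => q i) (EuclideanSpace.proj i : E 3 →L[ℝ] ℝ) p :=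
    fun i => (EuclideanSpace.proj i : E 3 →L[ℝ] ℝ).hasFDerivAt
  have hi : ∀ i : Fin 3, HasFDerivAt (fun q => coordMap G q i)
      ((EuclideanSpace.proj i : E 3 →L[ℝ] ℝ).comp (fderiv ℝ (coordMap G) p)) p := fun i =>
    (EuclideanSpace.proj i : E 3 →L[ℝ] ℝ).hasFDerivAt.comp p hm
  have e0 := congrArg (fun L => L v) ((hi 0).unique (hc 0))
  have e1 := congrArg (fun L => L v)
    ((hi 1).unique ((hc 1).add (hs 0)))
  have e2 := congrArg (fun L => L v)
    ((hi 2).unique ((hc 2).add (hs 1)))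
  ext i
  fin_cases i
  · simpa using e0
  · simpa using e1
  · simpa using e2

/-- For `ρ > 0` the coordinate map has a differentiable local left inverse, so its derivative is
injective. -/
theorem Layered.shiftDet_ne_zero (h : Layered G G') (h' : Layered G' G) {p : E 3}
    (hp : p 0 ∈ Ioc (0 : ℝ) 1) : shiftDet G p ≠ 0 := by
  have hd : 0 < denom G p := h.denom_pos ⟨hp.1.le, hp.2⟩
  have hd' : 0 < denom G' (coordMap G p) := h'.denom_pos (by simpa [coordMap] using ⟨hp.1.le, hp.2⟩)
  have hO := (isOpen_denom_pos h.smooth).mem_nhds hd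
  have hmc := (contDiffOn_coordMap h.smooth).contDiffAt hO
  have hm : HasFDerivAt (coordMap G) (fderiv ℝ (coordMap G) p) p :=
    (hmc.differentiableAt (by simp)).hasFDerivAt
  have hm' : HasFDerivAt (coordMap G') (fderiv ℝ (coordMap G') (coordMap G p)) (coordMap G p) :=
    (((contDiffOn_coordMap h'.smooth).contDiffAt
      ((isOpen_denom_pos h'.smooth).mem_nhds hd')).differentiableAt (by simp)).hasFDerivAt
  have hev : coordMap G' ∘ coordMap G =ᶠ[𝓝 p] id := by
    have h0 : Continuous fun q : E 3 => q 0 := by fun_prop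
    filter_upwards [hO, (isOpen_Ioi.preimage h0).mem_nhds hp.1,
      hmc.continuousAt.preimage_mem_nhds ((isOpen_denom_pos h'.smooth).mem_nhds hd')]
      with q hq hq0 hq'
    exact h.coordMap_coordMap h' hq0 hq hq'
  have hid := ((hm'.comp p hm).congr_of_eventuallyEq hev.symm).unique (hasFDerivAt_id p)
  have hinj : ∀ v, fderiv ℝ (coordMap G) p v = 0 → v = 0 := by
    intro v hv
    have := congrArg (fun L => L v) hid
    simpa [hv] using this.symm
  intro hdet
  have hlin : ∀ s t : ℝ, fderiv ℝ (coordMap G) p !₂[0, s, t] =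
      !₂[0, (1 + shiftDeriv G 0 0 p) * s + shiftDeriv G 0 1 p * t,
        shiftDeriv G 1 0 p * s + (1 + shiftDeriv G 1 1 p) * t] := by
    intro s t
    have e : (!₂[0, s, t] : E 3) = s • EuclideanSpace.single (Fin.succ 0) 1 +
        t • EuclideanSpace.single (Fin.succ 1) 1 := by
      ext i; fin_cases i <;> simp
    rw [e, map_add, map_smul, map_smul, fderiv_coordMap_apply h.smooth hd,
      fderiv_coordMap_apply h.smooth hd]
    ext i; fin_cases i <;> simp [shiftDeriv] <;> ring
  -- With zero determinant the columns of the adjugate lie in the kernel, hence are zero. So the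
  -- whole 2×2 block is zero and a basis vector is killed as well, a contradiction.
  have k1 := hinj !₂[0, 1 + shiftDeriv G 1 1 p, -shiftDeriv G 1 0 p] (by
    rw [hlin]
    ext i; fin_cases i
    · simp
    · simpa [shiftDet, sub_eq_add_neg] using hdet
    · simp; ring)
  have k2 := hinj !₂[0, -shiftDeriv G 0 1 p, 1 + shiftDeriv G 0 0 p] (by
    rw [hlin]
    ext i; fin_cases i
    · simp
    · simp; ring
    · have : shiftDeriv G 1 0 p * -shiftDeriv G 0 1 p + (1 + shiftDeriv G 1 1 p) *
        (1 + shiftDeriv G 0 0 p) = 0 := by rw [← hdet, shiftDet]; ring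
      simpa using this)
  have a11 : 1 + shiftDeriv G 1 1 p = 0 := by simpa using congrArg (fun v : E 3 => v 1) k1
  have a10 : shiftDeriv G 1 0 p = 0 := by simpa using congrArg (fun v : E 3 => v 2) k1
  have a01 : shiftDeriv G 0 1 p = 0 := by simpa using congrArg (fun v : E 3 => v 1) k2
  have a00 : 1 + shiftDeriv G 0 0 p = 0 := by simpa using congrArg (fun v : E 3 => v 2) k2
  have k3 := hinj !₂[0, 1, 0] (by
    rw [hlin, a00, a10, a01, a11]
    ext i; fin_cases i <;> simp)
  simpa using congrArg (fun v : E 3 => v 1) k3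

/-- Move along `ρ` from `ρ = 0`, where the layer is the identity and the determinant is 1: it never
vanishes on the way. -/
theorem Layered.shiftDet_pos (h : Layered G G') (h' : Layered G' G) {p : E 3}
    (hp : p 0 ∈ Icc (0 : ℝ) 1) : 0 < shiftDet G p := by
  set l : ℝ → E 3 := fun t => insertCoord 0 t ![p 1, p 2] with hl
  have hlc : Continuous l :=
    continuous_iff_continuousAt.2 fun t => (hasDerivAt_insertCoord 0 t _).continuousAt
  have hl0 : ∀ t, l t 0 = t := fun t => insertCoord_same 0 t _
  have hlp : l (p 0) = p := by
    ext i; fin_cases i <;> simp [hl, insertCoord]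
  have hcont : ContinuousOn (fun t => shiftDet G (l t)) (Icc 0 1) :=
    (continuousOn_shiftDet h.smooth).comp hlc.continuousOn
      fun t ht => h.denom_pos (by rwa [hl0])
  have h1 : shiftDet G (l 0) = 1 := by
    have hz : ∀ k j, shiftDeriv G k j (l 0) = 0 := by
      intro k j
      refine fderiv_eq_zero_of_slice ?_ (fun q hq => h.shift_zero k hq) (hl0 0) (by simp)
      exact ((contDiffOn_shift h.smooth k).contDiffAt ((isOpen_denom_pos h.smooth).mem_nhds
        (h.denom_pos (by simp [hl0])))).differentiableAt (by simp)
    simp [shiftDet, hz]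
  by_contra hneg
  rw [not_lt, ← hlp] at hneg
  obtain ⟨t, ht, ht0⟩ := intermediate_value_Icc' hp.1
    (hcont.mono (Icc_subset_Icc_right hp.2)) ⟨hneg, h1 ▸ zero_le_one⟩
  have ht0' : shiftDet G (l t) = 0 := ht0
  rcases ht.1.eq_or_lt with rfl | hpos
  · rw [h1] at ht0'; exact one_ne_zero ht0'
  · exact h.shiftDet_ne_zero h' (p := l t) ⟨by rwa [hl0], by rw [hl0]; exact ht.2.trans hp.2⟩ ht0'

theorem Layered.exists_le_layerDet (h : Layered G G') (h' : Layered G' G) :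
    ∃ c, 0 < c ∧ ∀ p ∈ coordDomain, c ≤ layerDet (shift G 0) (shift G 1) p := by
  obtain ⟨c, hc, hb⟩ := exists_pos_le
    ((continuousOn_shiftDet h.smooth).mono fun p hp => h.denom_pos hp)
    (fun p hp => h.shiftDet_pos h' hp)
    ((((h.rapid_shift 0).layerDet_sub_one (h.rapid_shift 1)) (-1)).congr fun p hp => by
      simp only [layerDet_eq_shiftDet hp])
  exact ⟨c, hc, fun p hp => by rw [layerDet_eq_shiftDet hp]; exact hb p hp⟩

end Coordinates

end WessZumino

end

noncomputable section

namespace WessZumino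

open Set Filter Topology MeasureTheory

/-! ### The Wess-Zumino term of a layered map -/

/-! ### The density of a layered map and its integral -/

section Density

variable {G G' : E 3 → E 3} {g : Equiv.Perm (Ball 3)}

theorem fromCoords_mem_ball {p : E 3} (hp : p ∈ coordDomain) : fromCoords p ∈ Ball 3 :=
  smul_unit_mem_ball hp.1.le hp.2.le (norm_invStereoCoord p)

theorem Layered.inCoords_eq (h : Layered G G') (hg : ∀ x ∈ Ball 3, G x = ext g x) :
    EqOn (inCoords g) (coordMap G) coordDomain := by
  intro p hp
  rw [inCoords, ← hg _ (fromCoords_mem_ball hp), h.toCoords_map hp.1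
    (h.denom_pos ⟨hp.1.le, hp.2.le⟩)]

/-- The Jacobian matrix of the map with shift `(f, g)`. -/
def jacobianModel (f g : E 3 → ℝ) (p : E 3) : Matrix (Fin 3) (Fin 3) ℝ :=
  !![1, 0, 0;
    pd 0 f p, confRe f g p + reflRe f g p, reflIm f g p - confIm f g p;
    pd 0 g p, reflIm f g p + confIm f g p, confRe f g p - reflRe f g p]

theorem Layered.jacobian_eq (h : Layered G G') (hg : ∀ x ∈ Ball 3, G x = ext g x) :
    EqOn (jacobian (inCoords g)) (jacobianModel (shift G 0) (shift G 1)) coordDomain := by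
  intro p hp
  have hev : inCoords g =ᶠ[𝓝 p] coordMap G := by
    filter_upwards [isOpen_coordDomain.mem_nhds hp] with q hq using h.inCoords_eq hg hq
  have hpd : ∀ k j, fderiv ℝ (shift G k) p (EuclideanSpace.single j 1) = pd j (shift G k) p :=
    fun k j => (dirD_of_isOpen isOpen_coordDomain _ _ hp).symm
  ext i j
  simp only [jacobian, Matrix.of_apply, hev.fderiv_eq]
  rw [fderiv_coordMap_apply h.smooth (h.denom_pos ⟨hp.1.le, hp.2.le⟩), hpd, hpd]
  fin_cases i <;> fin_cases j <;>
    simp [jacobianModel, confRe, confIm, reflRe, reflIm] <;> ring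

theorem Layered.theta_eq (h : Layered G G') (hg : ∀ x ∈ Ball 3, G x = ext g x) {p : E 3}
    (hp : p ∈ coordDomain) (k : Fin 3) :
    theta (inCoords g) p (EuclideanSpace.single k 1) =
      (jacobianModel (shift G 0) (shift G 1) p)⁻¹ * !![0, 0, 0;
        pd k (pd 0 (shift G 0)) p,
          pd k (confRe (shift G 0) (shift G 1)) p + pd k (reflRe (shift G 0) (shift G 1)) p,
          pd k (reflIm (shift G 0) (shift G 1)) p - pd k (confIm (shift G 0) (shift G 1)) p;
        pd k (pd 0 (shift G 1)) p,
          pd k (reflIm (shift G 0) (shift G 1)) p + pd k (confIm (shift G 0) (shift G 1)) p,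
          pd k (confRe (shift G 0) (shift G 1)) p - pd k (reflRe (shift G 0) (shift G 1)) p] := by
  have hU := uniqueDiffOn_coordDomain
  have hf := h.rapid_shift 0
  have hg' := h.rapid_shift 1
  have c1 := (hf.growth_confRe hg').smooth
  have c2 := (hf.rapid_confIm hg').smooth
  have c3 := (hf.rapid_reflRe hg').smooth
  have c4 := (hf.rapid_reflIm hg').smooth
  rw [theta, h.jacobian_eq hg hp]
  congr 1
  ext i j
  rw [Matrix.of_apply]
  have hev : (fun q => jacobian (inCoords g) q i j) =ᶠ[𝓝 p]
      fun q => jacobianModel (shift G 0) (shift G 1) q i j := by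
    filter_upwards [isOpen_coordDomain.mem_nhds hp] with q hq
    rw [h.jacobian_eq hg hq]
  rw [hev.fderiv_eq]
  have e : fderiv ℝ (fun q => jacobianModel (shift G 0) (shift G 1) q i j) p
      (EuclideanSpace.single k 1) =
      pd k (fun q => jacobianModel (shift G 0) (shift G 1) q i j) p :=
    (dirD_of_isOpen isOpen_coordDomain _ _ hp).symm
  rw [e]
  have hconst : ∀ c : ℝ, pd k (fun _ => c) p = 0 := fun c => by simp [pd, dirD]
  fin_cases i <;> fin_cases j
  · exact hconst 1
  · exact hconst 0
  · exact hconst 0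
  · rfl
  · exact dirD_add hU c1 c3 _ hp
  · exact dirD_sub hU c4 c2 _ hp
  · rfl
  · exact dirD_add hU c4 c2 _ hp
  · exact dirD_sub hU c1 c3 _ hp

/-- The exterior derivative of the primitive. -/
def divPrimitive (f g : E 3 → ℝ) (p : E 3) : ℝ :=
  pd 0 (primitive f g 1 2) p + pd 1 (primitive f g 2 0) p + pd 2 (primitive f g 0 1) p

theorem Layered.density_eq (h : Layered G G') (h' : Layered G' G)
    (hg : ∀ x ∈ Ball 3, G x = ext g x) :
    EqOn (density g) (fun p => -6 * divPrimitive (shift G 0) (shift G 1) p) coordDomain := by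
  intro p hp
  obtain ⟨c, hc, hd⟩ := h.exists_le_layerDet h'
  have hΔ : layerDet (shift G 0) (shift G 1) p ≠ 0 := (hc.trans_le (hd p hp)).ne'
  have e1 : density g p = (wedgeCube (fun k : Fin 3 =>
      theta (inCoords g) p (EuclideanSpace.single k 1)) id).trace := rfl
  simp only [divPrimitive]
  rw [e1, ← rowDet_eq_div_primitive (h.rapid_shift 0) (h.rapid_shift 1) hc hd hp]
  simp_rw [h.theta_eq hg hp]
  exact trace_wedgeCube_eq_rowDet _ _ _ _ _ _ _ _ _ _ _ _ hΔ

theorem Layered.rapid_divPrimitive (h : Layered G G') (h' : Layered G' G) :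
    Rapid (divPrimitive (shift G 0) (shift G 1)) := by
  obtain ⟨c, hc, hd⟩ := h.exists_le_layerDet h'
  have hP := fun j k => (h.rapid_shift 0).rapid_primitive (h.rapid_shift 1) hc hd j k
  exact (((hP 1 2).rapid_pd 0).add ((hP 2 0).rapid_pd 1)).add ((hP 0 1).rapid_pd 2)

theorem Layered.integrableOn_density (h : Layered G G') (h' : Layered G' G)
    (hg : ∀ x ∈ Ball 3, G x = ext g x) : IntegrableOn (density g) coordDomain :=
  ((h.rapid_divPrimitive h').const_mul (-6)).integrableOn.congr_fun
    (h.density_eq h' hg).symm isOpen_coordDomain.measurableSet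

/-- Agreement on a collar makes the shifts, and with them the primitives, agree near `ρ = 1`. The
other boundary terms vanish for each map separately. -/
theorem Layered.W_eq {G₁ G₁' G₂ G₂' : E 3 → E 3} {g₁ g₂ : Equiv.Perm (Ball 3)}
    (h₁ : Layered G₁ G₁') (h₁' : Layered G₁' G₁) (hg₁ : ∀ x ∈ Ball 3, G₁ x = ext g₁ x)
    (h₂ : Layered G₂ G₂') (h₂' : Layered G₂' G₂) (hg₂ : ∀ x ∈ Ball 3, G₂ x = ext g₂ x)
    {ε : ℝ} (hε : 0 < ε)
    (heq : ∀ ρ ∈ Ioc (1 - ε) 1, ∀ u, ‖u‖ = 1 → ext g₁ (ρ • u) = ext g₂ (ρ • u)) :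
    W g₁ = W g₂ := by
  obtain ⟨c₁, hc₁, hd₁⟩ := h₁.exists_le_layerDet h₁'
  obtain ⟨c₂, hc₂, hd₂⟩ := h₂.exists_le_layerDet h₂'
  have hm := isOpen_coordDomain.measurableSet
  rw [W, W, setIntegral_congr_fun hm (h₁.density_eq h₁' hg₁),
    setIntegral_congr_fun hm (h₂.density_eq h₂' hg₂), integral_const_mul, integral_const_mul]
  congr 1
  have hlim : ∀ {G G' : E 3 → E 3}, Layered G G' → ∀ y : Fin 2 → ℝ,
      Tendsto (fun t => primitive (shift G 0) (shift G 1) 1 2 (insertCoord 0 t y)) (𝓝[>] 0)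
        (𝓝 0) := fun h y =>
    tendsto_primitive (h.rapid_shift 0) (h.rapid_shift 1) (isOpen_denom_pos h.smooth)
      (fun p (hp : p 0 = 0) => h.denom_pos (by simp [hp])) (contDiffOn_shift h.smooth 0)
      (contDiffOn_shift h.smooth 1) (fun p hp => h.shift_zero 0 hp)
      (fun p hp => h.shift_zero 1 hp) y
  set V : Set (E 3) := {p | p 0 ∈ Ioo (1 - ε) 1} ∩ coordDomain with hV
  have h0 : Continuous fun p : E 3 => p 0 := by fun_prop
  have hVo : IsOpen V := (isOpen_Ioo.preimage h0).inter isOpen_coordDomain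
  have hmap : EqOn (coordMap G₁) (coordMap G₂) V := by
    rintro p ⟨hp, hpU⟩
    rw [← h₁.inCoords_eq hg₁ hpU, ← h₂.inCoords_eq hg₂ hpU, inCoords, inCoords, fromCoords_eq,
      heq (p 0) ⟨hp.1, hp.2.le⟩ _ (norm_invStereoCoord p)]
  have hs0 : EqOn (shift G₁ 0) (shift G₂ 0) V := fun p hp => by
    simpa [coordMap] using congrArg (fun q : E 3 => q 1) (hmap hp)
  have hs1 : EqOn (shift G₁ 1) (shift G₂ 1) V := fun p hp => by
    simpa [coordMap] using congrArg (fun q : E 3 => q 2) (hmap hp)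
  refine integral_div_primitive_eq (h₁.rapid_shift 0) (h₁.rapid_shift 1) hc₁ hd₁
    (h₂.rapid_shift 0) (h₂.rapid_shift 1) hc₂ hd₂ (hlim h₁) (hlim h₂) fun y => ?_
  have hmem : Ioo (max (1 - ε) 0) 1 ∈ 𝓝[<] (1 : ℝ) :=
    Ioo_mem_nhdsLT (max_lt (by linarith) one_pos)
  filter_upwards [hmem] with t ht
  refine primitive_congr hVo inter_subset_right hs0 hs1 1 2 ⟨?_, insertCoord_mem
    ⟨(le_max_right _ _).trans_lt ht.1, ht.2⟩ y⟩
  rw [mem_ofPred_eq, insertCoord_same]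
  exact ⟨(le_max_left _ _).trans_lt ht.1, ht.2⟩

end Density

/-! ### Convergence and dependence on the boundary value alone -/

theorem mem_of_mem_idComponent {n : ℕ} {𝒢 : Set (Equiv.Perm (Ball n))} {g : Equiv.Perm (Ball n)}
    (hg : g ∈ idComponent 𝒢) : g ∈ 𝒢 := by
  obtain ⟨H, h1, -, h2, -⟩ := hg
  exact h2 ▸ h1 1 ⟨zero_le_one, le_rfl⟩

/-- The integral that defines the Wess-Zumino term converges. -/
theorem integrableOn_density {g : Equiv.Perm (Ball 3)} (hg : g ∈ BallDiffStarZero) :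
    IntegrableOn (density g) coordDomain := by
  obtain ⟨G, G', h, h', hG⟩ := exists_layered (mem_of_mem_idComponent hg)
  exact h.integrableOn_density h' hG

/-- The Wess-Zumino term only depends on the boundary value. -/
theorem W_eq_of_boundary_eq {g₁ g₂ : Equiv.Perm (Ball 3)} (hg₁ : g₁ ∈ BallDiffStarZero)
    (hg₂ : g₂ ∈ BallDiffStarZero)
    (h : ∀ u ∈ Metric.sphere (0 : E 3) 1, ext g₁ u = ext g₂ u) : W g₁ = W g₂ := by
  have m₁ := mem_of_mem_idComponent hg₁
  have m₂ := mem_of_mem_idComponent hg₂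
  obtain ⟨G₁, G₁', h₁, h₁', e₁⟩ := exists_layered m₁
  obtain ⟨G₂, G₂', h₂, h₂', e₂⟩ := exists_layered m₂
  obtain ⟨ε₁, hε₁, b₁, -⟩ := layeredOnBall_of_mem m₁
  obtain ⟨ε₂, hε₂, b₂, -⟩ := layeredOnBall_of_mem m₂
  -- On the smaller of the two collars both maps are the homogeneous continuation of their boundary
  -- values.
  refine Layered.W_eq h₁ h₁' e₁ h₂ h₂' e₂ (lt_min hε₁.1 hε₂.1) fun ρ hρ u hu => ?_
  have hlt := hρ.1
  rw [b₁.collar ρ ⟨by linarith [min_le_left ε₁ ε₂], hρ.2⟩ u hu,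
    b₂.collar ρ ⟨by linarith [min_le_right ε₁ ε₂], hρ.2⟩ u hu, h u (mem_sphere_zero_iff_norm.2 hu)]

theorem ext_one {n : ℕ} (x : E n) : ext (1 : Equiv.Perm (Ball n)) x = x := by
  by_cases hx : x ∈ Ball n
  · exact dif_pos hx
  · exact dif_neg hx

theorem layered_id : Layered (fun x => x) (fun x => x) :=
  ⟨contDiff_id, fun _ => rfl, fun _ => rfl, fun _ _ => Eventually.of_forall fun _ _ => rfl⟩

theorem W_one : W 1 = 0 := by
  refine setIntegral_eq_zero_of_forall_eq_zero fun p hp => ?_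
  have hev : ∀ q ∈ coordDomain, jacobian (inCoords 1) q = 1 := by
    intro q hq
    have : inCoords 1 =ᶠ[𝓝 q] fun p => p := by
      filter_upwards [isOpen_coordDomain.mem_nhds hq] with p hp
      rw [inCoords, ext_one, toCoords_fromCoords hp.1]
    ext i j
    rw [jacobian, Matrix.of_apply, this.fderiv_eq]
    simp [Matrix.one_apply]
  have hθ : ∀ v, theta (inCoords 1) p v = 0 := by
    intro v
    have h0 : (Matrix.of fun i j => fderiv ℝ (fun q => jacobian (inCoords 1) q i j) p v) = 0 := by
      ext i j
      have : (fun q => jacobian (inCoords 1) q i j) =ᶠ[𝓝 p]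
          fun _ => (1 : Matrix (Fin 3) (Fin 3) ℝ) i j := by
        filter_upwards [isOpen_coordDomain.mem_nhds hp] with q hq
        rw [hev q hq]
      rw [Matrix.of_apply, this.fderiv_eq]
      simp
    rw [theta, h0, mul_zero]
  simp [density, wedgeCube, hθ]

/-- The Wess-Zumino term vanishes on the boundary-trivial elements. -/
theorem W_eq_zero {g : Equiv.Perm (Ball 3)} (hg : g ∈ boundaryTrivial BallDiffStarZero) :
    W g = 0 := by
  obtain ⟨hg, hb⟩ := hg
  have m := mem_of_mem_idComponent hg
  obtain ⟨G, G', h, h', e⟩ := exists_layered m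
  obtain ⟨ε, hε, b, -⟩ := layeredOnBall_of_mem m
  rw [← W_one]
  -- On its collar a boundary-trivial map coincides with the identity, whose Wess-Zumino term is
  -- zero.
  refine Layered.W_eq h h' e layered_id layered_id (fun x _ => (ext_one x).symm) hε.1
    fun ρ hρ u hu => ?_
  rw [b.collar ρ hρ u hu, hb u (mem_sphere_zero_iff_norm.2 hu), ext_one]

end WessZumino

end

noncomputable section

namespace WessZumino

open Set Filter Topology MeasureTheory

/-! ### Local diffeomorphisms -/

section LocalDiffeo

variable {V : Type*} [NormedAddCommGroup V] [NormedSpace ℝ V] [FiniteDimensional ℝ V]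

/-- The inverse function theorem, for an injective derivative. -/
theorem exists_openPartialHomeomorph {f : V → V} {x : V} (hf : ContDiffAt ℝ ∞ f x)
    (hd : Function.Injective (fderiv ℝ f x)) :
    ∃ e : OpenPartialHomeomorph V V, x ∈ e.source ∧ (e : V → V) = f ∧
      ContDiffAt ℝ ∞ e.symm (f x) := by
  have : CompleteSpace V := FiniteDimensional.complete ℝ V
  let L : V ≃L[ℝ] V :=
    (LinearEquiv.ofInjectiveEndo (fderiv ℝ f x : V →ₗ[ℝ] V) hd).toContinuousLinearEquiv
  have hL : HasFDerivAt f (L : V →L[ℝ] V) x := by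
    have h := (hf.differentiableAt (by simp)).hasFDerivAt
    refine h.congr_fderiv ?_
    ext v
    rfl
  refine ⟨hf.toOpenPartialHomeomorph f hL (by simp), hf.mem_toOpenPartialHomeomorph_source hL _,
    rfl, hf.to_localInverse hL (by simp)⟩

/-- Near each point of `U` the global inverse coincides with the smooth local inverse given by the
inverse function theorem. -/
theorem contDiffOn_of_leftInverse {f g : V → V} {U : Set V} (hU : IsOpen U)
    (hf : ContDiffOn ℝ ∞ f U) (hd : ∀ x ∈ U, Function.Injective (fderiv ℝ f x))
    (hgf : ∀ x, g (f x) = x) (hfg : ∀ x, f (g x) = x) (hg : MapsTo g U U) :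
    ContDiffOn ℝ ∞ g U := by
  intro y hy
  have hgy := hg hy
  obtain ⟨e, he, hef, hes⟩ := exists_openPartialHomeomorph
    (hf.contDiffAt (hU.mem_nhds hgy)) (hd _ hgy)
  rw [hfg] at hes
  refine (hes.congr_of_eventuallyEq ?_).contDiffWithinAt
  have hyt : y ∈ e.target := by
    have := e.map_source he
    rwa [hef, hfg] at this
  filter_upwards [e.open_target.mem_nhds hyt] with w hw
  have h1 := e.right_inv hw
  rw [hef] at h1
  rw [← hgf (e.symm w), h1]

/-- A local diffeomorphism that is the identity near infinity is bijective. -/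
theorem bijective_of_injective_fderiv [Nontrivial V] {f : V → V} (hf : ContDiff ℝ ∞ f)
    (hd : ∀ x, Function.Injective (fderiv ℝ f x)) {R : ℝ} (hR : ∀ x, R ≤ ‖x‖ → f x = x) :
    Function.Bijective f := by
  have : NoncompactSpace V := NormedSpace.noncompactSpace ℝ V
  have : ProperSpace V := FiniteDimensional.proper ℝ V
  have hmap : ∀ x, map f (𝓝 x) = 𝓝 (f x) := by
    intro x
    obtain ⟨e, he, hef, -⟩ := exists_openPartialHomeomorph hf.contDiffAt (hd x)
    have := e.map_nhds_eq he
    rwa [hef] at this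
  have hcont := hf.continuous
  set K := Metric.closedBall (0 : V) R with hK
  have hKc : IsCompact K := isCompact_closedBall _ _
  have hout : ∀ x, x ∉ K → f x = x := fun x hx => hR x (by
    simp only [hK, mem_closedBall_zero_iff, not_le] at hx; exact hx.le)
  have hfK : IsCompact (f '' K) := hKc.image hcont
  constructor
  -- `D'` is the set of double points. It is closed because local injectivity keeps it away from the
  -- diagonal. Its set of values is closed by compactness, open because `f` is open, and bounded,
  -- hence empty by connectedness.
  · set D' : Set (V × V) := {p | f p.1 = f p.2 ∧ p.1 ≠ p.2}
    have hclosed : IsClosed D' := by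
      rw [← isOpen_compl_iff, isOpen_iff_mem_nhds]
      rintro ⟨x, y⟩ hp
      by_cases hxy : f x = f y
      · have hxy' : x = y := by
          by_contra hne; exact hp ⟨hxy, hne⟩
        subst hxy'
        obtain ⟨e, he, hef, -⟩ := exists_openPartialHomeomorph hf.contDiffAt (hd x)
        filter_upwards [prod_mem_nhds (e.open_source.mem_nhds he) (e.open_source.mem_nhds he)]
        rintro ⟨a, b⟩ ⟨ha, hb⟩ ⟨hab, hne⟩
        exact hne (e.injOn ha hb (by rw [hef]; exact hab))
      · have : ∀ᶠ p : V × V in 𝓝 (x, y), f p.1 ≠ f p.2 :=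
          (isOpen_ne_fun (hcont.comp continuous_fst) (hcont.comp continuous_snd)).mem_nhds hxy
        filter_upwards [this] with p hp' hp''
        exact hp' hp''.1
    -- Outside `K` the map is the identity, so a double point has a member in `K`; by symmetry take
    -- it first. The other member is in `K` or equals its own value, which lies in `f '' K`.
    have hD : (fun p : V × V => f p.1) '' D' =
        (fun p : V × V => f p.1) '' (D' ∩ K ×ˢ (K ∪ f '' K)) := by
      apply subset_antisymm _ (image_mono inter_subset_left)
      have key : ∀ x y, f x = f y → x ≠ y → x ∈ K →
          f x ∈ (fun p : V × V => f p.1) '' (D' ∩ K ×ˢ (K ∪ f '' K)) := by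
        intro x y hxy hne hx
        refine ⟨(x, y), ⟨⟨hxy, hne⟩, hx, ?_⟩, rfl⟩
        by_cases hy : y ∈ K
        · exact Or.inl hy
        · exact Or.inr ⟨x, hx, by rw [hxy, hout y hy]⟩
      rintro _ ⟨⟨x, y⟩, ⟨hxy, hne⟩, rfl⟩
      simp only at hxy hne ⊢
      by_cases hx : x ∈ K
      · exact key x y hxy hne hx
      · by_cases hy : y ∈ K
        · rw [hxy]; exact key y x hxy.symm hne.symm hy
        · rw [hout x hx, hout y hy] at hxy; exact absurd hxy hne
    have hDclosed : IsClosed ((fun p : V × V => f p.1) '' D') := by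
      rw [hD]
      exact (((hKc.prod (hKc.union hfK)).inter_left hclosed).image
        (hcont.comp continuous_fst)).isClosed
    have hDopen : IsOpen ((fun p : V × V => f p.1) '' D') := by
      rw [isOpen_iff_mem_nhds]
      rintro _ ⟨⟨x, y⟩, ⟨hxy, hne⟩, rfl⟩
      simp only at hxy hne ⊢
      obtain ⟨u, v, hu, hv, hxu, hyv, huv⟩ := t2_separation hne
      have h1 : f '' u ∈ 𝓝 (f x) := by rw [← hmap]; exact image_mem_map (hu.mem_nhds hxu)
      have h2 : f '' v ∈ 𝓝 (f x) := by rw [hxy, ← hmap]; exact image_mem_map (hv.mem_nhds hyv)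
      filter_upwards [h1, h2]
      rintro _ ⟨a, ha, rfl⟩ ⟨b, hb, hab⟩
      exact ⟨(a, b), ⟨hab.symm, fun h => huv.le_bot ⟨ha, (show a = b from h) ▸ hb⟩⟩, rfl⟩
    have hempty : (fun p : V × V => f p.1) '' D' = ∅ := by
      rcases isClopen_iff.1 ⟨hDclosed, hDopen⟩ with h | h
      · exact h
      · exfalso
        refine (hKc.union hfK).ne_univ (eq_univ_of_forall fun w => ?_)
        have hw : w ∈ (fun p : V × V => f p.1) '' D' := by rw [h]; trivial
        rw [hD] at hw
        obtain ⟨⟨x, y⟩, ⟨-, hx, -⟩, rfl⟩ := hw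
        exact Or.inr ⟨x, hx, rfl⟩
    intro x y hxy
    by_contra hne
    exact (hempty.subset ⟨(x, y), ⟨hxy, hne⟩, rfl⟩ : f x ∈ (∅ : Set V))
  · have hopen : IsOpen (range f) := by
      rw [isOpen_iff_mem_nhds]
      rintro _ ⟨x, rfl⟩
      rw [← hmap]
      exact range_mem_map
    have hrange : range f = f '' K ∪ {x | R ≤ ‖x‖} := by
      ext w
      constructor
      · rintro ⟨x, rfl⟩
        by_cases hx : x ∈ K
        · exact Or.inl ⟨x, hx, rfl⟩
        · right
          rw [hout x hx]
          simp only [hK, mem_closedBall_zero_iff, not_le] at hx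
          exact hx.le
      · rintro (⟨x, -, rfl⟩ | hw)
        · exact ⟨x, rfl⟩
        · exact ⟨w, hR w hw⟩
    have hcl : IsClosed (range f) := by
      rw [hrange]
      exact hfK.isClosed.union (isClosed_le continuous_const continuous_norm)
    rcases isClopen_iff.1 ⟨hcl, hopen⟩ with h | h
    · exact absurd h (range_nonempty f).ne_empty
    · exact range_eq_univ.1 h

end LocalDiffeo

/-! ### Rotations of the plane -/

/-- The rotation of the plane by a right angle. -/
def quarterTurn : E 2 →L[ℝ] E 2 :=
  LinearMap.toContinuousLinearMap
    { toFun := fun x => !₂[-x 1, x 0]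
      map_add' := fun x y => by
        ext i
        fin_cases i
        · simp; ring
        · simp
      map_smul' := fun c x => by ext i; fin_cases i <;> simp }

theorem quarterTurn_apply (x : E 2) : quarterTurn x = !₂[-x 1, x 0] := rfl

/-- The rotation of the plane by the angle `θ`. -/
def rot (θ : ℝ) : E 2 →L[ℝ] E 2 :=
  Real.cos θ • ContinuousLinearMap.id ℝ (E 2) + Real.sin θ • quarterTurn

theorem rot_apply (θ : ℝ) (x : E 2) : rot θ x = Real.cos θ • x + Real.sin θ • quarterTurn x := rfl

theorem rot_zero (x : E 2) : rot 0 x = x := by simp [rot_apply]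

theorem rot_rot (θ φ : ℝ) (x : E 2) : rot θ (rot φ x) = rot (θ + φ) x := by
  ext i
  fin_cases i <;> simp [rot_apply, quarterTurn_apply, Real.cos_add, Real.sin_add] <;> ring

theorem rot_quarterTurn (θ : ℝ) (x : E 2) : rot θ (quarterTurn x) = quarterTurn (rot θ x) := by
  ext i
  fin_cases i <;> simp [rot_apply, quarterTurn_apply] <;> ring

theorem norm_rot (θ : ℝ) (x : E 2) : ‖rot θ x‖ = ‖x‖ := by
  rw [← sq_eq_sq₀ (norm_nonneg _) (norm_nonneg _)]
  simp [EuclideanSpace.real_norm_sq_eq, Fin.sum_univ_two, rot_apply, quarterTurn_apply]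
  linear_combination (x 0 ^ 2 + x 1 ^ 2) * Real.sin_sq_add_cos_sq θ

theorem injective_rot (θ : ℝ) : Function.Injective (rot θ) := fun x y h => by
  have := congrArg (rot (-θ)) h
  simpa [rot_rot, rot_zero] using this

theorem contDiff_rot {X : Type*} [NormedAddCommGroup X] [NormedSpace ℝ X] {s : Set X}
    {a : X → ℝ} {f : X → E 2} (ha : ContDiffOn ℝ ∞ a s) (hf : ContDiffOn ℝ ∞ f s) :
    ContDiffOn ℝ ∞ (fun p => rot (a p) (f p)) s :=
  ((Real.contDiff_cos.comp_contDiffOn ha).smul hf).add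
    ((Real.contDiff_sin.comp_contDiffOn ha).smul (quarterTurn.contDiff.comp_contDiffOn hf))

theorem hasFDerivAt_rot {X : Type*} [NormedAddCommGroup X] [NormedSpace ℝ X]
    {a : X → ℝ} {f : X → E 2} {a' : X →L[ℝ] ℝ} {f' : X →L[ℝ] E 2} {p : X}
    (ha : HasFDerivAt a a' p) (hf : HasFDerivAt f f' p) :
    HasFDerivAt (fun p => rot (a p) (f p))
      ((rot (a p)).comp f' + a'.smulRight (quarterTurn (rot (a p) (f p)))) p := by
  have h := (ha.cos.smul hf).add (ha.sin.smul (quarterTurn.hasFDerivAt.comp p hf))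
  refine h.congr_fderiv ?_
  ext v i
  fin_cases i <;> simp [rot_apply, quarterTurn_apply] <;> ring

theorem smul_quarterTurn_of_norm_eq_one {f w : E 2} (hf : ‖f‖ = 1) (h : inner ℝ w f = (0 : ℝ)) :
    w = inner ℝ w (quarterTurn f) • quarterTurn f := by
  have hf' : f 0 ^ 2 + f 1 ^ 2 = 1 := by
    have := EuclideanSpace.real_norm_sq_eq f
    rw [hf, Fin.sum_univ_two] at this
    linarith
  have h' : w 0 * f 0 + w 1 * f 1 = 0 := by
    simp [PiLp.inner_apply, Fin.sum_univ_two] at h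
    linarith
  ext i
  fin_cases i
  · simp [PiLp.inner_apply, Fin.sum_univ_two, quarterTurn_apply]
    linear_combination f 0 * h' - w 0 * hf'
  · simp [PiLp.inner_apply, Fin.sum_univ_two, quarterTurn_apply]
    linear_combination f 1 * h' - w 1 * hf'

theorem quarterTurn_ne_zero {x : E 2} (hx : x ≠ 0) : quarterTurn x ≠ 0 := by
  intro h
  apply hx
  ext i
  have h0 := congrFun (congrArg WithLp.ofLp h) 0
  have h1 := congrFun (congrArg WithLp.ofLp h) 1
  simp [quarterTurn_apply] at h0 h1
  fin_cases i <;> simp [h0, h1]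

theorem exists_of_rot_eq {θ : ℝ} {x : E 2} (hx : ‖x‖ = 1) (h : rot θ x = x) :
    ∃ k : ℤ, (k : ℝ) * (2 * Real.pi) = θ := by
  rw [← Real.cos_eq_one_iff]
  have h2 := EuclideanSpace.real_norm_sq_eq x
  rw [hx, Fin.sum_univ_two] at h2
  have h0 := congrFun (congrArg WithLp.ofLp h) 0
  have h1 := congrFun (congrArg WithLp.ofLp h) 1
  simp [rot_apply, quarterTurn_apply] at h0 h1
  linear_combination x 0 * h0 + x 1 * h1 - (Real.cos θ - 1) * h2.symm

theorem rot_int_mul (k : ℤ) (x : E 2) : rot (k * (2 * Real.pi)) x = x := by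
  have hs : Real.sin (k * (2 * Real.pi)) = 0 := by
    simpa using Real.sin_add_int_mul_two_pi 0 k
  simp [rot_apply, Real.cos_int_mul_two_pi, hs]

end WessZumino

end

noncomputable section

namespace WessZumino

open Set Filter Topology MeasureTheory

/-! ### Isotopies of the disc that are radial near the boundary -/

/-- Smooth isotopies of immersions of the closed disc that start at the identity and are radial near
the boundary. -/
structure RadialIsotopy (F : ℝ → E 2 → E 2) : Prop where
  smooth : ContDiffOn ℝ ∞ (fun p : ℝ × E 2 => F p.1 p.2) (univ ×ˢ Ball 2)
  zero : ∀ x ∈ Ball 2, F 0 x = x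
  collar : ∀ t, ∃ r ∈ Ioo (0 : ℝ) 1, ∀ x, r < ‖x‖ → ‖x‖ ≤ 1 → F t x = ‖x‖ • F t (‖x‖⁻¹ • x)
  norm : ∀ t x, ‖x‖ = 1 → ‖F t x‖ = 1
  immersion : ∀ t x, ‖x‖ < 1 → Function.Injective (fderiv ℝ (F t) x)

theorem norm_normalize {x : E 2} (hx : x ≠ 0) : ‖‖x‖⁻¹ • x‖ = 1 := by
  rw [norm_smul, norm_inv, norm_norm, inv_mul_cancel₀ (norm_ne_zero_iff.2 hx)]

/-- Reparametrising time by `Real.smoothTransition`, which maps `ℝ` into `[0,1]` and fixes 0 and 1,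
makes the isotopy smooth for all real times, so time has no boundary. -/
theorem radialIsotopy_of_mem_idComponent {H : ℝ → Equiv.Perm (Ball 2)}
    (hH : ∀ t ∈ Icc (0 : ℝ) 1, H t ∈ DiscDiffAR) (h0 : H 0 = 1)
    (hs : ContDiffOn ℝ ∞ (fun p : E 2 × ℝ => ext (H p.2) p.1) (Ball 2 ×ˢ Icc (0 : ℝ) 1)) :
    RadialIsotopy fun t => ext (H (Real.smoothTransition t)) := by
  have hτ : ∀ t, Real.smoothTransition t ∈ Icc (0 : ℝ) 1 := fun t =>
    ⟨Real.smoothTransition.nonneg t, Real.smoothTransition.le_one t⟩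
  have hrad : ∀ t, ∃ B : SphereDiffeo 1, ∃ ε ∈ Ioo (0 : ℝ) 1,
      RadialOnCollar (H (Real.smoothTransition t)) B ε := fun t => by
    obtain ⟨-, f, -, ε, hε, h⟩ := hH _ (hτ t)
    exact ⟨f, ε, hε, h⟩
  refine ⟨?_, ?_, ?_, ?_, ?_⟩
  · have hmap : ContDiff ℝ ∞ fun p : ℝ × E 2 => (p.2, Real.smoothTransition p.1) :=
      contDiff_snd.prodMk (Real.smoothTransition.contDiff.comp contDiff_fst)
    have hm : MapsTo (fun p : ℝ × E 2 => (p.2, Real.smoothTransition p.1)) (univ ×ˢ Ball 2)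
        (Ball 2 ×ˢ Icc (0 : ℝ) 1) := fun p hp => mk_mem_prod hp.2 (hτ p.1)
    have h := hs.comp hmap.contDiffOn hm
    refine h.congr fun p _ => ?_
    rfl
  · intro x hx
    simp only [Real.smoothTransition.zero, h0]
    exact ext_one x
  · intro t
    obtain ⟨B, ε, hε, h⟩ := hrad t
    refine ⟨1 - ε, ⟨by linarith [hε.2], by linarith [hε.1]⟩, fun x hx hx1 => ?_⟩
    have hx0 : x ≠ 0 := norm_pos_iff.1 (by linarith [hε.2])
    let u : S 1 := ⟨‖x‖⁻¹ • x, by rw [mem_sphere_zero_iff_norm, norm_normalize hx0]⟩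
    have e1 := h ‖x‖ ⟨hx, hx1⟩ u
    have e2 := h 1 ⟨by linarith [hε.1], le_rfl⟩ u
    rw [one_smul, one_smul] at e2
    have hxu : ‖x‖ • (u : E 2) = x := smul_inv_smul₀ (norm_ne_zero_iff.2 hx0) x
    rw [hxu, ← e2] at e1
    exact e1
  · intro t x hx
    obtain ⟨B, ε, hε, h⟩ := hrad t
    have e2 := h 1 ⟨by linarith [hε.1], le_rfl⟩ ⟨x, by rw [mem_sphere_zero_iff_norm, hx]⟩
    rw [one_smul, one_smul] at e2
    change ext (H (Real.smoothTransition t)) x = _ at e2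
    change ‖ext (H (Real.smoothTransition t)) x‖ = 1
    rw [e2]
    exact mem_sphere_zero_iff_norm.1 (B _).2
  · intro t x hx
    have h := (hH _ (hτ t)).1.2.2 x (mem_closedBall_zero_iff.2 hx.le)
    rw [fderivWithin_of_mem_nhds (mem_of_superset
      (Metric.isOpen_ball.mem_nhds (mem_ball_zero_iff.2 hx)) Metric.ball_subset_closedBall)] at h
    refine (LinearMap.ker_eq_bot.1 ?_ :
      Function.Injective (fderiv ℝ (ext (H (Real.smoothTransition t))) x : E 2 →ₗ[ℝ] E 2))
    by_contra hne
    exact h.ne' (LinearMap.det_eq_zero_iff_ker_ne_bot.2 hne)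

/-! ### The angle swept by boundary points -/

section Angle

variable {F : ℝ → E 2 → E 2}

/-- The angular velocity of the boundary point in the direction of `p.2`, at the time `p.1`. -/
def angularSpeed (F : ℝ → E 2 → E 2) (p : ℝ × E 2) : ℝ :=
  inner ℝ (deriv (fun s => F s (‖p.2‖⁻¹ • p.2)) p.1) (quarterTurn (F p.1 (‖p.2‖⁻¹ • p.2)))

/-- The angle swept by the boundary point in the direction of `p.2`, up to the time `p.1`. -/
def sweptAngle (F : ℝ → E 2 → E 2) (p : ℝ × E 2) : ℝ :=
  p.1 * ∫ s in (0 : ℝ)..1, angularSpeed F (s * p.1, p.2)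

/-- The domain of angle functions. -/
def angleDomain : Set (ℝ × E 2) := univ ×ˢ {0}ᶜ

theorem isOpen_angleDomain : IsOpen angleDomain := isOpen_univ.prod isOpen_compl_singleton

theorem mem_angleDomain {t : ℝ} {x : E 2} : (t, x) ∈ angleDomain ↔ x ≠ 0 := by
  simp [angleDomain]

theorem contDiffOn_normalize : ContDiffOn ℝ ∞ (fun p : ℝ × E 2 => ‖p.2‖⁻¹ • p.2) angleDomain := by
  have h : ∀ p ∈ angleDomain, (p : ℝ × E 2).2 ≠ 0 := fun _ hp => hp.2
  have hn : ContDiffOn ℝ ∞ (fun p : ℝ × E 2 => ‖p.2‖) angleDomain :=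
    contDiff_snd.contDiffOn.norm ℝ h
  exact (hn.inv fun p hp => norm_ne_zero_iff.2 (h p hp)).smul contDiff_snd.contDiffOn

theorem RadialIsotopy.contDiffOn_boundary (hF : RadialIsotopy F) :
    ContDiffOn ℝ ∞ (fun p : ℝ × E 2 => F p.1 (‖p.2‖⁻¹ • p.2)) angleDomain :=
  hF.smooth.comp (contDiff_fst.contDiffOn.prodMk contDiffOn_normalize) fun _ hp =>
    ⟨trivial, mem_closedBall_zero_iff.2 (norm_normalize hp.2).le⟩

theorem RadialIsotopy.hasDerivAt_boundary (hF : RadialIsotopy F) (t : ℝ) {x : E 2} (hx : x ≠ 0) :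
    HasDerivAt (fun s => F s (‖x‖⁻¹ • x))
      (fderiv ℝ (fun p : ℝ × E 2 => F p.1 (‖p.2‖⁻¹ • p.2)) (t, x) (1, 0)) t := by
  have h := ((hF.contDiffOn_boundary.contDiffAt (isOpen_angleDomain.mem_nhds
    (mem_angleDomain.2 hx) : _ ∈ 𝓝 (t, x))).differentiableAt (by simp)).hasFDerivAt
  exact h.comp_hasDerivAt t ((hasDerivAt_id t).prodMk (hasDerivAt_const t x))

theorem RadialIsotopy.contDiffOn_angularSpeed (hF : RadialIsotopy F) :
    ContDiffOn ℝ ∞ (angularSpeed F) angleDomain := by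
  have hb := hF.contDiffOn_boundary
  have hd : ContDiffOn ℝ ∞ (fun p => fderiv ℝ (fun p : ℝ × E 2 => F p.1 (‖p.2‖⁻¹ • p.2)) p (1, 0))
      angleDomain :=
    (hb.fderiv_of_isOpen isOpen_angleDomain (by simp)).clm_apply contDiffOn_const
  refine (hd.inner ℝ (quarterTurn.contDiff.comp_contDiffOn hb)).congr ?_
  rintro ⟨t, x⟩ hp
  simp only [angularSpeed, Function.comp]
  rw [(hF.hasDerivAt_boundary t (mem_angleDomain.1 hp)).deriv]

theorem RadialIsotopy.contDiffOn_sweptAngle (hF : RadialIsotopy F) :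
    ContDiffOn ℝ ∞ (sweptAngle F) angleDomain := by
  refine contDiff_fst.contDiffOn.mul (contDiffOn_intervalIntegral
    (f := fun s p => angularSpeed F (s * p.1, p.2)) isOpen_angleDomain ?_)
  have h : ContDiff ℝ ∞ fun q : ℝ × (ℝ × E 2) => (q.1 * q.2.1, q.2.2) := by fun_prop
  exact hF.contDiffOn_angularSpeed.comp h.contDiffOn fun q hq => ⟨trivial, hq.2.2⟩

theorem RadialIsotopy.hasDerivAt_sweptAngle (hF : RadialIsotopy F) (t : ℝ) {x : E 2}
    (hx : x ≠ 0) :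
    HasDerivAt (fun s => sweptAngle F (s, x)) (angularSpeed F (t, x)) t := by
  have hc : Continuous fun s => angularSpeed F (s, x) := by
    rw [← continuousOn_univ]
    exact hF.contDiffOn_angularSpeed.continuousOn.comp (by fun_prop)
      fun s _ => mem_angleDomain.2 hx
  refine (hc.integral_hasStrictDerivAt 0 t).hasDerivAt.congr_of_eventuallyEq
    (Eventually.of_forall fun s => ?_)
  have := intervalIntegral.mul_integral_comp_mul_right (a := 0) (b := 1)
    (f := fun σ => angularSpeed F (σ, x)) (c := s)
  simpa [sweptAngle] using this

theorem sweptAngle_zero (F : ℝ → E 2 → E 2) (x : E 2) : sweptAngle F (0, x) = 0 := by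
  simp [sweptAngle]

theorem sweptAngle_smul (F : ℝ → E 2 → E 2) (t : ℝ) (x : E 2) {c : ℝ} (hc : 0 < c) :
    sweptAngle F (t, c • x) = sweptAngle F (t, x) := by
  have h : ‖c • x‖⁻¹ • c • x = ‖x‖⁻¹ • x := by
    rw [norm_smul, Real.norm_of_nonneg hc.le, smul_smul, mul_inv, mul_right_comm,
      inv_mul_cancel₀ hc.ne', one_mul]
  simp only [sweptAngle, angularSpeed, h]

/-- A boundary point moves on the unit circle, so its velocity is the angular speed times its
quarter turn. Undoing the swept angle therefore leaves a constant. -/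
theorem RadialIsotopy.boundary_eq_rot (hF : RadialIsotopy F) (t : ℝ) {x : E 2} (hx : ‖x‖ = 1) :
    F t x = rot (sweptAngle F (t, x)) x := by
  have hx0 : x ≠ 0 := norm_ne_zero_iff.1 (by rw [hx]; exact one_ne_zero)
  have hn : ‖x‖⁻¹ • x = x := by rw [hx, inv_one, one_smul]
  have hd : ∀ s, HasDerivAt (fun s => F s x) (deriv (fun s => F s x) s) s := fun s => by
    have h := hF.hasDerivAt_boundary s hx0
    rw [hn] at h
    exact h.differentiableAt.hasDerivAt
  have hspeed : ∀ s, deriv (fun s => F s x) s =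
      angularSpeed F (s, x) • quarterTurn (F s x) := fun s => by
    have h1 : ∀ s, inner ℝ (F s x) (F s x) = (1 : ℝ) := fun s => by
      rw [real_inner_self_eq_norm_sq, hF.norm s x hx, one_pow]
    have h2 := (hd s).inner ℝ (hd s)
    rw [show (fun s => inner ℝ (F s x) (F s x)) = fun _ => (1 : ℝ) from funext h1] at h2
    have h3 := h2.unique (hasDerivAt_const s (1 : ℝ))
    rw [real_inner_comm, ← two_mul] at h3
    have h4 := smul_quarterTurn_of_norm_eq_one (hF.norm s x hx)
      (w := deriv (fun s => F s x) s) (by linarith)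
    simp only [angularSpeed, hn]
    exact h4
  have hconst : ∀ s, HasDerivAt (fun s => rot (-sweptAngle F (s, x)) (F s x)) 0 s := fun s => by
    have h := (hasFDerivAt_rot (hF.hasDerivAt_sweptAngle s hx0).neg.hasFDerivAt
      (hd s).hasFDerivAt).hasDerivAt
    refine h.congr_deriv ?_
    simp [hspeed s, rot_quarterTurn]
  have h := is_const_of_deriv_eq_zero (fun s => (hconst s).differentiableAt)
    (fun s => (hconst s).deriv) t 0
  simp only [sweptAngle_zero, neg_zero, rot_zero] at h
  rw [hF.zero x (mem_closedBall_zero_iff.2 hx.le)] at h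
  have h' := congrArg (rot (sweptAngle F (t, x))) h
  rwa [rot_rot, add_neg_cancel, rot_zero] at h'

/-- An angle function for a radial isotopy. -/
structure IsAngle (F : ℝ → E 2 → E 2) (a : ℝ × E 2 → ℝ) : Prop where
  smooth : ContDiffOn ℝ ∞ a angleDomain
  smul : ∀ t x (c : ℝ), 0 < c → a (t, c • x) = a (t, x)
  eq_rot : ∀ t x, ‖x‖ = 1 → F t x = rot (a (t, x)) x
  zero : ∀ x, a (0, x) = 0

theorem RadialIsotopy.isAngle_sweptAngle (hF : RadialIsotopy F) : IsAngle F (sweptAngle F) :=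
  ⟨hF.contDiffOn_sweptAngle, fun t x _ hc => sweptAngle_smul F t x hc,
    fun t _ hx => hF.boundary_eq_rot t hx, sweptAngle_zero F⟩

theorem RadialIsotopy.rotate (hF : RadialIsotopy F) {b : ℝ → ℝ} (hb : ContDiff ℝ ∞ b)
    (hb0 : b 0 = 0) : RadialIsotopy fun t x => WessZumino.rot (b t) (F t x) := by
  refine ⟨contDiff_rot (hb.comp contDiff_fst).contDiffOn hF.smooth, fun x hx => ?_, fun t => ?_,
    fun t x hx => ?_, fun t x hx => ?_⟩
  · rw [hb0, rot_zero, hF.zero x hx]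
  · obtain ⟨r, hr, h⟩ := hF.collar t
    exact ⟨r, hr, fun x h1 h2 => by rw [h x h1 h2, map_smul]⟩
  · rw [norm_rot, hF.norm t x hx]
  · have hd : DifferentiableAt ℝ (F t) x := by
      have h1 : ContDiffAt ℝ ∞ (fun p : ℝ × E 2 => F p.1 p.2) (t, x) :=
        hF.smooth.contDiffAt (prod_mem_nhds univ_mem (Metric.closedBall_mem_nhds_of_mem
          (mem_ball_zero_iff.2 hx)))
      exact (h1.comp x (contDiffAt_const.prodMk contDiffAt_id)).differentiableAt (by simp)
    have h := (WessZumino.rot (b t)).hasFDerivAt.comp x hd.hasFDerivAt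
    rw [show fderiv ℝ (fun x => WessZumino.rot (b t) (F t x)) x = _ from h.fderiv]
    exact (injective_rot _).comp (hF.immersion t x hx)

/-- The angle at time one lies in `2πℤ`, hence is a constant `2πk` on the connected circle. Rotating
the isotopy by `-2πk` times a smooth transition does not change its time-one map, but makes the
final angle zero. Without this the rotation outside the disc would not end at the identity once the
angle is cut off. -/
theorem exists_isAngle_eq_zero (hF : RadialIsotopy F) (h1 : ∀ x, ‖x‖ = 1 → F 1 x = x) :
    ∃ F' a, RadialIsotopy F' ∧ F' 1 = F 1 ∧ IsAngle F' a ∧ ∀ x ≠ 0, a (1, x) = 0 := by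
  have ha := hF.isAngle_sweptAngle
  set a := sweptAngle F
  have hk : ∀ x, ‖x‖ = 1 → ∃ k : ℤ, (k : ℝ) * (2 * Real.pi) = a (1, x) := fun x hx =>
    exists_of_rot_eq hx (by rw [← ha.eq_rot 1 x hx, h1 x hx])
  let u₀ : E 2 := EuclideanSpace.single 0 1
  have hu₀ : ‖u₀‖ = 1 := by simp [u₀]
  obtain ⟨k, hk₀⟩ := hk u₀ hu₀
  have hconst : ∀ x, ‖x‖ = 1 → a (1, x) = k * (2 * Real.pi) := by
    intro x hx
    rw [hk₀]
    have hpre : IsPreconnected (Metric.sphere (0 : E 2) 1) :=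
      isPreconnected_sphere (by simp [← Module.finrank_eq_rank]) 0 1
    refine hpre.constant_of_mapsTo (T := (AddSubgroup.zmultiples (2 * Real.pi) : Set ℝ))
      
      ⟨inferInstanceAs (DiscreteTopology (AddSubgroup.zmultiples (2 * Real.pi)))⟩
      (f := fun x => a (1, x)) (S := Metric.sphere (0 : E 2) 1) ?_ ?_ (mem_sphere_zero_iff_norm.2 hx)
      (mem_sphere_zero_iff_norm.2 hu₀)
    · refine ha.smooth.continuousOn.comp (f := fun y : E 2 => ((1 : ℝ), y))
        (Continuous.prodMk_right (1 : ℝ)).continuousOn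
        fun y hy => mem_angleDomain.2 ?_
      rw [mem_sphere_zero_iff_norm] at hy
      exact norm_ne_zero_iff.1 (by rw [hy]; exact one_ne_zero)
    · intro y hy
      obtain ⟨m, hm⟩ := hk y (mem_sphere_zero_iff_norm.1 hy)
      exact ⟨m, by simpa using hm⟩
  have hb : ContDiff ℝ ∞ fun t : ℝ => -(k * (2 * Real.pi) * Real.smoothTransition t) :=
    (contDiff_const.mul Real.smoothTransition.contDiff).neg
  have hb1 : -(k * (2 * Real.pi) * Real.smoothTransition 1) = ((-k : ℤ) : ℝ) * (2 * Real.pi) := by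
    rw [Real.smoothTransition.one]; push_cast; ring
  refine ⟨_, fun p => -(k * (2 * Real.pi) * Real.smoothTransition p.1) + a p, hF.rotate hb (by simp),
    ?_, ⟨?_, ?_, ?_, ?_⟩, ?_⟩
  · funext x
    rw [hb1, rot_int_mul]
  · exact (hb.comp contDiff_fst).contDiffOn.add ha.smooth
  · intro t x c hc
    simp only [ha.smul t x c hc]
  · intro t x hx
    simp only
    rw [ha.eq_rot t x hx, rot_rot]
  · intro x
    simp [ha.zero x]
  · intro x hx
    have h2 := hconst _ (norm_normalize hx)
    rw [ha.smul 1 x _ (inv_pos.2 (norm_pos_iff.2 hx))] at h2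
    simp only [h2, Real.smoothTransition.one]
    ring

end Angle

end WessZumino

end

noncomputable section

namespace WessZumino

open Set Filter Topology MeasureTheory

/-! ### Extending an isotopy of the disc to the plane -/

/-- A rotation invariant function, equal to `1` near the unit circle. -/
def cutoff (x : E 2) : ℝ :=
  Real.smoothTransition (8 * ‖x‖ ^ 2 - 1) * Real.smoothTransition (3 - ‖x‖ ^ 2)

theorem contDiff_cutoff : ContDiff ℝ ∞ cutoff := by
  have h : ContDiff ℝ ∞ fun x : E 2 => ‖x‖ ^ 2 := contDiff_norm_sq ℝ
  exact (Real.smoothTransition.contDiff.comp ((contDiff_const.mul h).sub contDiff_const)).mul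
    (Real.smoothTransition.contDiff.comp (contDiff_const.sub h))

theorem cutoff_mem_Icc (x : E 2) : cutoff x ∈ Icc (0 : ℝ) 1 :=
  ⟨mul_nonneg (Real.smoothTransition.nonneg _) (Real.smoothTransition.nonneg _),
    mul_le_one₀ (Real.smoothTransition.le_one _) (Real.smoothTransition.nonneg _)
      (Real.smoothTransition.le_one _)⟩

theorem cutoff_eq_zero_of_small {x : E 2} (hx : ‖x‖ ^ 2 ≤ 1 / 8) : cutoff x = 0 := by
  rw [cutoff, Real.smoothTransition.zero_of_nonpos (by linarith), zero_mul]

theorem cutoff_eq_zero_of_large {x : E 2} (hx : 3 ≤ ‖x‖ ^ 2) : cutoff x = 0 := by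
  rw [cutoff, Real.smoothTransition.zero_of_nonpos (x := 3 - ‖x‖ ^ 2) (by linarith), mul_zero]

theorem cutoff_eq_one {x : E 2} (hx : 1 / 2 ≤ ‖x‖) (hx' : ‖x‖ ≤ 1) : cutoff x = 1 := by
  rw [cutoff, Real.smoothTransition.one_of_one_le (by nlinarith),
    Real.smoothTransition.one_of_one_le (by nlinarith), one_mul]

theorem fderiv_cutoff_quarterTurn (x : E 2) : fderiv ℝ cutoff x (quarterTurn x) = 0 := by
  set φ : ℝ → ℝ := fun s => Real.smoothTransition (8 * s - 1) * Real.smoothTransition (3 - s)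
  have hφ : ContDiff ℝ ∞ φ :=
    (Real.smoothTransition.contDiff.comp ((contDiff_const.mul contDiff_id).sub contDiff_const)).mul
      (Real.smoothTransition.contDiff.comp (contDiff_const.sub contDiff_id))
  have h1 : HasFDerivAt (φ ∘ fun y : E 2 => ‖y‖ ^ 2) _ x :=
    (((hφ.differentiable (by simp)) (‖x‖ ^ 2)).hasDerivAt).comp_hasFDerivAt x
      (hasStrictFDerivAt_norm_sq x).hasFDerivAt
  change fderiv ℝ (φ ∘ fun y : E 2 => ‖y‖ ^ 2) x _ = 0
  rw [h1.fderiv]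
  simp [PiLp.inner_apply, Fin.sum_univ_two, quarterTurn_apply]
  right
  ring

/-- The map that rotates the circles around the origin as prescribed by an angle function, cut off
near the origin and near infinity. -/
def spin (a : ℝ × E 2 → ℝ) (t : ℝ) (x : E 2) : E 2 := rot (cutoff x * a (t, x)) x

theorem spin_of_large (a : ℝ × E 2 → ℝ) (t : ℝ) {x : E 2} (hx : 3 ≤ ‖x‖ ^ 2) :
    spin a t x = x := by
  rw [spin, cutoff_eq_zero_of_large hx, zero_mul, rot_zero]

theorem fderiv_rot_apply {b : E 2 → ℝ} {b' : E 2 →L[ℝ] ℝ} {x : E 2} (hb : HasFDerivAt b b' x)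
    (v : E 2) :
    fderiv ℝ (fun y => rot (b y) y) x v = rot (b x) (v + b' v • quarterTurn x) := by
  have h := hasFDerivAt_rot hb (hasFDerivAt_id x)
  simp only [id] at h
  rw [h.fderiv]
  simp [rot_quarterTurn]

/-- Up to a rotation the derivative is `v ↦ v + b'(v) • quarterTurn x`, a rank-one perturbation of
the identity, with determinant `1 + b' (quarterTurn x)`. -/
theorem injective_fderiv_rot {b : E 2 → ℝ} {b' : E 2 →L[ℝ] ℝ} {x : E 2} (hb : HasFDerivAt b b' x)
    (h : 1 + b' (quarterTurn x) ≠ 0) :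
    Function.Injective (fderiv ℝ (fun y => rot (b y) y) x) := by
  rw [injective_iff_map_eq_zero]
  intro v hv
  rw [fderiv_rot_apply hb] at hv
  have h0 : v + b' v • quarterTurn x = 0 :=
    injective_rot _ (by rw [hv, map_zero])
  have h1 : v = -(b' v) • quarterTurn x := by
    rw [neg_smul]; exact eq_neg_of_add_eq_zero_left h0
  have h2 : b' v * (1 + b' (quarterTurn x)) = 0 := by
    have := congrArg b' h0
    rw [map_add, map_smul, smul_eq_mul, map_zero] at this
    linear_combination this
  rw [h1, (mul_eq_zero.1 h2).resolve_right h, neg_zero, zero_smul]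

theorem one_add_ne_zero_of_injective {b : E 2 → ℝ} {b' : E 2 →L[ℝ] ℝ} {x : E 2} (hx : x ≠ 0)
    (hb : HasFDerivAt b b' x) (h : Function.Injective (fderiv ℝ (fun y => rot (b y) y) x)) :
    1 + b' (quarterTurn x) ≠ 0 := by
  intro h0
  refine quarterTurn_ne_zero hx (h ?_)
  rw [fderiv_rot_apply hb, map_zero]
  nth_rewrite 1 [← one_smul ℝ (quarterTurn x)]
  rw [← add_smul, h0, zero_smul, map_zero]

/-! ### Gluing the disc isotopy to rotations of circles -/

section PlaneIsotopy

variable {F : ℝ → E 2 → E 2} {a : ℝ × E 2 → ℝ}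

theorem IsAngle.contDiff_spin (ha : IsAngle F a) :
    ContDiff ℝ ∞ fun p : ℝ × E 2 => spin a p.1 p.2 := by
  rw [contDiff_iff_contDiffAt]
  rintro ⟨t, x⟩
  by_cases hx : x = 0
  · refine (contDiffAt_snd (𝕜 := ℝ) (E := ℝ) (F := E 2)).congr_of_eventuallyEq ?_
    have ho : IsOpen {p : ℝ × E 2 | ‖p.2‖ ^ 2 < 1 / 8} :=
      isOpen_lt (by fun_prop) continuous_const
    filter_upwards [ho.mem_nhds (by simp [hx] : (t, x) ∈ {p : ℝ × E 2 | ‖p.2‖ ^ 2 < 1 / 8})]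
      with p hp
    rw [spin, cutoff_eq_zero_of_small hp.le, zero_mul, rot_zero]
  · have h : ContDiffOn ℝ ∞ (fun p : ℝ × E 2 => spin a p.1 p.2) angleDomain :=
      contDiff_rot ((contDiff_cutoff.comp contDiff_snd).contDiffOn.mul ha.smooth)
        contDiff_snd.contDiffOn
    exact h.contDiffAt (isOpen_angleDomain.mem_nhds (mem_angleDomain.2 hx))

theorem IsAngle.hasFDerivAt (ha : IsAngle F a) (t : ℝ) {x : E 2} (hx : x ≠ 0) :
    HasFDerivAt (fun y => a (t, y)) ((fderiv ℝ a (t, x)).comp (.inr ℝ ℝ (E 2))) x := by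
  have h := ((ha.smooth.contDiffAt (isOpen_angleDomain.mem_nhds
    (mem_angleDomain.2 hx))).differentiableAt (by simp)).hasFDerivAt (x := (t, x))
  exact h.comp x (hasFDerivAt_prodMk_right t x)

/-- The angle is constant along rays, so its angular derivative may be computed at any radius, in
particular inside the collar. -/
theorem IsAngle.fderiv_smul (ha : IsAngle F a) (t : ℝ) {x : E 2} (hx : x ≠ 0) {c : ℝ}
    (hc : 0 < c) :
    fderiv ℝ a (t, c • x) (0, quarterTurn (c • x)) = fderiv ℝ a (t, x) (0, quarterTurn x) := by
  have h1 := (ha.hasFDerivAt t (smul_ne_zero hc.ne' hx)).comp x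
    ((hasFDerivAt_id x).const_smul c)
  have h2 : ((fun y => a (t, y)) ∘ (c • id : E 2 → E 2)) = fun y => a (t, y) :=
    funext fun y => ha.smul t y c hc
  have h3 := (ha.hasFDerivAt t hx).unique (h2 ▸ h1)
  have h4 := congrArg (fun L : E 2 →L[ℝ] ℝ => L (quarterTurn x)) h3
  rw [map_smul, show ((0 : ℝ), c • quarterTurn x) = c • ((0 : ℝ), quarterTurn x) by simp, map_smul]
  simpa using h4.symm

theorem IsAngle.collar (hF : RadialIsotopy F) (ha : IsAngle F a) (t : ℝ) :
    ∃ r ∈ Ioo (0 : ℝ) 1, ∀ x, r < ‖x‖ → ‖x‖ ≤ 1 → F t x = rot (a (t, x)) x := by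
  obtain ⟨r, hr, h⟩ := hF.collar t
  refine ⟨r, hr, fun x hx hx1 => ?_⟩
  have hx0 : x ≠ 0 := norm_pos_iff.1 (hr.1.trans hx)
  rw [h x hx hx1, ha.eq_rot t _ (norm_normalize hx0), ha.smul t x _ (inv_pos.2 (norm_pos_iff.2 hx0)),
    ← map_smul, smul_inv_smul₀ (norm_ne_zero_iff.2 hx0)]

/-- This is the derivative of the circle map `θ ↦ θ + a`. It is nonzero because in the collar `F t`
is an immersion given by this rotation, and positive by continuity in `t` from `t = 0`, where `a =
0`. -/
theorem IsAngle.one_add_fderiv_pos (hF : RadialIsotopy F) (ha : IsAngle F a) (t : ℝ) {x : E 2}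
    (hx : x ≠ 0) : 0 < 1 + fderiv ℝ a (t, x) (0, quarterTurn x) := by
  have hne : ∀ t, 1 + fderiv ℝ a (t, x) (0, quarterTurn x) ≠ 0 := by
    intro t
    obtain ⟨r, hr, h⟩ := ha.collar hF t
    obtain ⟨s, hs, hs1⟩ := exists_between hr.2
    have hs0 : 0 < s := hr.1.trans hs
    have hc : 0 < s / ‖x‖ := div_pos hs0 (norm_pos_iff.2 hx)
    have hn : ‖(s / ‖x‖) • x‖ = s := by
      rw [norm_smul, Real.norm_of_nonneg hc.le, div_mul_cancel₀ _ (norm_ne_zero_iff.2 hx)]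
    rw [← ha.fderiv_smul t hx hc]
    set y := (s / ‖x‖) • x
    have hy : y ≠ 0 := smul_ne_zero hc.ne' hx
    refine one_add_ne_zero_of_injective hy (ha.hasFDerivAt t hy) ?_
    have ho : IsOpen {z : E 2 | r < ‖z‖ ∧ ‖z‖ < 1} :=
      (isOpen_lt continuous_const continuous_norm).inter (isOpen_lt continuous_norm continuous_const)
    have hev : (fun z => rot (a (t, z)) z) =ᶠ[𝓝 y] F t := by
      filter_upwards [ho.mem_nhds ⟨by rwa [hn], by rwa [hn]⟩] with z hz
      rw [h z hz.1 hz.2.le]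
    rw [hev.fderiv_eq]
    exact hF.immersion t y (by rwa [hn])
  have hcont : Continuous fun t => 1 + fderiv ℝ a (t, x) (0, quarterTurn x) := by
    have h1 : ContinuousOn (fun p => fderiv ℝ a p (0, quarterTurn x)) angleDomain :=
      ((ha.smooth.fderiv_of_isOpen isOpen_angleDomain (m := ∞) (by simp)).clm_apply
        contDiffOn_const).continuousOn
    have h2 : Continuous fun t => fderiv ℝ a (t, x) (0, quarterTurn x) := by
      rw [← continuousOn_univ]
      exact h1.comp (f := fun t : ℝ => (t, x)) (Continuous.prodMk_left x).continuousOn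
        fun s _ => mem_angleDomain.2 hx
    exact continuous_const.add h2
  have h0 : 0 < 1 + fderiv ℝ a (0, x) (0, quarterTurn x) := by
    have h1 := ha.hasFDerivAt 0 hx
    simp only [ha.zero] at h1
    have h2 := congrArg (fun L : E 2 →L[ℝ] ℝ => L (quarterTurn x))
      (h1.unique (hasFDerivAt_const (0 : ℝ) x))
    have h3 : fderiv ℝ a (0, x) (0, quarterTurn x) = 0 := by simpa using h2
    rw [h3, add_zero]
    exact one_pos
  by_contra hneg
  obtain ⟨s, hs⟩ := mem_range_of_exists_le_of_exists_ge hcont ⟨t, not_lt.1 hneg⟩ ⟨0, h0.le⟩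
  exact hne s hs

/-- The cutoff is constant on circles, so it contributes no angular derivative; the relevant number
is a convex combination of 1 and a positive number. -/
theorem IsAngle.injective_fderiv_spin (hF : RadialIsotopy F) (ha : IsAngle F a) (t : ℝ) {x : E 2}
    (hx : x ≠ 0) : Function.Injective (fderiv ℝ (spin a t) x) := by
  have hc := ((contDiff_cutoff.differentiable (by simp)).differentiableAt (x := x)).hasFDerivAt
  have hb := hc.mul (ha.hasFDerivAt t hx)
  refine injective_fderiv_rot hb ?_
  simp only [add_apply, smul_apply, ContinuousLinearMap.coe_comp, Function.comp_apply,
    ContinuousLinearMap.inr_apply, smul_eq_mul, fderiv_cutoff_quarterTurn, mul_zero, add_zero]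
  have h1 := ha.one_add_fderiv_pos hF t hx
  obtain ⟨h2, h3⟩ := cutoff_mem_Icc x
  have : 0 < 1 + cutoff x * fderiv ℝ a (t, x) (0, quarterTurn x) := by
    rcases h3.lt_or_eq with h3 | h3
    · nlinarith
    · rw [h3, one_mul]; exact h1
  exact this.ne'

/-- The isotopy of the plane that extends an isotopy of the disc. -/
def planeIsotopy (F : ℝ → E 2 → E 2) (a : ℝ × E 2 → ℝ) (t : ℝ) (x : E 2) : E 2 :=
  open Classical in if ‖x‖ ≤ 1 then F t x else spin a t x

theorem planeIsotopy_of_le {t : ℝ} {x : E 2} (hx : ‖x‖ ≤ 1) : planeIsotopy F a t x = F t x :=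
  if_pos hx

/-- The radius is raised to at least `1/2` because there, up to the unit circle, the cutoff is 1. It
depends on `t`, with no uniformity. -/
theorem planeIsotopy_eq_spin (hF : RadialIsotopy F) (ha : IsAngle F a) (t : ℝ) :
    ∃ r ∈ Ioo (0 : ℝ) 1, ∀ x, r < ‖x‖ → planeIsotopy F a t x = spin a t x := by
  obtain ⟨r, hr, h⟩ := ha.collar hF t
  refine ⟨max r (1 / 2), ⟨lt_max_of_lt_left hr.1, max_lt hr.2 (by norm_num)⟩, fun x hx => ?_⟩
  by_cases hx1 : ‖x‖ ≤ 1
  · rw [planeIsotopy, if_pos hx1, h x ((le_max_left _ _).trans_lt hx) hx1, spin,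
      cutoff_eq_one ((le_max_right _ _).trans hx.le) hx1, one_mul]
  · rw [planeIsotopy, if_neg hx1]

theorem injective_fderiv_planeIsotopy (hF : RadialIsotopy F) (ha : IsAngle F a) (t : ℝ) (x : E 2) :
    Function.Injective (fderiv ℝ (planeIsotopy F a t) x) := by
  obtain ⟨r, hr, h⟩ := planeIsotopy_eq_spin hF ha t
  by_cases hx : r < ‖x‖
  · have hev : planeIsotopy F a t =ᶠ[𝓝 x] spin a t := by
      filter_upwards [(isOpen_lt continuous_const continuous_norm).mem_nhds hx] with y hy
        using h y hy
    rw [hev.fderiv_eq]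
    exact ha.injective_fderiv_spin hF t (norm_pos_iff.1 (hr.1.trans hx))
  · have hx1 : ‖x‖ < 1 := (not_lt.1 hx).trans_lt hr.2
    have hev : planeIsotopy F a t =ᶠ[𝓝 x] F t := by
      filter_upwards [(isOpen_lt continuous_norm continuous_const).mem_nhds hx1] with y hy
        using planeIsotopy_of_le (le_of_lt hy)
    rw [hev.fderiv_eq]
    exact hF.immersion t x hx1

/-- At each time the two formulas agree near the unit circle, but the collar may shrink as `t`
varies. So their difference is shown to be flat along the circle, using the slices `t = const`, and
is then extended by zero. -/
theorem contDiff_planeIsotopy (hF : RadialIsotopy F) (ha : IsAngle F a) :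
    ContDiff ℝ ∞ fun p : ℝ × E 2 => planeIsotopy F a p.1 p.2 := by
  set K : Set (ℝ × E 2) := univ ×ˢ Ball 2
  set A : Set (ℝ × E 2) := univ ×ˢ Metric.sphere 0 1
  have hint : interior K = univ ×ˢ Metric.ball (0 : E 2) 1 := by
    rw [interior_prod_eq, interior_univ, interior_closedBall _ one_ne_zero]
  have hclos : closure (Metric.ball (0 : E 2) 1) = Ball 2 := closure_ball _ one_ne_zero
  have hKc : K ⊆ closure (interior K) := by
    rw [hint, closure_prod_eq, closure_univ, hclos]
  have hKu : UniqueDiffOn ℝ K := uniqueDiffOn_univ.prod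
    (uniqueDiffOn_convex (convex_closedBall _ _) (by
      rw [interior_closedBall _ one_ne_zero]; exact Metric.nonempty_ball.2 one_pos))
  have hKcl : IsClosed K := isClosed_univ.prod Metric.isClosed_closedBall
  have hfr : frontier K ⊆ A := by
    rw [frontier_univ_prod_eq, frontier_closedBall _ one_ne_zero]
  have hAK : A ⊆ K := prod_mono subset_rfl Metric.sphere_subset_closedBall
  rw [contDiff_euclidean]
  intro i
  set D : ℝ × E 2 → ℝ := fun p => F p.1 p.2 i - spin a p.1 p.2 i
  have hD : ContDiffOn ℝ ∞ D K :=
    (contDiffOn_euclidean.1 hF.smooth i).sub (contDiff_euclidean.1 ha.contDiff_spin i).contDiffOn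
  have hflat : Flat K A D := by
    refine flat_of_slices (ContinuousLinearMap.fst ℝ ℝ (E 2)) (e := (1, 0)) rfl hKu hKc hAK
      ?_ ?_ hD ?_
    · rintro ⟨t, x⟩ ⟨-, hx⟩
      rw [hint]
      have hx' : x ∈ closure (Metric.ball (0 : E 2) 1) := by
        rw [hclos]; exact Metric.sphere_subset_closedBall hx
      exact map_mem_closure (f := fun y : E 2 => (t, y)) (Continuous.prodMk_right t) hx'
        fun y hy => ⟨⟨trivial, hy⟩, rfl⟩
    · rintro ⟨t, x⟩ ⟨-, hx⟩
      exact Eventually.of_forall fun h => ⟨trivial, by simpa using hx⟩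
    · rintro ⟨t, x⟩ ⟨-, hx⟩
      obtain ⟨r, hr, h⟩ := planeIsotopy_eq_spin hF ha t
      refine ⟨{p | r < ‖p.2‖}, isOpen_lt continuous_const (by fun_prop), ?_, ?_⟩
      · change r < ‖x‖
        rw [mem_sphere_zero_iff_norm.1 hx]
        exact hr.2
      · rintro ⟨s, y⟩ ⟨hy, hyK⟩ hs
        have hst : s = t := hs
        subst hst
        have hyK' := mem_closedBall_zero_iff.1 (interior_subset hyK).2
        simp only [D]
        rw [← h y hy, planeIsotopy_of_le hyK', sub_self]
  have heq : (fun p : ℝ × E 2 => planeIsotopy F a p.1 p.2 i) =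
      fun p => spin a p.1 p.2 i + K.indicator D p := by
    funext p
    by_cases hp : ‖p.2‖ ≤ 1
    · rw [indicator_of_mem (show p ∈ K from ⟨trivial, mem_closedBall_zero_iff.2 hp⟩),
        planeIsotopy_of_le hp]
      simp only [D]
      ring
    · rw [indicator_of_notMem (fun h : p ∈ K => hp (mem_closedBall_zero_iff.1 h.2)),
        planeIsotopy, if_neg hp, add_zero]
  rw [heq]
  exact (contDiff_euclidean.1 ha.contDiff_spin i).add (hflat.contDiff_indicator hKcl hKu hfr)

end PlaneIsotopy

/-- Smooth isotopies of the plane that start at the identity, with supports in a fixed disc. -/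
structure PlaneIsotopy (Ψ : ℝ → E 2 → E 2) : Prop where
  smooth : ContDiff ℝ ∞ fun p : ℝ × E 2 => Ψ p.1 p.2
  immersion : ∀ t x, Function.Injective (fderiv ℝ (Ψ t) x)
  eq_self : ∀ t x, 3 ≤ ‖x‖ ^ 2 → Ψ t x = x
  zero : ∀ x, Ψ 0 x = x

theorem PlaneIsotopy.contDiff {Ψ : ℝ → E 2 → E 2} (h : PlaneIsotopy Ψ) (t : ℝ) :
    ContDiff ℝ ∞ (Ψ t) :=
  h.smooth.comp (contDiff_const.prodMk contDiff_id)

theorem PlaneIsotopy.bijective {Ψ : ℝ → E 2 → E 2} (h : PlaneIsotopy Ψ) (t : ℝ) :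
    Function.Bijective (Ψ t) :=
  bijective_of_injective_fderiv (h.contDiff t) (h.immersion t) (R := 2) fun x hx =>
    h.eq_self t x (by nlinarith)

/-- Every element of `ℋ`, extended by the identity, is isotopic to the identity of the plane by a
compactly supported isotopy. -/
theorem exists_planeIsotopy {h : Equiv.Perm (Ball 2)} (hh : h ∈ GroupH) :
    ∃ Ψ, PlaneIsotopy Ψ ∧ (∀ x ∈ Ball 2, Ψ 1 x = ext h x) ∧ ∀ x, 1 ≤ ‖x‖ → Ψ 1 x = x := by
  obtain ⟨⟨H, hH, h0, h1, hs⟩, hbt⟩ := hh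
  have hF := radialIsotopy_of_mem_idComponent hH h0 hs
  have hF1 : ext (H (Real.smoothTransition 1)) = ext h := by rw [Real.smoothTransition.one, h1]
  obtain ⟨F', a, hF', hF'1, ha, ha1⟩ := exists_isAngle_eq_zero hF (fun x hx => by
    rw [hF1]; exact hbt x (mem_sphere_zero_iff_norm.2 hx))
  have key : ∀ x, ‖x‖ ≤ 1 → planeIsotopy F' a 1 x = ext h x := fun x hx => by
    rw [planeIsotopy_of_le hx, hF'1, hF1]
  refine ⟨planeIsotopy F' a, ⟨contDiff_planeIsotopy hF' ha, injective_fderiv_planeIsotopy hF' ha,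
    fun t x hx => ?_, fun x => ?_⟩, fun x hx => key x (mem_closedBall_zero_iff.1 hx),
    fun x hx => ?_⟩
  · rw [planeIsotopy, if_neg (by intro; nlinarith [norm_nonneg x]), spin_of_large a t hx]
  · rw [planeIsotopy]
    split_ifs with hx
    · exact hF'.zero x (mem_closedBall_zero_iff.2 hx)
    · rw [spin, ha.zero, mul_zero, rot_zero]
  · rcases hx.eq_or_lt with hx | hx
    · rw [key x hx.symm.le]
      exact hbt x (mem_sphere_zero_iff_norm.2 hx.symm)
    · rw [planeIsotopy, if_neg (not_le.2 hx), spin,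
        ha1 x (norm_pos_iff.1 (one_pos.trans hx)), mul_zero, rot_zero]

end WessZumino

end

noncomputable section

namespace WessZumino

open Set Filter Topology MeasureTheory

/-! ### Homogeneous maps of space given by maps of the plane -/

theorem invStereo_eq_invStereoCoord (z : E 2) : invStereo z = invStereoCoord !₂[1, z 0, z 1] := by
  rw [invStereoCoord]
  congr 1
  ext i
  fin_cases i <;> simp

theorem invStereo_eq_fromCoords (z : E 2) : invStereo z = fromCoords !₂[1, z 0, z 1] := by
  rw [fromCoords_eq, invStereo_eq_invStereoCoord]
  simp

theorem norm_invStereo (z : E 2) : ‖invStereo z‖ = 1 := by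
  rw [invStereo_eq_invStereoCoord, norm_invStereoCoord]

theorem one_add_invStereo_pos (z : E 2) : 0 < 1 + invStereo z 2 := by
  have h : (0 : ℝ) < 1 + ‖z‖ ^ 2 := by positivity
  have : 1 + invStereo z 2 = 2 * (1 + ‖z‖ ^ 2)⁻¹ := by
    simp [invStereo]
    field_simp
    ring
  rw [this]
  positivity

theorem stereo_invStereo (z : E 2) : stereo (invStereo z) = z := by
  have h := toCoords_fromCoords (p := !₂[1, z 0, z 1]) (by simp)
  rw [← invStereo_eq_fromCoords] at h
  ext i
  fin_cases i
  · simpa [toCoords] using congrArg (fun p : E 3 => p 1) h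
  · simpa [toCoords] using congrArg (fun p : E 3 => p 2) h

theorem smul_invStereo_stereo {x : E 3} (hx : 0 < ‖x‖ + x 2) :
    ‖x‖ • invStereo (stereo x) = x := by
  have h := fromCoords_toCoords hx
  rw [fromCoords_eq] at h
  rw [invStereo_eq_invStereoCoord]
  simpa [toCoords, invStereoCoord] using h

theorem contDiff_invStereo : ContDiff ℝ ∞ invStereo := by
  have h : ContDiff ℝ ∞ fun z : E 2 => (!₂[1, z 0, z 1] : E 3) := by
    rw [contDiff_euclidean]
    intro i
    fin_cases i
    · exact contDiff_const
    · exact contDiff_euclidean.1 contDiff_id 0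
    · exact contDiff_euclidean.1 contDiff_id 1
  rw [show invStereo = fun z => invStereoCoord !₂[1, z 0, z 1] from
    funext invStereo_eq_invStereoCoord]
  exact contDiff_invStereoCoord.comp h

/-- The complement of the closed ray through the point at infinity of the sphere. -/
def slitSpace : Set (E 3) := {x | 0 < ‖x‖ + x 2}

theorem isOpen_slitSpace : IsOpen slitSpace := isOpen_lt continuous_const (by fun_prop)

theorem ne_zero_of_mem_slitSpace {x : E 3} (hx : x ∈ slitSpace) : x ≠ 0 := by
  rintro rfl
  simp [slitSpace] at hx

theorem contDiffOn_stereo : ContDiffOn ℝ ∞ stereo slitSpace := by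
  have hc : ∀ i, ContDiff ℝ ∞ fun x : E 3 => x i := contDiff_euclidean.1 contDiff_id
  have hn : ContDiffOn ℝ ∞ (fun x : E 3 => ‖x‖ + x 2) slitSpace :=
    (contDiff_id.contDiffOn.norm ℝ fun x hx => ne_zero_of_mem_slitSpace hx).add (hc 2).contDiffOn
  rw [contDiffOn_euclidean]
  intro i
  fin_cases i
  · exact (hc 0).contDiffOn.div hn fun x hx => ne_of_gt hx
  · exact (hc 1).contDiffOn.div hn fun x hx => ne_of_gt hx

/-- The radius preserving map of space that is given by `ψ` in stereographic coordinates. -/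
def layerMap (ψ : E 2 → E 2) (x : E 3) : E 3 :=
  open Classical in if x ∈ slitSpace then ‖x‖ • invStereo (ψ (stereo x)) else x

theorem layerMap_of_mem (ψ : E 2 → E 2) {x : E 3} (hx : x ∈ slitSpace) :
    layerMap ψ x = ‖x‖ • invStereo (ψ (stereo x)) := if_pos hx

theorem layerMap_of_notMem (ψ : E 2 → E 2) {x : E 3} (hx : x ∉ slitSpace) :
    layerMap ψ x = x := if_neg hx

theorem norm_layerMap (ψ : E 2 → E 2) (x : E 3) : ‖layerMap ψ x‖ = ‖x‖ := by
  by_cases hx : x ∈ slitSpace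
  · rw [layerMap_of_mem ψ hx, norm_smul, norm_invStereo, norm_norm, mul_one]
  · rw [layerMap_of_notMem ψ hx]

theorem layerMap_mem_slitSpace (ψ : E 2 → E 2) {x : E 3} (hx : x ∈ slitSpace) :
    layerMap ψ x ∈ slitSpace := by
  have h := mul_pos (norm_pos_iff.2 (ne_zero_of_mem_slitSpace hx))
    (one_add_invStereo_pos (ψ (stereo x)))
  rw [slitSpace, mem_ofPred_eq, norm_layerMap, layerMap_of_mem ψ hx]
  simpa [mul_add] using h

theorem stereo_layerMap (ψ : E 2 → E 2) {x : E 3} (hx : x ∈ slitSpace) :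
    stereo (layerMap ψ x) = ψ (stereo x) := by
  rw [layerMap_of_mem ψ hx, stereo_smul (norm_pos_iff.2 (ne_zero_of_mem_slitSpace hx)),
    stereo_invStereo]

theorem layerMap_layerMap (φ ψ : E 2 → E 2) (x : E 3) :
    layerMap φ (layerMap ψ x) = layerMap (φ ∘ ψ) x := by
  by_cases hx : x ∈ slitSpace
  · rw [layerMap_of_mem φ (layerMap_mem_slitSpace ψ hx), norm_layerMap, stereo_layerMap ψ hx,
      layerMap_of_mem _ hx, Function.comp]
  · rw [layerMap_of_notMem ψ hx, layerMap_of_notMem φ hx, layerMap_of_notMem _ hx]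

theorem layerMap_of_stereo_eq {ψ : E 2 → E 2} {x : E 3} (h : ψ (stereo x) = stereo x) :
    layerMap ψ x = x := by
  by_cases hx : x ∈ slitSpace
  · rw [layerMap_of_mem ψ hx, h, smul_invStereo_stereo hx]
  · rw [layerMap_of_notMem ψ hx]

theorem smul_mem_slitSpace {c : ℝ} (hc : 0 < c) {x : E 3} :
    c • x ∈ slitSpace ↔ x ∈ slitSpace := by
  have : ‖c • x‖ + (c • x) 2 = c * (‖x‖ + x 2) := by
    rw [norm_smul, Real.norm_of_nonneg hc.le]; simp [mul_add]
  rw [slitSpace, mem_ofPred_eq, mem_ofPred_eq, this, mul_pos_iff_of_pos_left hc]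

theorem layerMap_smul (ψ : E 2 → E 2) {c : ℝ} (hc : 0 < c) (x : E 3) :
    layerMap ψ (c • x) = c • layerMap ψ x := by
  by_cases hx : x ∈ slitSpace
  · rw [layerMap_of_mem ψ hx, layerMap_of_mem ψ ((smul_mem_slitSpace hc).2 hx), stereo_smul hc,
      norm_smul, Real.norm_of_nonneg hc.le, smul_smul]
  · rw [layerMap_of_notMem ψ hx, layerMap_of_notMem ψ (mt (smul_mem_slitSpace hc).1 hx)]

/-- On the unit sphere at height `η` one has `|z|² = (1 - η) / (1 + η)`, which is at least 3 exactly
for `-1 < η ≤ -1/2`; this matches the radius `√3` of the cutoff. -/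
theorem three_le_norm_stereo {x : E 3} (hx : x ∈ slitSpace) (h : ‖x‖ + 2 * x 2 ≤ 0) :
    3 ≤ ‖stereo x‖ ^ 2 := by
  have hx' : 0 < ‖x‖ + x 2 := hx
  have hn : ‖x‖ ^ 2 = x 0 ^ 2 + x 1 ^ 2 + x 2 ^ 2 := by
    rw [EuclideanSpace.real_norm_sq_eq, Fin.sum_univ_three]
  have : ‖stereo x‖ ^ 2 = (x 0 ^ 2 + x 1 ^ 2) / (‖x‖ + x 2) ^ 2 := by
    rw [EuclideanSpace.real_norm_sq_eq, Fin.sum_univ_two]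
    simp [stereo, div_pow, add_div]
  rw [this, le_div_iff₀ (by positivity)]
  nlinarith

/-- The cone on which maps supported in the disc of radius `√3` are the identity. -/
def southCone : Set (E 3) := {x | ‖x‖ + 2 * x 2 < 0}

theorem isOpen_southCone : IsOpen southCone := isOpen_lt (by fun_prop) continuous_const

theorem mem_slitSpace_or_southCone {x : E 3} (hx : x ≠ 0) : x ∈ slitSpace ∨ x ∈ southCone := by
  have := norm_pos_iff.2 hx
  by_contra! h
  simp only [slitSpace, southCone, mem_ofPred_eq, not_lt] at h
  linarith

/-! ### Isotopies of the sphere obtained from isotopies of the plane -/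

section Isotopy

attribute [local irreducible] stereo invStereo

variable {Ψ : ℝ → E 2 → E 2}

theorem PlaneIsotopy.layerMap_eq_self (h : PlaneIsotopy Ψ) (t : ℝ) {x : E 3}
    (hx : ‖x‖ + 2 * x 2 ≤ 0) : layerMap (Ψ t) x = x := by
  by_cases hx' : x ∈ slitSpace
  · exact layerMap_of_stereo_eq (h.eq_self t _ (three_le_norm_stereo hx' hx))
  · exact layerMap_of_notMem _ hx'

/-- Away from the origin two open cones cover space: the slit space, where the stereographic formula
is smooth, and the south cone, where the map is the identity. -/
theorem PlaneIsotopy.contDiffAt_layerMap (h : PlaneIsotopy Ψ) (t : ℝ) {x : E 3} (hx : x ≠ 0) :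
    ContDiffAt ℝ ∞ (fun p : ℝ × E 3 => layerMap (Ψ p.1) p.2) (t, x) := by
  have hN : ContDiffAt ℝ ∞ (fun p : ℝ × E 3 => ‖p.2‖) (t, x) := contDiffAt_snd.norm ℝ hx
  rcases mem_slitSpace_or_southCone hx with hx | hx
  · have hs : ContDiffAt ℝ ∞ (fun p : ℝ × E 3 => stereo p.2) (t, x) :=
      ContDiffAt.comp (g := stereo) (t, x)
        (contDiffOn_stereo.contDiffAt (isOpen_slitSpace.mem_nhds hx)) contDiffAt_snd
    have hΨ : ContDiffAt ℝ ∞ (fun p : ℝ × E 3 => Ψ p.1 (stereo p.2)) (t, x) :=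
      ContDiffAt.comp (g := fun p : ℝ × E 2 => Ψ p.1 p.2) (t, x) h.smooth.contDiffAt
        (contDiffAt_fst.prodMk hs)
    have hm : ContDiffAt ℝ ∞ (fun p : ℝ × E 3 => ‖p.2‖ • invStereo (Ψ p.1 (stereo p.2))) (t, x) :=
      hN.smul (ContDiffAt.comp (g := invStereo) (t, x) contDiff_invStereo.contDiffAt hΨ)
    refine hm.congr_of_eventuallyEq ?_
    filter_upwards [(isOpen_slitSpace.preimage continuous_snd).mem_nhds
      (show (t, x) ∈ Prod.snd ⁻¹' slitSpace from hx)] with p hp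
    exact layerMap_of_mem _ hp
  · refine (contDiffAt_snd (𝕜 := ℝ) (E := ℝ) (F := E 3)).congr_of_eventuallyEq ?_
    filter_upwards [(isOpen_southCone.preimage continuous_snd).mem_nhds
      (show (t, x) ∈ Prod.snd ⁻¹' southCone from hx)] with p hp
    exact h.layerMap_eq_self _ (le_of_lt hp)

/-- The derivative at `x` of the map given by `Ψ` at a time that depends on the radius. -/
theorem PlaneIsotopy.injective_fderiv_layerMap (h : PlaneIsotopy Ψ) {b : ℝ → ℝ}
    (hb : Differentiable ℝ b) {x : E 3} (hx : x ≠ 0) :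
    Function.Injective (fderiv ℝ (fun y => layerMap (Ψ (b ‖y‖)) y) x) := by
  set G : E 3 → E 3 := fun y => layerMap (Ψ (b ‖y‖)) y
  have hN : DifferentiableAt ℝ (fun y : E 3 => ‖y‖) x :=
    (contDiffAt_norm ℝ hx (n := ∞)).differentiableAt (by simp)
  have hbN : DifferentiableAt ℝ (fun y : E 3 => b ‖y‖) x := DifferentiableAt.comp (g := b) x (hb _) hN
  have hG : DifferentiableAt ℝ G x :=
    DifferentiableAt.comp (g := fun p : ℝ × E 3 => layerMap (Ψ p.1) p.2)
      (f := fun y : E 3 => (b ‖y‖, y)) x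
      ((h.contDiffAt_layerMap (b ‖x‖) hx).differentiableAt (by simp))
      (hbN.prodMk differentiableAt_fun_id)
  rcases mem_slitSpace_or_southCone hx with hs | hs
  · rw [injective_iff_map_eq_zero]
    intro v hv
    have hGx : G x ≠ 0 := by
      rw [← norm_pos_iff, norm_layerMap]; exact norm_pos_iff.2 hx
    -- The norm is preserved, so a kernel vector has no radial component. The time `b ‖y‖` is then
    -- stationary along `v`, the immersion property of `Ψ` kills the stereographic component too,
    -- and radius and stereographic coordinate determine the point.
    have hNv : fderiv ℝ (fun y : E 3 => ‖y‖) x v = 0 := by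
      have h1 : HasFDerivAt (fun y => ‖G y‖) _ x :=
        HasFDerivAt.comp (g := fun y : E 3 => ‖y‖) x
          ((contDiffAt_norm ℝ hGx (n := ∞)).differentiableAt (by simp)).hasFDerivAt hG.hasFDerivAt
      rw [show (fun y => ‖G y‖) = fun y => ‖y‖ from funext fun y => norm_layerMap _ y] at h1
      rw [h1.fderiv, ContinuousLinearMap.comp_apply, hv, map_zero]
    have hstereo : ∀ y ∈ slitSpace, DifferentiableAt ℝ stereo y := fun y hy =>
      (contDiffOn_stereo.contDiffAt (isOpen_slitSpace.mem_nhds hy)).differentiableAt (by simp)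
    have hsv : fderiv ℝ stereo x v = 0 := by
      have h1 : HasFDerivAt (fun y => stereo (G y)) _ x :=
        HasFDerivAt.comp (g := stereo) x
          (hstereo _ (layerMap_mem_slitSpace (Ψ (b ‖x‖)) hs)).hasFDerivAt hG.hasFDerivAt
      have h2 : HasFDerivAt (fun y => Ψ (b ‖y‖) (stereo y)) _ x :=
        HasFDerivAt.comp (g := fun p : ℝ × E 2 => Ψ p.1 p.2) x
          ((h.smooth.differentiable (by simp)) _).hasFDerivAt
          (hbN.hasFDerivAt.prodMk (hstereo x hs).hasFDerivAt)
      have h3 : (fun y => stereo (G y)) =ᶠ[𝓝 x] fun y => Ψ (b ‖y‖) (stereo y) := by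
        filter_upwards [isOpen_slitSpace.mem_nhds hs] with y hy using stereo_layerMap _ hy
      have h4 := congrArg (fun L : E 3 →L[ℝ] E 2 => L v) (h1.unique (h2.congr_of_eventuallyEq h3))
      have h5 : HasFDerivAt (fun y : E 3 => b ‖y‖) _ x :=
        HasFDerivAt.comp (g := b) x (hb ‖x‖).hasFDerivAt hN.hasFDerivAt
      have h6 : fderiv ℝ (fun y : E 3 => b ‖y‖) x v = 0 := by
        rw [h5.fderiv, ContinuousLinearMap.comp_apply, hNv, map_zero]
      have h7 : HasFDerivAt (Ψ (b ‖x‖)) _ (stereo x) :=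
        HasFDerivAt.comp (g := fun p : ℝ × E 2 => Ψ p.1 p.2) (stereo x)
          ((h.smooth.differentiable (by simp)) _).hasFDerivAt
          (hasFDerivAt_prodMk_right (b ‖x‖) (stereo x))
      refine h.immersion (b ‖x‖) (stereo x) ?_
      rw [map_zero, h7.fderiv]
      simp only [ContinuousLinearMap.comp_apply, hv, map_zero, ContinuousLinearMap.prod_apply,
        h6] at h4
      simpa using h4.symm
    have h1 : HasFDerivAt (fun y => ‖y‖ • invStereo (stereo y)) _ x :=
      hN.hasFDerivAt.smul (HasFDerivAt.comp (g := invStereo) x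
        ((contDiff_invStereo.differentiable (by simp)) _).hasFDerivAt (hstereo x hs).hasFDerivAt)
    have h2 : (fun y : E 3 => y) =ᶠ[𝓝 x] fun y => ‖y‖ • invStereo (stereo y) := by
      filter_upwards [isOpen_slitSpace.mem_nhds hs] with y hy using (smul_invStereo_stereo hy).symm
    have h3 := congrArg (fun L : E 3 →L[ℝ] E 3 => L v)
      ((h1.congr_of_eventuallyEq h2).unique (hasFDerivAt_id x))
    simpa [hNv, hsv] using h3.symm
  · have hev : G =ᶠ[𝓝 x] id := by
      filter_upwards [isOpen_southCone.mem_nhds hs] with y hy using h.layerMap_eq_self _ (le_of_lt hy)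
    rw [hev.fderiv_eq, fderiv_id]
    exact Function.injective_id

/-- The determinant depends continuously on `s`, never vanishes, and is 1 at `s = 0`. -/
theorem det_fderiv_pos_of_isotopy {n : ℕ} {G : ℝ → E n → E n} {x : E n}
    (hG : ∀ s, ContDiffAt ℝ ∞ (fun p : ℝ × E n => G p.1 p.2) (s, x))
    (hinj : ∀ s, Function.Injective (fderiv ℝ (G s) x)) (h0 : G 0 = id) (s : ℝ) :
    0 < (fderiv ℝ (G s) x).det := by
  have hd : ∀ s, fderiv ℝ (G s) x =
      (fderiv ℝ (fun p : ℝ × E n => G p.1 p.2) (s, x)).comp (.inr ℝ ℝ (E n)) := fun s =>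
    (HasFDerivAt.comp (g := fun p : ℝ × E n => G p.1 p.2) x
      ((hG s).differentiableAt (by simp)).hasFDerivAt (hasFDerivAt_prodMk_right s x)).fderiv
  have hcont : Continuous fun s => (fderiv ℝ (G s) x).det := by
    simp only [hd]
    refine ContinuousLinearMap.continuous_det.comp (Continuous.clm_comp ?_ continuous_const)
    rw [continuous_iff_continuousAt]
    intro s
    exact ContinuousAt.comp (f := fun s : ℝ => (s, x))
      ((hG s).fderiv_right (m := 0) (by simp)).continuousAt (Continuous.prodMk_left x).continuousAt
  have hne : ∀ s, (fderiv ℝ (G s) x).det ≠ 0 := fun s h =>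
    LinearMap.det_eq_zero_iff_ker_ne_bot.1 h (LinearMap.ker_eq_bot.2 (hinj s))
  have hpos : 0 < (fderiv ℝ (G 0) x).det := by
    rw [h0, fderiv_id, ContinuousLinearMap.det, ContinuousLinearMap.coe_id, LinearMap.det_id]
    exact one_pos
  by_contra hneg
  obtain ⟨r, hr⟩ := mem_range_of_exists_le_of_exists_ge hcont ⟨s, not_lt.1 hneg⟩ ⟨0, hpos.le⟩
  exact hne r hr

/-- The inverse maps of an isotopy of the plane. -/
def PlaneIsotopy.inverse (h : PlaneIsotopy Ψ) (t : ℝ) : E 2 → E 2 :=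
  (Equiv.ofBijective _ (h.bijective t)).symm

theorem PlaneIsotopy.layerMap_inverse_left (h : PlaneIsotopy Ψ) (t : ℝ) (x : E 3) :
    layerMap (h.inverse t) (layerMap (Ψ t) x) = x := by
  rw [layerMap_layerMap]
  exact layerMap_of_stereo_eq ((Equiv.ofBijective _ (h.bijective t)).symm_apply_apply _)

theorem PlaneIsotopy.layerMap_inverse_right (h : PlaneIsotopy Ψ) (t : ℝ) (x : E 3) :
    layerMap (Ψ t) (layerMap (h.inverse t) x) = x := by
  rw [layerMap_layerMap]
  exact layerMap_of_stereo_eq ((Equiv.ofBijective _ (h.bijective t)).apply_symm_apply _)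

theorem PlaneIsotopy.contDiffOn_layerMap (h : PlaneIsotopy Ψ) (t : ℝ) :
    ContDiffOn ℝ ∞ (layerMap (Ψ t)) {0}ᶜ := fun x hx =>
  (ContDiffAt.comp (g := fun p : ℝ × E 3 => layerMap (Ψ p.1) p.2) x (h.contDiffAt_layerMap t hx)
    (contDiffAt_const.prodMk contDiffAt_id)).contDiffWithinAt

theorem PlaneIsotopy.contDiffOn_layerMap_inverse (h : PlaneIsotopy Ψ) (t : ℝ) :
    ContDiffOn ℝ ∞ (layerMap (h.inverse t)) {0}ᶜ := by
  refine contDiffOn_of_leftInverse isOpen_compl_singleton (h.contDiffOn_layerMap t)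
    (fun x hx => h.injective_fderiv_layerMap (differentiable_const t) hx)
    (h.layerMap_inverse_left t) (h.layerMap_inverse_right t) fun x hx => ?_
  rw [mem_compl_singleton_iff, ← norm_pos_iff, norm_layerMap]
  exact norm_pos_iff.2 hx

theorem contMDiff_restrict_sphere {f : E (2 + 1) → E (2 + 1)} (hf : ContDiffOn ℝ ∞ f {0}ᶜ)
    (hn : ∀ x, ‖f x‖ = ‖x‖) :
    ContMDiff (𝓡 2) (𝓡 2) ∞ fun u : S 2 => (⟨f u, by
      rw [mem_sphere_zero_iff_norm, hn]; exact mem_sphere_zero_iff_norm.1 u.2⟩ : S 2) := by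
  have : Fact (Module.finrank ℝ (E (2 + 1)) = 2 + 1) := ⟨by simp⟩
  have h : ContMDiff (𝓡 2) 𝓘(ℝ, E (2 + 1)) ∞ fun u : S 2 => f u :=
    hf.contMDiffOn.comp_contMDiff contMDiff_coe_sphere fun u => ne_zero_of_mem_unit_sphere u
  exact h.codRestrict_sphere _

/-- The diffeomorphism of the sphere given by a time of an isotopy of the plane. -/
def PlaneIsotopy.sphereDiffeo (h : PlaneIsotopy Ψ) (t : ℝ) : SphereDiffeo 2 where
  toFun u := ⟨layerMap (Ψ t) u, by
    rw [mem_sphere_zero_iff_norm, norm_layerMap]; exact mem_sphere_zero_iff_norm.1 u.2⟩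
  invFun u := ⟨layerMap (h.inverse t) u, by
    rw [mem_sphere_zero_iff_norm, norm_layerMap]; exact mem_sphere_zero_iff_norm.1 u.2⟩
  left_inv u := Subtype.ext (h.layerMap_inverse_left t u)
  right_inv u := Subtype.ext (h.layerMap_inverse_right t u)
  contMDiff_toFun := contMDiff_restrict_sphere (h.contDiffOn_layerMap t) (norm_layerMap _)
  contMDiff_invFun := contMDiff_restrict_sphere (h.contDiffOn_layerMap_inverse t) (norm_layerMap _)

theorem PlaneIsotopy.coe_sphereDiffeo (h : PlaneIsotopy Ψ) (t : ℝ) (u : S 2) :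
    (h.sphereDiffeo t u : E 3) = layerMap (Ψ t) u := rfl

theorem PlaneIsotopy.layerMap_zero_time (h : PlaneIsotopy Ψ) : layerMap (Ψ 0) = id :=
  funext fun _ => layerMap_of_stereo_eq (h.zero _)

/-- By homogeneity the radial extension is `layerMap` itself, whose determinant is positive through
the isotopy. The support lies at heights at least `-1/2`, away from the pole. -/
theorem PlaneIsotopy.sphereDiffeo_mem (h : PlaneIsotopy Ψ) (t : ℝ) :
    h.sphereDiffeo t ∈ DiffCI := by
  have hsupp : closure {u : S 2 | h.sphereDiffeo t u ≠ u} ⊆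
      {u : S 2 | 0 ≤ ‖(u : E 3)‖ + 2 * (u : E 3) 2} := by
    refine closure_minimal (fun u hu => ?_) (isClosed_le continuous_const (by fun_prop))
    by_contra hneg
    exact hu (Subtype.ext (h.layerMap_eq_self t (not_le.1 hneg).le))
  refine ⟨fun u => ?_, isClosed_closure.isCompact, fun u hu hinf => ?_⟩
  · have hu : (u : E 3) ≠ 0 := ne_zero_of_mem_unit_sphere u
    have hev : radialExtension (h.sphereDiffeo t) =ᶠ[𝓝 (u : E 3)] layerMap (Ψ t) := by
      filter_upwards [isOpen_compl_singleton.mem_nhds hu] with x hx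
      have hx0 : 0 < ‖x‖ := norm_pos_iff.2 hx
      rw [radialExtension, dif_neg (show x ≠ 0 from hx), h.coe_sphereDiffeo, layerMap_smul _ (inv_pos.2 hx0),
        smul_inv_smul₀ hx0.ne']
    rw [hev.fderiv_eq]
    exact det_fderiv_pos_of_isotopy (G := fun t => layerMap (Ψ t))
      (fun s => h.contDiffAt_layerMap s hu)
      (fun s => h.injective_fderiv_layerMap (differentiable_const s) hu) h.layerMap_zero_time t
  · have h1 : 0 ≤ ‖(u : E 3)‖ + 2 * (u : E 3) 2 := hsupp hu
    rw [hinf, norm_infinity] at h1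
    simp only [infinity, PiLp.toLp_apply, Matrix.cons_val] at h1
    norm_num at h1

end Isotopy

end WessZumino

end

noncomputable section

namespace WessZumino

open Set Filter Topology MeasureTheory

/-! ### Extensions to the ball -/

/-- The bijection of the ball given by a pair of mutually inverse norm preserving maps. -/
def normPreservingPerm {n : ℕ} (G G' : E n → E n) (hG : ∀ x, ‖G x‖ = ‖x‖) (hG' : ∀ x, ‖G' x‖ = ‖x‖)
    (hl : ∀ x, G' (G x) = x) (hr : ∀ x, G (G' x) = x) : Equiv.Perm (Ball n) where
  toFun x := ⟨G x, by
    rw [mem_closedBall_zero_iff, hG]; exact mem_closedBall_zero_iff.1 x.2⟩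
  invFun x := ⟨G' x, by
    rw [mem_closedBall_zero_iff, hG']; exact mem_closedBall_zero_iff.1 x.2⟩
  left_inv x := Subtype.ext (hl x)
  right_inv x := Subtype.ext (hr x)

section NormPreserving

variable {n : ℕ} {G G' : E n → E n} {hG : ∀ x, ‖G x‖ = ‖x‖} {hG' : ∀ x, ‖G' x‖ = ‖x‖}
  {hl : ∀ x, G' (G x) = x} {hr : ∀ x, G (G' x) = x}

theorem ext_normPreservingPerm {x : E n} (hx : x ∈ Ball n) :
    ext (normPreservingPerm G G' hG hG' hl hr) x = G x := dif_pos hx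

theorem ext_normPreservingPerm_inv {x : E n} (hx : x ∈ Ball n) :
    ext (normPreservingPerm G G' hG hG' hl hr)⁻¹ x = G' x := dif_pos hx

theorem uniqueDiffOn_ball (n : ℕ) : UniqueDiffOn ℝ (Ball n) :=
  uniqueDiffOn_convex (convex_closedBall _ _) (by
    rw [interior_closedBall _ one_ne_zero]; exact Metric.nonempty_ball.2 one_pos)

theorem normPreservingPerm_mem_diffPlus (hs : ContDiff ℝ ∞ G)
    (hd : ∀ x, 0 < (fderiv ℝ G x).det) :
    normPreservingPerm G G' hG hG' hl hr ∈ DiffPlus n := by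
  have hs' : ContDiffOn ℝ ∞ G' univ := contDiffOn_of_leftInverse isOpen_univ hs.contDiffOn
    (fun x _ => LinearMap.ker_eq_bot.1 (by
      by_contra hne
      exact (hd x).ne' (LinearMap.det_eq_zero_iff_ker_ne_bot.2 hne))) hl hr (mapsTo_univ _ _)
  refine ⟨hs.contDiffOn.congr fun x hx => ext_normPreservingPerm hx,
    (hs'.mono (subset_univ _)).congr fun x hx => ext_normPreservingPerm_inv hx, fun x hx => ?_⟩
  rw [fderivWithin_congr (fun y hy => ext_normPreservingPerm hy) (ext_normPreservingPerm hx),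
    ((hs.differentiable (by simp)) x).fderivWithin (uniqueDiffOn_ball n x hx)]
  exact hd x

end NormPreserving

/-- The time of the isotopy at the radius `r`. -/
def radialTime (s r : ℝ) : ℝ := s * Real.smoothTransition (4 * r ^ 2 - 1)

theorem contDiff_radialTime : ContDiff ℝ ∞ fun p : ℝ × ℝ => radialTime p.1 p.2 :=
  contDiff_fst.mul (Real.smoothTransition.contDiff.comp
    ((contDiff_const.mul (contDiff_snd.pow 2)).sub contDiff_const))

theorem radialTime_zero (r : ℝ) : radialTime 0 r = 0 := zero_mul _

theorem radialTime_of_small (s : ℝ) {r : ℝ} (hr : r ^ 2 ≤ 1 / 4) : radialTime s r = 0 := by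
  rw [radialTime, Real.smoothTransition.zero_of_nonpos (by linarith), mul_zero]

/-- On this range of radii the time is constant in `r`, which yields a radial collar of width `1/4`.
-/
theorem radialTime_of_large (s : ℝ) {r : ℝ} (hr : 3 / 4 ≤ r) : radialTime s r = s := by
  rw [radialTime, Real.smoothTransition.one_of_one_le (by nlinarith), mul_one]

/-! ### Running the isotopy along the radius -/

section BallIsotopy

variable {Ψ : ℝ → E 2 → E 2}

/-- The isotopy of space that runs through `Ψ` along the radius. -/
def spaceIsotopy (Ψ : ℝ → E 2 → E 2) (s : ℝ) (x : E 3) : E 3 :=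
  layerMap (Ψ (radialTime s ‖x‖)) x

theorem norm_spaceIsotopy (Ψ : ℝ → E 2 → E 2) (s : ℝ) (x : E 3) : ‖spaceIsotopy Ψ s x‖ = ‖x‖ :=
  norm_layerMap _ _

theorem PlaneIsotopy.spaceIsotopy_of_small (h : PlaneIsotopy Ψ) (s : ℝ) {x : E 3}
    (hx : ‖x‖ ^ 2 ≤ 1 / 4) : spaceIsotopy Ψ s x = x := by
  rw [spaceIsotopy, radialTime_of_small s hx, h.layerMap_zero_time, id]

theorem PlaneIsotopy.contDiff_spaceIsotopy (h : PlaneIsotopy Ψ) :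
    ContDiff ℝ ∞ fun p : ℝ × E 3 => spaceIsotopy Ψ p.1 p.2 := by
  rw [contDiff_iff_contDiffAt]
  rintro ⟨s, x⟩
  by_cases hx : x = 0
  · refine (contDiffAt_snd (𝕜 := ℝ) (E := ℝ) (F := E 3)).congr_of_eventuallyEq ?_
    have ho : IsOpen {p : ℝ × E 3 | ‖p.2‖ ^ 2 < 1 / 4} :=
      isOpen_lt (by fun_prop) continuous_const
    filter_upwards [ho.mem_nhds (by simp [hx] : (s, x) ∈ {p : ℝ × E 3 | ‖p.2‖ ^ 2 < 1 / 4})]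
      with p hp using h.spaceIsotopy_of_small p.1 (le_of_lt hp)
  · have hN : ContDiffAt ℝ ∞ (fun p : ℝ × E 3 => ‖p.2‖) (s, x) := contDiffAt_snd.norm ℝ hx
    have ht : ContDiffAt ℝ ∞ (fun p : ℝ × E 3 => radialTime p.1 ‖p.2‖) (s, x) :=
      ContDiffAt.comp (g := fun p : ℝ × ℝ => radialTime p.1 p.2)
        (f := fun p : ℝ × E 3 => (p.1, ‖p.2‖)) (s, x) contDiff_radialTime.contDiffAt
        (contDiffAt_fst.prodMk hN)
    exact ContDiffAt.comp (g := fun p : ℝ × E 3 => layerMap (Ψ p.1) p.2)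
      (f := fun p : ℝ × E 3 => (radialTime p.1 ‖p.2‖, p.2)) (s, x)
      (h.contDiffAt_layerMap (radialTime s ‖x‖) hx) (ht.prodMk contDiffAt_snd)

theorem PlaneIsotopy.det_fderiv_spaceIsotopy_pos (h : PlaneIsotopy Ψ) (s : ℝ) (x : E 3) :
    0 < (fderiv ℝ (spaceIsotopy Ψ s) x).det := by
  refine det_fderiv_pos_of_isotopy (G := spaceIsotopy Ψ)
    (fun s => h.contDiff_spaceIsotopy.contDiffAt) (fun s => ?_) (funext fun x => ?_) s
  · by_cases hx : x = 0
    · have hev : spaceIsotopy Ψ s =ᶠ[𝓝 x] id := by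
        have ho : IsOpen {x : E 3 | ‖x‖ ^ 2 < 1 / 4} := isOpen_lt (by fun_prop) continuous_const
        filter_upwards [ho.mem_nhds (by simp [hx] : x ∈ {x : E 3 | ‖x‖ ^ 2 < 1 / 4})] with y hy
          using h.spaceIsotopy_of_small s (le_of_lt hy)
      rw [hev.fderiv_eq, fderiv_id]
      exact Function.injective_id
    · have hb : ContDiff ℝ ∞ (radialTime s) :=
        contDiff_radialTime.comp (contDiff_const.prodMk contDiff_id)
      exact h.injective_fderiv_layerMap (hb.differentiable (by simp)) hx
  · rw [spaceIsotopy, radialTime_zero, h.layerMap_zero_time]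

/-- The isotopy of the ball that runs through `Ψ` along the radius. -/
def PlaneIsotopy.ballIsotopy (h : PlaneIsotopy Ψ) (s : ℝ) : Equiv.Perm (Ball 3) :=
  normPreservingPerm (spaceIsotopy Ψ s) (spaceIsotopy h.inverse s) (norm_spaceIsotopy Ψ s)
    (norm_spaceIsotopy h.inverse s)
    (fun x => by
      rw [spaceIsotopy, norm_spaceIsotopy]; exact h.layerMap_inverse_left _ x)
    (fun x => by
      rw [spaceIsotopy, norm_spaceIsotopy]; exact h.layerMap_inverse_right _ x)

theorem PlaneIsotopy.ext_ballIsotopy (h : PlaneIsotopy Ψ) (s : ℝ) {x : E 3} (hx : x ∈ Ball 3) :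
    ext (h.ballIsotopy s) x = spaceIsotopy Ψ s x := ext_normPreservingPerm hx

theorem PlaneIsotopy.ext_ballIsotopy_smul (h : PlaneIsotopy Ψ) (s : ℝ) {ρ : ℝ}
    (hρ : ρ ∈ Icc (0 : ℝ) 1) (u : S 2) :
    ext (h.ballIsotopy s) (ρ • (u : E 3)) = ρ • (h.sphereDiffeo (radialTime s ρ) u : E 3) := by
  have hu : ‖(u : E 3)‖ = 1 := mem_sphere_zero_iff_norm.1 u.2
  have hn : ‖ρ • (u : E 3)‖ = ρ := by rw [norm_smul, hu, mul_one, Real.norm_of_nonneg hρ.1]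
  rw [h.ext_ballIsotopy s (smul_unit_mem_ball hρ.1 hρ.2 hu), spaceIsotopy, hn, h.coe_sphereDiffeo]
  rcases hρ.1.eq_or_lt with h0 | h0
  · rw [← h0, zero_smul, zero_smul]
    exact norm_eq_zero.1 (by rw [norm_layerMap, norm_zero])
  · exact layerMap_smul _ h0 _

theorem PlaneIsotopy.ballIsotopy_mem (h : PlaneIsotopy Ψ) (s : ℝ) :
    h.ballIsotopy s ∈ BallDiffStar := by
  have hs : ContDiff ℝ ∞ (spaceIsotopy Ψ s) :=
    ContDiff.comp (g := fun p : ℝ × E 3 => spaceIsotopy Ψ p.1 p.2) (f := fun x : E 3 => (s, x))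
      h.contDiff_spaceIsotopy (contDiff_prodMk_right s)
  have hD : h.ballIsotopy s ∈ DiffPlus 3 :=
    normPreservingPerm_mem_diffPlus hs (h.det_fderiv_spaceIsotopy_pos s)
  refine ⟨⟨hD, h.sphereDiffeo s, 1 / 4, by norm_num, fun ρ hρ u => ?_⟩, hD,
    fun ρ => h.sphereDiffeo (radialTime s ρ), fun ρ hρ => ⟨h.sphereDiffeo_mem _, fun u =>
      h.ext_ballIsotopy_smul s hρ u⟩⟩
  rw [h.ext_ballIsotopy_smul s ⟨by linarith [hρ.1], hρ.2⟩ u,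
    radialTime_of_large s (by linarith [hρ.1])]

/-- Scaling the radial time by `s` gives the isotopy to the identity, each stage being again layered
and radial near the boundary. -/
theorem PlaneIsotopy.ballIsotopy_mem_zero (h : PlaneIsotopy Ψ) :
    h.ballIsotopy 1 ∈ BallDiffStarZero := by
  refine ⟨h.ballIsotopy, fun s _ => h.ballIsotopy_mem s, Equiv.ext fun x => Subtype.ext ?_, rfl, ?_⟩
  · change layerMap (Ψ (radialTime 0 ‖(x : E 3)‖)) x = x
    rw [radialTime_zero, h.layerMap_zero_time, id]
  · have hs : ContDiff ℝ ∞ fun p : E 3 × ℝ => spaceIsotopy Ψ p.2 p.1 :=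
      ContDiff.comp (g := fun p : ℝ × E 3 => spaceIsotopy Ψ p.1 p.2)
        (f := fun p : E 3 × ℝ => (p.2, p.1)) h.contDiff_spaceIsotopy
        (contDiff_snd.prodMk contDiff_fst)
    exact hs.contDiffOn.congr fun p hp => h.ext_ballIsotopy p.2 hp.1

end BallIsotopy

/-- The boundary value of every element of `ℋ` extends to the ball. -/
theorem extensions_nonempty {h : Equiv.Perm (Ball 2)} (hh : h ∈ GroupH) :
    (extensions h).Nonempty := by
  obtain ⟨Ψ, hΨ, hin, hout⟩ := exists_planeIsotopy hh
  refine ⟨hΨ.ballIsotopy 1, hΨ.ballIsotopy_mem_zero, fun u hu => ?_⟩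
  have hu1 : ‖u‖ = 1 := mem_sphere_zero_iff_norm.1 hu
  rw [hΨ.ext_ballIsotopy 1 (Metric.sphere_subset_closedBall hu), spaceIsotopy, hu1,
    radialTime_of_large 1 (by norm_num), extendToSphere]
  split_ifs with hmem
  · obtain ⟨z, hz, rfl⟩ := hmem
    have hs : invStereo z ∈ slitSpace := by
      rw [slitSpace, mem_ofPred_eq, hu1]; exact one_add_invStereo_pos z
    rw [layerMap_of_mem _ hs, hu1, one_smul, stereo_invStereo,
      hin z (Metric.ball_subset_closedBall hz)]
  -- Outside the disc `Ψ 1` is the identity, and the remaining point, the pole, is fixed by the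
  -- definition of `layerMap`.
  · by_cases hs : u ∈ slitSpace
    · refine layerMap_of_stereo_eq (hout _ ?_)
      by_contra hlt
      refine hmem ⟨stereo u, mem_ball_zero_iff.2 (not_le.1 hlt), ?_⟩
      have h1 := smul_invStereo_stereo hs
      rwa [hu1, one_smul] at h1
    · exact layerMap_of_notMem _ hs

/-- Existence holds because all extensions share their boundary value, uniqueness because at least
one extension exists. -/
theorem existsUnique_wessZumino (c₀ : ℝ) : ∃! ω₀ : GroupH → ℝ,
    ∀ h : GroupH, ∀ g ∈ extensions h.1, ω₀ h = c₀ * W g := by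
  choose e he using fun h : GroupH => extensions_nonempty h.2
  refine ⟨fun h => c₀ * W (e h), fun h g hg => ?_, fun w hw => funext fun h => hw h _ (he h)⟩
  change c₀ * W (e h) = c₀ * W g
  rw [W_eq_of_boundary_eq (he h).1 hg.1 fun u hu => ((he h).2 u hu).trans (hg.2 u hu).symm]

end WessZumino

end

theorem proposition5p12 :
    -- the integral that defines `W` converges on `Diff_{+*}(ball)₀`
    (∀ g ∈ WessZumino.BallDiffStarZero,
      MeasureTheory.IntegrableOn (WessZumino.density g) WessZumino.coordDomain
        MeasureTheory.volume) ∧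
    -- `W` vanishes on the boundary-trivial elements
    (∀ h ∈ WessZumino.boundaryTrivial WessZumino.BallDiffStarZero, WessZumino.W h = 0) ∧
    -- `W` depends only on the boundary value
    (∀ g₁ ∈ WessZumino.BallDiffStarZero, ∀ g₂ ∈ WessZumino.BallDiffStarZero,
      (∀ u ∈ Metric.sphere (0 : WessZumino.E 3) 1,
        WessZumino.ext g₁ u = WessZumino.ext g₂ u) →
      WessZumino.W g₁ = WessZumino.W g₂) ∧
    -- `ω₀` is well defined on `ℋ`, as a real-valued function
    (∀ h ∈ WessZumino.GroupH, (WessZumino.extensions h).Nonempty) ∧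
    (∀ c₀ : ℝ, ∃! ω₀ : WessZumino.GroupH → ℝ,
      ∀ h : WessZumino.GroupH, ∀ g ∈ WessZumino.extensions h.1,
        ω₀ h = c₀ * WessZumino.W g) :=
  ⟨fun _ hg => WessZumino.integrableOn_density hg, fun _ hh => WessZumino.W_eq_zero hh,
    fun _ h₁ _ h₂ h => WessZumino.W_eq_of_boundary_eq h₁ h₂ h,
    fun _ hh => WessZumino.extensions_nonempty hh, WessZumino.existsUnique_wessZumino⟩
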